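/- Let $(X,d)$ be a complete separable metric space, let $m\ge 0$ be a Borel measure on $X$ that is finite on bounded sets, and let $p,q\in(1,\infty)$ satisfy $\frac1p+\frac1q=1$. Sobolev functions. Let $\mathrm{LIP}_{bs}(X)$ be the space of real Lipschitz functions with bounded support, and $\mathrm{lip}(u)(x)=\limsup_{y\to x}|u(x)-u(y)|/d(x,y)$ the slope ($0$ at isolated points). $W^{1,p}(X)$ is the space of $f\in L^p(m)$ for which there are $u_n\in\mathrm{LIP}_{bs}(X)$ with $u_n\to f$ in $L^p(m)$ and $\liminf_n\int\mathrm{lip}(u_n)^p\,dm<\infty$, with norm $\big(\|f\|_{L^p(m)}^p+\inf\liminf_n\int\mathrm{lip}(u_n)^p\,dm\big)^{1/p}$, the infimum being over all sequences $(u_n)\subseteq\mathrm{LIP}_{bs}(X)$ with $u_n\to f$ in $L^p(m)$. For $f\in W^{1,p}(X)$, $|Df|_p\in L^p(m)$ denotes the minimal $p$-relaxed slope, i.e. the $m$-a.e. smallest among the $L^p(m)$-limits of functions $G_n\ge \mathrm{lip}(u_n)$ with $(u_n)\subseteq\mathrm{LIP}_{bs}(X)$, $u_n\to f$ in $L^p(m)$.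 Normed modules. An $L^p(\mu)$-normed $L^\infty(\mu)$-module is an $L^\infty(\mu)$-module $\mathscr M$ with a pointwise norm $|\cdot|:\mathscr M\to L^p(\mu)$ such that, $\mu$-a.e., $|v|\ge0$, $|v|=0$ iff $v=0$, $|gv|=|g||v|$, $|v+w|\le|v|+|w|$, and such that $\||v|\|_{L^p(\mu)}$ is a complete norm. Its dual $\mathscr M^*$ is the set of continuous $L^\infty(\mu)$-linear maps $T:\mathscr M\to L^1(\mu)$, with $|T|=\operatorname{ess\,sup}\{|T(v)|:|v|\le1\}\in L^q(\mu)$, and $\mathsf{Dual}(v)=\{\omega\in\mathscr M^*:\omega(v)=|v|^p=|\omega|^q\ \mu\text{-a.e.}\}$. The cotangent module $L^p(T^*X)$ is the $L^p(m)$-normed module with a linear map $d_p:W^{1,p}(X)\to L^p(T^*X)$ such that $|d_pf|=|Df|_p$ and the finite sums $\sum_i g_i\,d_pf_i$, $g_i\in L^\infty(m)$, are dense. If $\varphi$ is measurable with $\varphi_\#\mu\le C m$, the pullback $\varphi^*\mathscr M$ of an $L^p(m)$-normed module $\mathscr M$ is the $L^p(\mu)$-normed module with a linear map $\varphi^*:\mathscr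 M\to\varphi^*\mathscr M$ such that $|\varphi^*v|=|v|\circ\varphi$ and the finite sums $\sum_i g_i\,\varphi^*v_i$, $g_i\in L^\infty(\mu)$, are dense. Test plans. Let $e_t(\gamma)=\gamma_t$ on $C([0,1],X)$. For $t\in(0,1]$ put $E_{q,t}(\gamma)=t\big(\frac1t\int_0^t|\dot\gamma_s|^q\,ds\big)^{1/q}$ if $\gamma$ is absolutely continuous with metric speed $|\dot\gamma|\in L^q(0,1)$, and $E_{q,t}(\gamma)=\infty$ otherwise. A $q$-test plan is a Borel probability measure $\pi$ on $C([0,1],X)$ such that $(e_t)_\#\pi\le Cm$ for all $t\in[0,1]$, for some constant $C>0$, and $\int E_{q,1}^q\,d\pi<\infty$. It $q$-represents the gradient of $f\in W^{1,p}(X)$ if $$\frac{f\circ e_t-f\circ e_0}{E_{q,t}}\to|Df|_p\circ e_0\quad\text{and}\quad\Big(\frac{E_{q,t}}t\Big)^{q/p}\to|Df|_p\circ e_0\qquad\text{strongly in }L^p(\pi)\text{ as }t\searrow0,$$ with the convention $0/0=0$ in the first quotient. Proposition. Suppose that $W^{1,p}(X)$ is separable, let $f\in W^{1,p}(X)$,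 and let $\pi$ be a $q$-test plan that $q$-represents the gradient of $f$. Then every sequence $t_i\in(0,1]$ with $t_i\to0$ has a subsequence $(t_{i_j})_j$ for which there is an element $\eta\in\mathsf{Dual}(e_0^*d_pf)\subseteq\big(e_0^*L^p(T^*X)\big)^*$ such that $$\frac{g\circ e_{t_{i_j}}-g\circ e_0}{t_{i_j}}\rightharpoonup\eta(e_0^*d_pg)\quad\text{weakly in }L^1(\pi)\text{ as }j\to\infty,\qquad\text{for every }g\in W^{1,p}(X).$$ -/

import Mathlib

open MeasureTheory Filter Topology Set UniformSpace
open scoped ENNReal NNReal unitInterval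

set_option linter.unusedSectionVars false

noncomputable section

namespace NormedModules

variable {Ω : Type*} [MeasurableSpace Ω] {μ : Measure Ω}

/-! ### The ring `L^∞(μ)` and its action on `L^p(μ)` -/

/-- Pointwise a.e. multiplication `L^∞(μ) × L^p(μ) → L^p(μ)`. -/
def mulLp (μ : Measure Ω) (p : ℝ≥0∞) [Fact (1 ≤ p)] :
    Lp ℝ ∞ μ →L[ℝ] Lp ℝ p μ →L[ℝ] Lp ℝ p μ :=
  (ContinuousLinearMap.mul ℝ ℝ).holderL μ ∞ p p

theorem coeFn_mulLp {p : ℝ≥0∞} [Fact (1 ≤ p)] (g : Lp ℝ ∞ μ) (f : Lp ℝ p μ) :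
    mulLp μ p g f =ᵐ[μ] fun x => g x * f x := by
  simpa [mulLp] using (ContinuousLinearMap.mul ℝ ℝ).coeFn_holder (r := p) g f

theorem norm_mulLp_le {p : ℝ≥0∞} [Fact (1 ≤ p)] (g : Lp ℝ ∞ μ) (f : Lp ℝ p μ) :
    ‖mulLp μ p g f‖ ≤ ‖g‖ * ‖f‖ := by
  have := (ContinuousLinearMap.mul ℝ ℝ).norm_holder_apply_apply_le (r := p) g f
  simpa [mulLp] using this

/-- The constant function `1` in `L^∞(μ)`. -/
def oneLinf (μ : Measure Ω) : Lp ℝ ∞ μ := (memLp_top_const (1 : ℝ)).toLp _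

theorem coeFn_oneLinf : oneLinf μ =ᵐ[μ] fun _ => (1 : ℝ) := MemLp.coeFn_toLp _

/-- `L^∞(μ)` is a commutative ring under pointwise a.e. multiplication. -/
instance : CommRing (Lp ℝ ∞ μ) where
  __ := (inferInstance : AddCommGroup (Lp ℝ ∞ μ))
  mul f g := mulLp μ ∞ f g
  one := oneLinf μ
  left_distrib f g h := map_add (mulLp μ ∞ f) g h
  right_distrib f g h := by
    change mulLp μ ∞ (f + g) h = mulLp μ ∞ f h + mulLp μ ∞ g h
    simp
  zero_mul f := by
    change mulLp μ ∞ 0 f = 0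
    simp
  mul_zero f := by
    change mulLp μ ∞ f 0 = 0
    simp
  mul_assoc f g h := by
    change mulLp μ ∞ (mulLp μ ∞ f g) h = mulLp μ ∞ f (mulLp μ ∞ g h)
    apply Lp.ext
    filter_upwards [coeFn_mulLp (mulLp μ ∞ f g) h, coeFn_mulLp f g,
      coeFn_mulLp f (mulLp μ ∞ g h), coeFn_mulLp g h] with x h1 h2 h3 h4
    rw [h1, h2, h3, h4, mul_assoc]
  one_mul f := by
    change mulLp μ ∞ (oneLinf μ) f = f
    apply Lp.ext
    filter_upwards [coeFn_mulLp (oneLinf μ) f, coeFn_oneLinf (μ := μ)] with x h1 h2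
    rw [h1, h2, one_mul]
  mul_one f := by
    change mulLp μ ∞ f (oneLinf μ) = f
    apply Lp.ext
    filter_upwards [coeFn_mulLp f (oneLinf μ), coeFn_oneLinf (μ := μ)] with x h1 h2
    rw [h1, h2, mul_one]
  mul_comm f g := by
    change mulLp μ ∞ f g = mulLp μ ∞ g f
    apply Lp.ext
    filter_upwards [coeFn_mulLp f g, coeFn_mulLp g f] with x h1 h2
    rw [h1, h2, mul_comm]

theorem linf_mul_def (f g : Lp ℝ ∞ μ) : f * g = mulLp μ ∞ f g := rfl

theorem linf_one_def : (1 : Lp ℝ ∞ μ) = oneLinf μ := rfl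

/-! ### Normed modules -/

/-- An `L^p(μ)`-normed `L^∞(μ)`-module. -/
class LpNormedModule (p : ℝ≥0∞) [Fact (1 ≤ p)] (μ : Measure Ω) (M : Type*)
    [NormedAddCommGroup M] [NormedSpace ℝ M] [Module (Lp ℝ ∞ μ) M] where
  /-- the pointwise norm -/
  pnorm : M → Lp ℝ p μ
  pnorm_nonneg : ∀ v, 0 ≤ pnorm v
  pnorm_eq_zero_iff : ∀ v, pnorm v = 0 ↔ v = 0
  pnorm_smul : ∀ (g : Lp ℝ ∞ μ) (v : M), pnorm (g • v) = mulLp μ p |g| (pnorm v)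
  pnorm_add_le : ∀ v w, pnorm (v + w) ≤ pnorm v + pnorm w
  norm_eq : ∀ v, ‖v‖ = ‖pnorm v‖
  complete : CompleteSpace M
  /-- real scalars act as constant functions -/
  smul_const : ∀ (c : ℝ) (v : M), (c • (1 : Lp ℝ ∞ μ)) • v = c • v


/-! ### The normed module generated by a pointwise seminorm -/

/-- A sublinear, absolutely homogeneous map from a real vector space to `L^p(μ)`. -/
structure PtSeminorm (p : ℝ≥0∞) (μ : Measure Ω) (V : Type*) [AddCommGroup V] [Module ℝ V] where
  /-- the underlying map -/
  toFun : V → Lp ℝ p μ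
  add_le : ∀ v w, toFun (v + w) ≤ toFun v + toFun w
  smul_eq : ∀ (c : ℝ) v, toFun (c • v) = |c| • toFun v

variable {p : ℝ≥0∞} {V : Type*} [AddCommGroup V] [Module ℝ V]

namespace PtSeminorm

theorem map_zero (ψ : PtSeminorm p μ V) : ψ.toFun 0 = 0 := by
  simpa using ψ.smul_eq 0 0

theorem nonneg (ψ : PtSeminorm p μ V) (v : V) : 0 ≤ ψ.toFun v := by
  have h := ψ.add_le v ((-1 : ℝ) • v)
  rw [ψ.smul_eq] at h
  simp only [neg_smul, one_smul, add_neg_cancel, abs_neg, abs_one, ψ.map_zero] at h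
  rw [← Lp.coeFn_nonneg]
  rw [← Lp.coeFn_nonneg] at h
  filter_upwards [h, Lp.coeFn_add (ψ.toFun v) (ψ.toFun v)] with x h1 h2
  rw [h2] at h1
  simp only [Pi.zero_apply, Pi.add_apply] at h1 ⊢
  linarith

end PtSeminorm

/-- Simple forms `∑ χ_{A_i} v_i` with `(A_i)` a finite measurable partition, as the vector space of
simple functions with values in `V`, to be seminormed by `ψ`. -/
def SimpleForm (_ψ : PtSeminorm p μ V) : Type _ := SimpleFunc Ω V

namespace SimpleForm

variable (ψ : PtSeminorm p μ V)

instance : AddCommGroup (SimpleForm ψ) := inferInstanceAs (AddCommGroup (SimpleFunc Ω V))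

instance : Module ℝ (SimpleForm ψ) := inferInstanceAs (Module ℝ (SimpleFunc Ω V))

variable {ψ}

/-- The underlying function. -/
def fn (s : SimpleForm ψ) : Ω → V := fun x => (show SimpleFunc Ω V from s) x

theorem fn_finite (s : SimpleForm ψ) : (Set.range s.fn).Finite :=
  SimpleFunc.finite_range (show SimpleFunc Ω V from s)

theorem fn_add (s t : SimpleForm ψ) (x : Ω) : (s + t).fn x = s.fn x + t.fn x := rfl

theorem fn_smul (c : ℝ) (s : SimpleForm ψ) (x : Ω) : (c • s).fn x = c • s.fn x := rfl

theorem ext_fn {s t : SimpleForm ψ} (h : ∀ x, s.fn x = t.fn x) : s = t :=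
  SimpleFunc.ext h

theorem memLp_pn (s : SimpleForm ψ) : MemLp (fun x => ψ.toFun (s.fn x) x) p μ := by
  classical
  let s' : SimpleFunc Ω V := s
  have : (fun x => ψ.toFun (s.fn x) x) =
      fun x => ∑ v ∈ s'.range, (s' ⁻¹' {v}).indicator (ψ.toFun v) x := by
    funext x
    rw [Finset.sum_eq_single (s' x)]
    · simp [Set.indicator, fn, s']
    · intro v _ hv
      simp [Set.indicator, Ne.symm hv]
    · intro h
      exact absurd (s'.mem_range_self x) h
  rw [this]
  exact memLp_finsetSum _ fun v _ => (Lp.memLp _).indicator (s'.measurableSet_fiber v)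

/-- The pointwise norm `|∑ χ_{A_i} v_i| = ∑ χ_{A_i} ψ(v_i)` of a simple form. -/
def pn (s : SimpleForm ψ) : Lp ℝ p μ := (memLp_pn s).toLp _

theorem coeFn_pn (s : SimpleForm ψ) : pn s =ᵐ[μ] fun x => ψ.toFun (s.fn x) x :=
  MemLp.coeFn_toLp _

theorem pn_nonneg (s : SimpleForm ψ) : 0 ≤ pn s := by
  rw [← Lp.coeFn_nonneg]
  have h : ∀ᵐ x ∂μ, ∀ v ∈ Set.range s.fn, 0 ≤ ψ.toFun v x :=
    (ae_ball_iff s.fn_finite.countable).2 fun v _ => (Lp.coeFn_nonneg _).2 (ψ.nonneg v)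
  filter_upwards [h, coeFn_pn s] with x h1 h2
  rw [h2]
  exact h1 _ ⟨x, rfl⟩

theorem pn_add_le (s t : SimpleForm ψ) : pn (s + t) ≤ pn s + pn t := by
  rw [← Lp.coeFn_le]
  have h : ∀ᵐ x ∂μ, ∀ v ∈ Set.range s.fn, ∀ w ∈ Set.range t.fn,
      ψ.toFun (v + w) x ≤ ψ.toFun v x + ψ.toFun w x := by
    refine (ae_ball_iff s.fn_finite.countable).2 fun v _ =>
      (ae_ball_iff t.fn_finite.countable).2 fun w _ => ?_
    filter_upwards [(Lp.coeFn_le _ _).2 (ψ.add_le v w),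
      Lp.coeFn_add (ψ.toFun v) (ψ.toFun w)] with x h1 h2
    rw [h2] at h1
    exact h1
  filter_upwards [h, coeFn_pn s, coeFn_pn t, coeFn_pn (s + t), Lp.coeFn_add (pn s) (pn t)]
    with x h1 h2 h3 h4 h5
  rw [h4, h5, Pi.add_apply, h2, h3, fn_add]
  exact h1 _ ⟨x, rfl⟩ _ ⟨x, rfl⟩

/-- Multiplication of a simple form by a real simple function. -/
def mulSimple (a : SimpleFunc Ω ℝ) (s : SimpleForm ψ) : SimpleForm ψ :=
  (a.pair (show SimpleFunc Ω V from s)).map fun q => q.1 • q.2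

theorem fn_mulSimple (a : SimpleFunc Ω ℝ) (s : SimpleForm ψ) (x : Ω) :
    (mulSimple a s).fn x = a x • s.fn x := rfl

theorem coeFn_pn_mulSimple (a : SimpleFunc Ω ℝ) (s : SimpleForm ψ) :
    pn (mulSimple a s) =ᵐ[μ] fun x => |a x| * pn s x := by
  have h : ∀ᵐ x ∂μ, ∀ c ∈ Set.range a, ∀ v ∈ Set.range s.fn,
      ψ.toFun (c • v) x = |c| * ψ.toFun v x := by
    refine (ae_ball_iff a.finite_range.countable).2 fun c _ =>
      (ae_ball_iff s.fn_finite.countable).2 fun v _ => ?_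
    rw [ψ.smul_eq]
    exact Lp.coeFn_smul _ _
  filter_upwards [h, coeFn_pn s, coeFn_pn (mulSimple a s)] with x h1 h2 h3
  rw [h2, h3, fn_mulSimple]
  exact h1 _ ⟨x, rfl⟩ _ ⟨x, rfl⟩

theorem pn_smul (c : ℝ) (s : SimpleForm ψ) : pn (c • s) = |c| • pn s := by
  have h : c • s = mulSimple (SimpleFunc.const Ω c) s := rfl
  rw [h]
  apply Lp.ext
  filter_upwards [coeFn_pn_mulSimple (SimpleFunc.const Ω c) s, Lp.coeFn_smul |c| (pn s)]
    with x h1 h2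
  rw [h1, h2]
  simp

theorem pn_zero : pn (0 : SimpleForm ψ) = 0 := by
  simpa using pn_smul 0 (0 : SimpleForm ψ)

theorem pn_neg (s : SimpleForm ψ) : pn (-s) = pn s := by
  simpa using pn_smul (-1) s

variable [Fact (1 ≤ p)]

instance : SeminormedAddCommGroup (SimpleForm ψ) :=
  AddGroupSeminorm.toSeminormedAddCommGroup
    { toFun := fun s => ‖pn s‖
      map_zero' := by simp [pn_zero]
      add_le' := fun s t => by
        refine le_trans (norm_le_norm_of_abs_le_abs ?_) (norm_add_le (pn s) (pn t))
        rw [abs_of_nonneg (pn_nonneg _), abs_of_nonneg (add_nonneg (pn_nonneg _) (pn_nonneg _))]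
        exact pn_add_le s t
      neg' := fun s => by rw [pn_neg] }

theorem norm_def (s : SimpleForm ψ) : ‖s‖ = ‖pn s‖ := rfl

instance : NormedSpace ℝ (SimpleForm ψ) where
  norm_smul_le c s := by rw [norm_def, norm_def, pn_smul, norm_smul]; simp

theorem lipschitz_pn : LipschitzWith 1 (pn (ψ := ψ)) := by
  refine LipschitzWith.of_dist_le_mul fun s t => ?_
  rw [NNReal.coe_one, one_mul, dist_eq_norm, dist_eq_norm, norm_def]
  refine norm_le_norm_of_abs_le_abs ?_
  rw [abs_of_nonneg (pn_nonneg _), abs_le']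
  constructor
  · have := pn_add_le (s - t) t
    rw [sub_add_cancel] at this
    exact sub_le_iff_le_add.2 this
  · have := pn_add_le (t - s) s
    rw [sub_add_cancel, ← neg_sub s t, pn_neg] at this
    rw [neg_sub]
    exact sub_le_iff_le_add.2 this

end SimpleForm

/-- The inclusion of simple functions in `L^∞(μ)`. -/
def simpleToLinf (μ : Measure Ω) : SimpleFunc Ω ℝ →ₗ[ℝ] Lp ℝ ∞ μ where
  toFun a := (a.memLp_top μ).toLp a
  map_add' a b := MemLp.toLp_add (a.memLp_top μ) (b.memLp_top μ)
  map_smul' c a := MemLp.toLp_const_smul c (a.memLp_top μ)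

theorem coeFn_simpleToLinf (a : SimpleFunc Ω ℝ) : simpleToLinf μ a =ᵐ[μ] a :=
  MemLp.coeFn_toLp (a.memLp_top μ)

theorem denseRange_simpleToLinf : DenseRange (simpleToLinf μ) := by
  intro g
  rw [Metric.mem_closure_iff]
  intro ε hε
  obtain ⟨δ, hδ0, hδε⟩ : ∃ δ : ℝ, 0 < δ ∧ δ < ε := exists_between hε
  obtain ⟨g', hg', hgg'⟩ := (Lp.aestronglyMeasurable g)
  set C : ℝ := ‖g‖ with hC
  have hbd : ∀ᵐ x ∂μ, |g x| ≤ C := by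
    have hfin : eLpNorm g ∞ μ ≠ ∞ := Lp.eLpNorm_ne_top g
    filter_upwards [ae_le_eLpNormEssSup (f := (g : Ω → ℝ)) (μ := μ)] with x hx
    rw [hC, Lp.norm_def, ← Real.norm_eq_abs, ← toReal_enorm]
    refine ENNReal.toReal_mono hfin ?_
    rwa [eLpNorm_exponent_top]
  have hC0 : 0 ≤ C := norm_nonneg g
  let k : Ω → ℤ := fun x => ⌊max (-C) (min C (g' x)) / δ⌋
  have hk : Measurable k := by
    have := hg'.measurable
    fun_prop
  have hkfin : (Set.range k).Finite := by
    refine (Set.finite_Icc ⌊-C / δ⌋ ⌊C / δ⌋).subset ?_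
    rintro _ ⟨x, rfl⟩
    constructor
    · exact Int.floor_le_floor (by gcongr; exact le_max_left _ _)
    · exact Int.floor_le_floor (by gcongr; exact max_le (by linarith) (min_le_left _ _))
  let ks : SimpleFunc Ω ℤ := ⟨k, fun z => hk (measurableSet_singleton z), hkfin⟩
  let a : SimpleFunc Ω ℝ := ks.map fun z : ℤ => δ * (z : ℝ)
  refine ⟨simpleToLinf μ a, ⟨a, rfl⟩, ?_⟩
  rw [dist_eq_norm]
  refine lt_of_le_of_lt ?_ hδε
  rw [Lp.norm_def]
  refine ENNReal.toReal_le_of_le_ofReal hδ0.le ?_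
  rw [eLpNorm_exponent_top]
  refine eLpNormEssSup_le_of_ae_bound ?_
  filter_upwards [hbd, hgg', coeFn_simpleToLinf (μ := μ) a, Lp.coeFn_sub g (simpleToLinf μ a)]
    with x h1 h2 h3 h4
  rw [h4, Pi.sub_apply, h3, Real.norm_eq_abs]
  have hx : max (-C) (min C (g' x)) = g x := by
    rw [← h2]
    rw [abs_le] at h1
    rw [min_eq_right h1.2, max_eq_right h1.1]
  have ha : a x = δ * (⌊g x / δ⌋ : ℝ) := by
    change δ * (⌊max (-C) (min C (g' x)) / δ⌋ : ℝ) = _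
    rw [hx]
  rw [ha]
  have e1 := Int.floor_le (g x / δ)
  have e2 := Int.lt_floor_add_one (g x / δ)
  rw [le_div_iff₀ hδ0] at e1
  rw [div_lt_iff₀ hδ0] at e2
  rw [abs_le]
  constructor <;> nlinarith

variable [Fact (1 ≤ p)]

/-- The `L^p(μ)`-normed `L^∞(μ)`-module generated by `(V, ψ)`: the completion of the space of
simple forms `∑ χ_{A_i} v_i` for the norm `‖∑ χ_{A_i} ψ(v_i)‖_{L^p}`. -/
def GenModule (ψ : PtSeminorm p μ V) : Type _ := Completion (SimpleForm ψ)

namespace GenModule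

variable (ψ : PtSeminorm p μ V)

instance : NormedAddCommGroup (GenModule ψ) :=
  inferInstanceAs (NormedAddCommGroup (Completion (SimpleForm ψ)))

instance : NormedSpace ℝ (GenModule ψ) :=
  inferInstanceAs (NormedSpace ℝ (Completion (SimpleForm ψ)))

instance : CompleteSpace (GenModule ψ) :=
  inferInstanceAs (CompleteSpace (Completion (SimpleForm ψ)))

/-- The canonical map from simple forms to their completion. -/
def incl : SimpleForm ψ →L[ℝ] GenModule ψ := Completion.toComplL

theorem denseRange_incl : DenseRange (incl ψ) := Completion.denseRange_coe

theorem norm_incl (s : SimpleForm ψ) : ‖incl ψ s‖ = ‖s‖ := Completion.norm_coe s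

/-- The pointwise norm on the generated module, extended by continuity from simple forms. -/
def ptNorm : GenModule ψ → Lp ℝ p μ := Completion.extension (SimpleForm.pn (ψ := ψ))

theorem continuous_ptNorm : Continuous (ptNorm ψ) := Completion.continuous_extension

theorem ptNorm_incl (s : SimpleForm ψ) : ptNorm ψ (incl ψ s) = s.pn :=
  Completion.extension_coe SimpleForm.lipschitz_pn.uniformContinuous s

theorem pn_mulSimple (a : SimpleFunc Ω ℝ) (s : SimpleForm ψ) :
    (SimpleForm.mulSimple a s).pn = mulLp μ p |simpleToLinf μ a| s.pn := by
  apply Lp.ext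
  filter_upwards [SimpleForm.coeFn_pn_mulSimple a s, coeFn_mulLp |simpleToLinf μ a| s.pn,
    Lp.coeFn_abs (simpleToLinf μ a), coeFn_simpleToLinf (μ := μ) a] with x h1 h2 h3 h4
  rw [h1, h2, h3, h4]

/-- Multiplication by a simple function, on simple forms. -/
def mulSimpleL (a : SimpleFunc Ω ℝ) : SimpleForm ψ →L[ℝ] SimpleForm ψ :=
  LinearMap.mkContinuous
    { toFun := SimpleForm.mulSimple a
      map_add' := fun s t => SimpleForm.ext_fn fun x => smul_add (a x) (s.fn x) (t.fn x)
      map_smul' := fun c s => SimpleForm.ext_fn fun x => smul_comm (a x) c (s.fn x) }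
    ‖simpleToLinf μ a‖ fun s => by
      change ‖(SimpleForm.mulSimple a s).pn‖ ≤ ‖simpleToLinf μ a‖ * ‖s.pn‖
      rw [pn_mulSimple]
      refine (norm_mulLp_le _ _).trans ?_
      rw [norm_abs_eq_norm]

/-- Extension of multiplication by a simple function to the generated module. -/
def opSimpleAux (a : SimpleFunc Ω ℝ) : GenModule ψ →L[ℝ] GenModule ψ :=
  (incl ψ ∘L mulSimpleL ψ a).toLinearMap.extendOfNorm (incl ψ).toLinearMap

theorem norm_mulSimple_le (a : SimpleFunc Ω ℝ) (s : SimpleForm ψ) :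
    ‖(incl ψ ∘L mulSimpleL ψ a).toLinearMap s‖ ≤
      ‖simpleToLinf μ a‖ * ‖(incl ψ).toLinearMap s‖ := by
  change ‖incl ψ (mulSimpleL ψ a s)‖ ≤ _ * ‖incl ψ s‖
  rw [norm_incl, norm_incl]
  refine ((mulSimpleL ψ a).le_opNorm s).trans ?_
  gcongr
  exact LinearMap.mkContinuous_norm_le _ (norm_nonneg _) _

theorem opSimpleAux_incl (a : SimpleFunc Ω ℝ) (s : SimpleForm ψ) :
    opSimpleAux ψ a (incl ψ s) = incl ψ (SimpleForm.mulSimple a s) :=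
  LinearMap.extendOfNorm_eq (denseRange_incl ψ) ⟨_, norm_mulSimple_le ψ a⟩ s

theorem clm_ext_incl {F : Type*} [TopologicalSpace F] [T2Space F] {f g : GenModule ψ → F}
    (hf : Continuous f) (hg : Continuous g) (h : ∀ s, f (incl ψ s) = g (incl ψ s))
    (v : GenModule ψ) : f v = g v :=
  congrFun ((denseRange_incl ψ).equalizer hf hg (funext h)) v

/-- Multiplication by simple functions, as operators on the generated module. -/
def opSimple : SimpleFunc Ω ℝ →ₗ[ℝ] (GenModule ψ →L[ℝ] GenModule ψ) where
  toFun := opSimpleAux ψ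
  map_add' a b := by
    ext v
    refine clm_ext_incl ψ (f := opSimpleAux ψ (a + b)) (g := opSimpleAux ψ a + opSimpleAux ψ b)
      (by fun_prop) (by fun_prop) (fun s => ?_) v
    change _ = opSimpleAux ψ a (incl ψ s) + opSimpleAux ψ b (incl ψ s)
    have h : SimpleForm.mulSimple (a + b) s =
        SimpleForm.mulSimple a s + SimpleForm.mulSimple b s :=
      SimpleForm.ext_fn fun x => add_smul (a x) (b x) (s.fn x)
    rw [opSimpleAux_incl, opSimpleAux_incl, opSimpleAux_incl, h, map_add]
  map_smul' c a := by
    ext v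
    refine clm_ext_incl ψ (f := opSimpleAux ψ (c • a)) (g := fun w => c • opSimpleAux ψ a w)
      (opSimpleAux ψ (c • a)).continuous ((opSimpleAux ψ a).continuous.const_smul c)
      (fun s => ?_) v
    have h : SimpleForm.mulSimple (c • a) s = c • SimpleForm.mulSimple a s :=
      SimpleForm.ext_fn fun x => by
        rw [SimpleForm.fn_mulSimple, SimpleForm.fn_smul, SimpleForm.fn_mulSimple,
          SimpleFunc.smul_apply, smul_assoc]
    rw [opSimpleAux_incl, opSimpleAux_incl, h, map_smul]

theorem norm_opSimple_le (a : SimpleFunc Ω ℝ) : ‖opSimple ψ a‖ ≤ 1 * ‖simpleToLinf μ a‖ := by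
  rw [one_mul]
  exact LinearMap.opNorm_extendOfNorm_le (denseRange_incl ψ) (norm_nonneg _)
    (norm_mulSimple_le ψ a)

/-- The action of `L^∞(μ)` on the generated module, extended by continuity from simple
functions. -/
def act : Lp ℝ ∞ μ →L[ℝ] (GenModule ψ →L[ℝ] GenModule ψ) :=
  (opSimple ψ).extendOfNorm (simpleToLinf μ)

theorem act_simple (a : SimpleFunc Ω ℝ) (s : SimpleForm ψ) :
    act ψ (simpleToLinf μ a) (incl ψ s) = incl ψ (SimpleForm.mulSimple a s) := by
  have h : act ψ (simpleToLinf μ a) = opSimple ψ a :=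
    LinearMap.extendOfNorm_eq denseRange_simpleToLinf ⟨1, norm_opSimple_le ψ⟩ a
  rw [h]
  exact opSimpleAux_incl ψ a s

theorem ext_simple {F : Type*} [TopologicalSpace F] [T2Space F] {f g : Lp ℝ ∞ μ → F}
    (hf : Continuous f) (hg : Continuous g)
    (h : ∀ a, f (simpleToLinf μ a) = g (simpleToLinf μ a)) (u : Lp ℝ ∞ μ) : f u = g u :=
  congrFun (denseRange_simpleToLinf.equalizer hf hg (funext h)) u

theorem simpleToLinf_mul (a b : SimpleFunc Ω ℝ) :
    simpleToLinf μ (a * b) = simpleToLinf μ a * simpleToLinf μ b := by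
  rw [linf_mul_def]
  apply Lp.ext
  filter_upwards [coeFn_simpleToLinf (μ := μ) (a * b), coeFn_simpleToLinf (μ := μ) a,
    coeFn_simpleToLinf (μ := μ) b, coeFn_mulLp (simpleToLinf μ a) (simpleToLinf μ b)]
    with x h1 h2 h3 h4
  rw [h1, h4, h2, h3]
  rfl

theorem act_one (v : GenModule ψ) : act ψ 1 v = v := by
  refine clm_ext_incl ψ (by fun_prop) continuous_id (fun s => ?_) v
  have h : (1 : Lp ℝ ∞ μ) = simpleToLinf μ (SimpleFunc.const Ω 1) := rfl
  rw [h, act_simple]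
  exact congrArg (incl ψ) (SimpleForm.ext_fn fun x => one_smul ℝ (s.fn x))

theorem act_mul (g h : Lp ℝ ∞ μ) (v : GenModule ψ) : act ψ (g * h) v = act ψ g (act ψ h v) := by
  simp only [linf_mul_def]
  refine clm_ext_incl ψ (f := act ψ (mulLp μ ∞ g h)) (g := fun v => act ψ g (act ψ h v))
    (by fun_prop) (by fun_prop) (fun s => ?_) v
  refine ext_simple (f := fun g => act ψ (mulLp μ ∞ g h) (incl ψ s))
    (g := fun g => act ψ g (act ψ h (incl ψ s))) (by fun_prop) (by fun_prop) (fun a => ?_) g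
  refine ext_simple (f := fun h => act ψ (mulLp μ ∞ (simpleToLinf μ a) h) (incl ψ s))
    (g := fun h => act ψ (simpleToLinf μ a) (act ψ h (incl ψ s)))
    (by fun_prop) (by fun_prop) (fun b => ?_) h
  change act ψ (simpleToLinf μ a * simpleToLinf μ b) (incl ψ s) = _
  rw [← simpleToLinf_mul, act_simple, act_simple, act_simple]
  exact congrArg (incl ψ) (SimpleForm.ext_fn fun x => mul_smul (a x) (b x) (s.fn x))

instance : Module (Lp ℝ ∞ μ) (GenModule ψ) where
  smul g v := act ψ g v
  one_smul := act_one ψ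
  mul_smul := act_mul ψ
  smul_zero g := map_zero (act ψ g)
  smul_add g := map_add (act ψ g)
  add_smul g h v := by
    change act ψ (g + h) v = act ψ g v + act ψ h v
    simp
  zero_smul v := by
    change act ψ 0 v = 0
    simp

theorem smul_def (g : Lp ℝ ∞ μ) (v : GenModule ψ) : g • v = act ψ g v := rfl

/-- The generated module is an `L^p(μ)`-normed `L^∞(μ)`-module. -/
instance : LpNormedModule p μ (GenModule ψ) where
  pnorm := ptNorm ψ
  pnorm_nonneg v := by
    refine (denseRange_incl ψ).induction_on v
      (isClosed_le continuous_const (continuous_ptNorm ψ)) fun s => ?_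
    rw [ptNorm_incl]
    exact s.pn_nonneg
  pnorm_eq_zero_iff v := by
    have h : ‖v‖ = ‖ptNorm ψ v‖ :=
      clm_ext_incl ψ continuous_norm (continuous_ptNorm ψ).norm
        (fun s => by rw [norm_incl, ptNorm_incl]; rfl) v
    rw [← norm_eq_zero, ← h, norm_eq_zero]
  pnorm_smul g v := by
    have hc := continuous_ptNorm ψ
    simp only [smul_def]
    refine clm_ext_incl ψ (f := fun v => ptNorm ψ (act ψ g v))
      (g := fun v => mulLp μ p |g| (ptNorm ψ v)) (by fun_prop) (by fun_prop) (fun s => ?_) v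
    refine ext_simple (f := fun g => ptNorm ψ (act ψ g (incl ψ s)))
      (g := fun g => mulLp μ p |g| (ptNorm ψ (incl ψ s))) (by fun_prop) ?_ (fun a => ?_) g
    · have : Continuous fun g : Lp ℝ ∞ μ => |g| := continuous_id.sup continuous_neg
      fun_prop
    · simp only [act_simple, ptNorm_incl, pn_mulSimple]
  pnorm_add_le v w := by
    have hc := continuous_ptNorm ψ
    refine (denseRange_incl ψ).induction_on₂ (p := fun v w =>
      ptNorm ψ (v + w) ≤ ptNorm ψ v + ptNorm ψ w) ?_ (fun s t => ?_) v w
    · exact isClosed_le (by fun_prop) (by fun_prop)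
    · rw [← map_add, ptNorm_incl, ptNorm_incl, ptNorm_incl]
      exact s.pn_add_le t
  norm_eq v := clm_ext_incl ψ continuous_norm (continuous_ptNorm ψ).norm
    (fun s => by rw [norm_incl, ptNorm_incl]; rfl) v
  complete := inferInstance
  smul_const c v := by
    rw [smul_def, map_smul, smul_apply, act_one]

/-- The canonical linear map from the generating space to the generated module. -/
def gen : V →ₗ[ℝ] GenModule ψ :=
  (incl ψ).toLinearMap ∘ₗ
    { toFun := fun v => (SimpleFunc.const Ω v : SimpleFunc Ω V)
      map_add' := fun _ _ => rfl
      map_smul' := fun _ _ => rfl }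

theorem pnorm_gen (v : V) : LpNormedModule.pnorm (p := p) (μ := μ) (gen ψ v) = ψ.toFun v := by
  refine (ptNorm_incl ψ _).trans (Lp.ext ?_)
  exact SimpleForm.coeFn_pn _

theorem dense_span_gen :
    Dense (Submodule.span (Lp ℝ ∞ μ) (Set.range (gen ψ)) : Set (GenModule ψ)) := by
  classical
  refine Dense.mono ?_ (denseRange_incl ψ)
  rintro _ ⟨s, rfl⟩
  refine SimpleFunc.induction (motive := fun s : SimpleFunc Ω V =>
    incl ψ s ∈ Submodule.span (Lp ℝ ∞ μ) (Set.range (gen ψ))) ?_ ?_ s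
  · intro v A hA
    let a : SimpleFunc Ω ℝ := SimpleFunc.piecewise A hA (SimpleFunc.const Ω 1) (SimpleFunc.const Ω 0)
    have h : incl ψ (SimpleFunc.piecewise A hA (SimpleFunc.const Ω v) (SimpleFunc.const Ω 0)) =
        simpleToLinf μ a • gen ψ v := by
      refine Eq.trans ?_ (act_simple ψ a _).symm
      refine congrArg (incl ψ) (SimpleForm.ext_fn fun x => ?_)
      rw [SimpleForm.fn_mulSimple]
      change A.piecewise (fun _ => v) (fun _ => 0) x = A.piecewise (fun _ => (1 : ℝ)) (fun _ => 0) x • v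
      by_cases hx : x ∈ A <;> simp [hx]
    rw [h]
    exact Submodule.smul_mem _ _ (Submodule.subset_span ⟨v, rfl⟩)
  · intro f g _ hf hg
    have h := Submodule.add_mem _ hf hg
    exact (map_add (incl ψ) (show SimpleForm ψ from f) (show SimpleForm ψ from g)) ▸ h

end GenModule

/-! ### Pullback of a normed module -/

section Pullback

variable {Ω' : Type*} [MeasurableSpace Ω'] {ν : Measure Ω'} {φ : Ω → Ω'}

/-- `φ` is measurable and `φ_# μ ≤ C ν` for some constant `C`. -/
structure BoundedCompression (φ : Ω → Ω') (μ : Measure Ω) (ν : Measure Ω') : Prop where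
  measurable : Measurable φ
  bound : ∃ C : ℝ≥0, μ.map φ ≤ C • ν

theorem BoundedCompression.memLp (h : BoundedCompression φ μ ν) (f : Lp ℝ p ν) :
    MemLp (fun x => f (φ x)) p μ := by
  obtain ⟨C, hC⟩ := h.bound
  have h1 : MemLp f p (μ.map φ) :=
    (Lp.memLp f).of_measure_le_smul (c := (C : ℝ≥0∞)) ENNReal.coe_ne_top hC
  exact h1.comp_of_map h.measurable.aemeasurable

theorem BoundedCompression.quasi (h : BoundedCompression φ μ ν) :
    Measure.QuasiMeasurePreserving φ μ ν := by
  obtain ⟨C, hC⟩ := h.bound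
  exact ⟨h.measurable, (Measure.absolutelyContinuous_of_le hC).trans
    Measure.smul_absolutelyContinuous⟩

/-- The composition `f ↦ f ∘ φ` from `L^p(ν)` to `L^p(μ)`. -/
def compLp (h : BoundedCompression φ μ ν) (f : Lp ℝ p ν) : Lp ℝ p μ := (h.memLp f).toLp _

theorem coeFn_compLp (h : BoundedCompression φ μ ν) (f : Lp ℝ p ν) :
    compLp h f =ᵐ[μ] fun x => f (φ x) := MemLp.coeFn_toLp _

theorem pnorm_real_smul {M : Type*} [NormedAddCommGroup M] [NormedSpace ℝ M]
    [Module (Lp ℝ ∞ ν) M] [LpNormedModule p ν M] (c : ℝ) (v : M) :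
    LpNormedModule.pnorm (p := p) (μ := ν) (c • v) =
      |c| • LpNormedModule.pnorm (p := p) (μ := ν) v := by
  rw [← LpNormedModule.smul_const (p := p) (μ := ν) c v, LpNormedModule.pnorm_smul]
  apply Lp.ext
  filter_upwards [coeFn_mulLp |c • (1 : Lp ℝ ∞ ν)| (LpNormedModule.pnorm (p := p) v),
    Lp.coeFn_abs (c • (1 : Lp ℝ ∞ ν)), Lp.coeFn_smul c (1 : Lp ℝ ∞ ν), coeFn_oneLinf (μ := ν),
    Lp.coeFn_smul |c| (LpNormedModule.pnorm (p := p) (μ := ν) v)] with x h1 h2 h3 h4 h5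
  rw [linf_one_def] at h3
  rw [h1, h2, linf_one_def, h3, h5, Pi.smul_apply, h4, Pi.smul_apply]
  simp

/-- The pointwise seminorm `v ↦ |v| ∘ φ` on an `L^p(ν)`-normed module. -/
def pullbackSeminorm (h : BoundedCompression φ μ ν) (M : Type*) [NormedAddCommGroup M]
    [NormedSpace ℝ M] [Module (Lp ℝ ∞ ν) M] [LpNormedModule p ν M] : PtSeminorm p μ M where
  toFun v := compLp h (LpNormedModule.pnorm (p := p) (μ := ν) v)
  add_le v w := by
    rw [← Lp.coeFn_le]
    filter_upwards [coeFn_compLp h (LpNormedModule.pnorm (p := p) (v + w)),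
      coeFn_compLp h (LpNormedModule.pnorm (p := p) v),
      coeFn_compLp h (LpNormedModule.pnorm (p := p) w),
      Lp.coeFn_add (compLp h (LpNormedModule.pnorm (p := p) v))
        (compLp h (LpNormedModule.pnorm (p := p) w)),
      h.quasi.ae ((Lp.coeFn_le _ _).2 (LpNormedModule.pnorm_add_le (p := p) (μ := ν) v w)),
      h.quasi.ae (Lp.coeFn_add (LpNormedModule.pnorm (p := p) (μ := ν) v)
        (LpNormedModule.pnorm (p := p) w))] with x h1 h2 h3 h4 h5 h6
    rw [h1, h4, Pi.add_apply, h2, h3]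
    rw [h6] at h5
    exact h5
  smul_eq c v := by
    apply Lp.ext
    rw [pnorm_real_smul]
    filter_upwards [coeFn_compLp h (|c| • LpNormedModule.pnorm (p := p) (μ := ν) v),
      coeFn_compLp h (LpNormedModule.pnorm (p := p) v),
      Lp.coeFn_smul |c| (compLp h (LpNormedModule.pnorm (p := p) v)),
      h.quasi.ae (Lp.coeFn_smul |c| (LpNormedModule.pnorm (p := p) (μ := ν) v))]
      with x h1 h2 h3 h4
    rw [h1, h3, Pi.smul_apply, h2, h4, Pi.smul_apply]

variable (p) in
/-- The pullback module `φ^* M`, generated by `M` with the pointwise seminorm `|·| ∘ φ`. -/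
abbrev PullbackModule (h : BoundedCompression φ μ ν) (M : Type*) [NormedAddCommGroup M]
    [NormedSpace ℝ M] [Module (Lp ℝ ∞ ν) M] [LpNormedModule p ν M] : Type _ :=
  GenModule (pullbackSeminorm (p := p) h M)

variable (p) in
/-- The pullback map `φ^* : M → φ^* M`. -/
def pullbackMap (h : BoundedCompression φ μ ν) {M : Type*} [NormedAddCommGroup M]
    [NormedSpace ℝ M] [Module (Lp ℝ ∞ ν) M] [LpNormedModule p ν M] :
    M →ₗ[ℝ] PullbackModule p h M :=
  GenModule.gen (pullbackSeminorm (p := p) h M)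

/-- `|φ^* v| = |v| ∘ φ`. -/
theorem pnorm_pullbackMap (h : BoundedCompression φ μ ν) {M : Type*} [NormedAddCommGroup M]
    [NormedSpace ℝ M] [Module (Lp ℝ ∞ ν) M] [LpNormedModule p ν M] (v : M) :
    LpNormedModule.pnorm (p := p) (μ := μ) (pullbackMap p h v) =
      compLp h (LpNormedModule.pnorm (p := p) (μ := ν) v) :=
  GenModule.pnorm_gen _ v

/-- The elements `∑ g_i • φ^* v_i` with `g_i ∈ L^∞(μ)` are dense in `φ^* M`. -/
theorem dense_span_pullbackMap (h : BoundedCompression φ μ ν) {M : Type*} [NormedAddCommGroup M]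
    [NormedSpace ℝ M] [Module (Lp ℝ ∞ ν) M] [LpNormedModule p ν M] :
    Dense (Submodule.span (Lp ℝ ∞ μ)
      (Set.range (pullbackMap p h (M := M))) : Set (PullbackModule p h M)) :=
  GenModule.dense_span_gen _

end Pullback

/-! ### Dual modules -/

section Dual

variable (p μ) (M : Type*) [NormedAddCommGroup M] [NormedSpace ℝ M] [Module (Lp ℝ ∞ μ) M]

/-- The dual `M^*`: the continuous `L^∞(μ)`-linear maps `M → L^1(μ)`. -/
structure ModuleDual where
  /-- the underlying continuous linear map -/
  toCLM : M →L[ℝ] Lp ℝ 1 μ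
  map_linf_smul : ∀ (g : Lp ℝ ∞ μ) (v : M), toCLM (g • v) = mulLp μ 1 g (toCLM v)

variable {M} [LpNormedModule p μ M]

/-- `N` is the pointwise norm `|T| = ess sup {|T(v)| : |v| ≤ 1 a.e.}`, i.e. the least upper bound
of these functions in the a.e. order. -/
def IsDualPtNorm (T : ModuleDual μ M) (N : Ω →ₘ[μ] ℝ) : Prop :=
  IsLUB {h : Ω →ₘ[μ] ℝ | ∃ v : M,
    (∀ᵐ x ∂μ, LpNormedModule.pnorm (p := p) (μ := μ) v x ≤ 1) ∧
      h = |(T.toCLM v : Ω →ₘ[μ] ℝ)|} N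

/-- `Dual(v) = {ω ∈ M^* : ω(v) = |v|^p = |ω|^q a.e.}`, where `|ω| ∈ L^q(μ)`. -/
def DualSet (q : ℝ≥0∞) (v : M) : Set (ModuleDual μ M) :=
  {ω | ∃ N : Lp ℝ q μ, IsDualPtNorm μ p ω (N : Ω →ₘ[μ] ℝ) ∧
    ∀ᵐ x ∂μ, ω.toCLM v x = LpNormedModule.pnorm (p := p) (μ := μ) v x ^ p.toReal ∧
      LpNormedModule.pnorm (p := p) (μ := μ) v x ^ p.toReal = N x ^ q.toReal}

end Dual

/-! ### Two order and convexity facts about `L^p` -/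

/-- The standing assumption `p ∈ (1, ∞)` on exponents. -/
class FiniteExponent (p : ℝ≥0∞) : Prop where
  one_lt : 1 < p
  lt_top : p < ∞

instance (p : ℝ≥0∞) [h : FiniteExponent p] : Fact (1 ≤ p) := ⟨h.one_lt.le⟩

section LpFacts

variable {p : ℝ≥0∞} [hp : FiniteExponent p]

theorem one_lt_toReal : 1 < p.toReal := by
  have := (ENNReal.toReal_lt_toReal ENNReal.one_ne_top hp.lt_top.ne).2 hp.one_lt
  simpa using this

theorem ne_zero_of_exponent : p ≠ 0 := (zero_lt_one.trans hp.one_lt).ne'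

theorem integrable_rpow (f : Lp ℝ p μ) : Integrable (fun x => |f x| ^ p.toReal) μ :=
  (Lp.memLp f).integrable_norm_rpow ne_zero_of_exponent hp.lt_top.ne

theorem norm_rpow_eq (f : Lp ℝ p μ) : ‖f‖ ^ p.toReal = ∫ x, |f x| ^ p.toReal ∂μ := by
  have h0 : 0 ≤ ∫ x, |f x| ^ p.toReal ∂μ := integral_nonneg fun x => by positivity
  have hr : p.toReal ≠ 0 := (zero_lt_one.trans one_lt_toReal).ne'
  rw [Lp.norm_def, (Lp.memLp f).eLpNorm_eq_integral_rpow_norm ne_zero_of_exponent hp.lt_top.ne]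
  simp only [Real.norm_eq_abs]
  rw [ENNReal.toReal_ofReal (by positivity), ← Real.rpow_mul h0, inv_mul_cancel₀ hr,
    Real.rpow_one]

theorem norm_sub_rpow_le {a b : Lp ℝ p μ} (hb : 0 ≤ b) (hba : b ≤ a) :
    ‖a - b‖ ^ p.toReal ≤ ‖a‖ ^ p.toReal - ‖b‖ ^ p.toReal := by
  rw [norm_rpow_eq, norm_rpow_eq, norm_rpow_eq,
    ← integral_sub (integrable_rpow a) (integrable_rpow b)]
  refine integral_mono_ae (integrable_rpow _) ((integrable_rpow a).sub (integrable_rpow b)) ?_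
  filter_upwards [(Lp.coeFn_nonneg b).2 hb, (Lp.coeFn_le b a).2 hba, Lp.coeFn_sub a b]
    with x h1 h2 h3
  simp only [Pi.zero_apply] at h1
  rw [h3, Pi.sub_apply, abs_of_nonneg h1, abs_of_nonneg (h1.trans h2),
    abs_of_nonneg (sub_nonneg.2 h2)]
  have := Real.add_rpow_le_rpow_add (sub_nonneg.2 h2) h1 (one_lt_toReal (p := p)).le
  rw [sub_add_cancel] at this
  linarith

theorem tendsto_of_norm_rpow {u : ℕ → Lp ℝ p μ} {a : ℕ → ℝ} (ha : Tendsto a atTop (𝓝 0))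
    (h : ∀ n, ‖u n‖ ^ p.toReal ≤ a n) : Tendsto u atTop (𝓝 0) := by
  have hr : 0 < p.toReal := zero_lt_one.trans one_lt_toReal
  have h1 : Tendsto (fun n => ‖u n‖ ^ p.toReal) atTop (𝓝 0) :=
    squeeze_zero (fun n => by positivity) h ha
  have h2 := h1.rpow_const (p := 1 / p.toReal) (Or.inr (by positivity))
  rw [Real.zero_rpow (by positivity)] at h2
  rw [tendsto_zero_iff_norm_tendsto_zero]
  refine h2.congr fun n => ?_
  rw [← Real.rpow_mul (norm_nonneg _), mul_one_div_cancel hr.ne', Real.rpow_one]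

theorem cauchySeq_of_norm_rpow {u : ℕ → Lp ℝ p μ}
    (h : ∀ ε > 0, ∃ N, ∀ n m, N ≤ n → n ≤ m → ‖u n - u m‖ ^ p.toReal < ε) : CauchySeq u := by
  have hr : 0 < p.toReal := zero_lt_one.trans one_lt_toReal
  have key : ∀ ε > 0, ∃ N, ∀ n m, N ≤ n → n ≤ m → ‖u n - u m‖ < ε := by
    intro ε hε
    obtain ⟨N, hN⟩ := h (ε ^ p.toReal) (by positivity)
    exact ⟨N, fun n m hn hm => (Real.rpow_lt_rpow_iff (norm_nonneg _) hε.le hr).1 (hN n m hn hm)⟩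
  rw [Metric.cauchySeq_iff]
  intro ε hε
  obtain ⟨N, hN⟩ := key ε hε
  refine ⟨N, fun m hm n hn => ?_⟩
  rw [dist_eq_norm]
  rcases le_total m n with h1 | h1
  · exact hN m n hm h1
  · rw [norm_sub_rev]
    exact hN n m hn h1

/-- A nonempty set of nonnegative elements of `L^p` has a greatest lower bound (its essential
infimum). -/
theorem exists_isGLB {S : Set (Lp ℝ p μ)} (hne : S.Nonempty) (hS : ∀ G ∈ S, 0 ≤ G) :
    ∃ G, IsGLB S G := by
  have hr : 0 < p.toReal := zero_lt_one.trans one_lt_toReal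
  suffices h : ∃ G, IsGLB (infClosure S) G by simpa using h
  set T := infClosure S with hT
  have hTc : InfClosed T := infClosed_infClosure
  have hT0 : ∀ G ∈ T, 0 ≤ G := by
    have h0 : (0 : Lp ℝ p μ) ∈ lowerBounds S := fun G hG => hS G hG
    rw [← lowerBounds_infClosure] at h0
    exact fun G hG => h0 hG
  have hTne : T.Nonempty := hne.mono subset_infClosure
  set N : Lp ℝ p μ → ℝ := fun G => ‖G‖ ^ p.toReal with hN
  have hbdd : BddBelow (N '' T) := ⟨0, by rintro _ ⟨G, -, rfl⟩; simp only [hN]; positivity⟩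
  set J := sInf (N '' T) with hJ
  have hJle : ∀ G ∈ T, J ≤ N G := fun G hG => csInf_le hbdd ⟨G, hG, rfl⟩
  have hex : ∀ n : ℕ, ∃ G ∈ T, N G < J + 1 / ((n : ℝ) + 1) := by
    intro n
    obtain ⟨_, ⟨G, hG, rfl⟩, h⟩ := exists_lt_of_csInf_lt (hTne.image N)
      (show sInf (N '' T) < J + 1 / ((n : ℝ) + 1) by
        rw [← hJ]; linarith [Nat.one_div_pos_of_nat (α := ℝ) (n := n)])
    exact ⟨G, hG, h⟩
  choose a haT ha using hex
  let b : ℕ → Lp ℝ p μ := fun n => Nat.rec (a 0) (fun k c => c ⊓ a (k + 1)) n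
  have hbs : ∀ n, b (n + 1) = b n ⊓ a (n + 1) := fun n => rfl
  have hbT : ∀ n, b n ∈ T := by
    intro n
    induction n with
    | zero => exact haT 0
    | succ k ih => rw [hbs]; exact hTc ih (haT _)
  have hba : ∀ n, b n ≤ a n := by
    intro n
    cases n with
    | zero => exact le_rfl
    | succ k => rw [hbs]; exact inf_le_right
  have hanti : Antitone b := antitone_nat_of_succ_le fun n => by rw [hbs]; exact inf_le_left
  have hNmono : ∀ {c d : Lp ℝ p μ}, 0 ≤ c → c ≤ d → N c ≤ N d := by
    intro c d hc hcd
    have := norm_sub_rpow_le hc hcd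
    have h0 : 0 ≤ ‖d - c‖ ^ p.toReal := by positivity
    simp only [hN]
    linarith
  have hNb : ∀ n, N (b n) < J + 1 / ((n : ℝ) + 1) := fun n =>
    (hNmono (hT0 _ (hbT n)) (hba n)).trans_lt (ha n)
  have hcau : CauchySeq b := by
    refine cauchySeq_of_norm_rpow fun ε hε => ?_
    obtain ⟨M, hM⟩ := exists_nat_one_div_lt hε
    refine ⟨M, fun n m hn hm => ?_⟩
    have h1 := norm_sub_rpow_le (hT0 _ (hbT m)) (hanti hm)
    have h2 := hJle _ (hbT m)
    have h3 := hNb n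
    have h4 : 1 / ((n : ℝ) + 1) ≤ 1 / ((M : ℝ) + 1) := by gcongr
    simp only [hN] at h2 h3
    linarith
  obtain ⟨c, hc⟩ := cauchySeq_tendsto_of_complete hcau
  refine ⟨c, fun s hs => ?_, fun d hd => ge_of_tendsto' hc fun n => hd (hbT n)⟩
  have hlim : Tendsto (fun n => b n - b n ⊓ s) atTop (𝓝 (c - c ⊓ s)) :=
    hc.sub (hc.inf_nhds tendsto_const_nhds)
  have hlim0 : Tendsto (fun n => b n - b n ⊓ s) atTop (𝓝 0) := by
    refine tendsto_of_norm_rpow (tendsto_one_div_add_atTop_nhds_zero_nat (𝕜 := ℝ)) fun n => ?_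
    have hm : b n ⊓ s ∈ T := hTc (hbT n) hs
    have h1 := norm_sub_rpow_le (hT0 _ hm) (inf_le_left : b n ⊓ s ≤ b n)
    have h2 := hJle _ hm
    have h3 := hNb n
    simp only [hN] at h2 h3
    linarith
  have := tendsto_nhds_unique hlim hlim0
  rw [sub_eq_zero] at this
  exact inf_eq_left.1 this.symm

/-- A quantitative form of the strict convexity of `t ↦ t ^ r`. -/
theorem rpow_gap {r : ℝ} (hr : 1 < r) {ε : ℝ} (hε : 0 < ε) :
    ∃ K : ℝ, 0 ≤ K ∧ ∀ a b : ℝ, 0 ≤ a → 0 ≤ b →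
      |a - b| ^ r ≤ ε * (a ^ r + b ^ r) + K * ((a ^ r + b ^ r) / 2 - ((a + b) / 2) ^ r) := by
  have hr0 : 0 < r := by linarith
  have hsc := strictConvexOn_rpow hr
  let D : ℝ → ℝ := fun s => (s ^ r + (1 - s) ^ r) / 2 - (1 / 2) ^ r
  have hhalf : ∀ s : ℝ, (1 / 2 : ℝ) • s + (1 / 2 : ℝ) • (1 - s) = 1 / 2 := fun s => by
    simp only [smul_eq_mul]; ring
  have hD0 : ∀ s ∈ Icc (0 : ℝ) 1, 0 ≤ D s := by
    intro s hs
    have := hsc.convexOn.2 (mem_Ici.2 hs.1) (mem_Ici.2 (sub_nonneg.2 hs.2))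
      (show (0 : ℝ) ≤ 1 / 2 by norm_num) (show (0 : ℝ) ≤ 1 / 2 by norm_num) (by norm_num)
    simp only [hhalf] at this
    simp only [smul_eq_mul] at this
    simp only [D]
    linarith
  have hDpos : ∀ s ∈ Icc (0 : ℝ) 1, s ≠ 1 - s → 0 < D s := by
    intro s hs hne
    have := hsc.2 (mem_Ici.2 hs.1) (mem_Ici.2 (sub_nonneg.2 hs.2)) hne
      (show (0 : ℝ) < 1 / 2 by norm_num) (show (0 : ℝ) < 1 / 2 by norm_num) (by norm_num)
    simp only [hhalf] at this
    simp only [smul_eq_mul] at this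
    simp only [D]
    linarith
  have hcont : Continuous D := by
    have h1 : Continuous fun s : ℝ => s ^ r := Real.continuous_rpow_const hr0.le
    have h2 : Continuous fun s : ℝ => (1 - s) ^ r := h1.comp (continuous_const.sub continuous_id)
    exact ((h1.add h2).div_const 2).sub continuous_const
  have hcont' : Continuous fun s : ℝ => |2 * s - 1| ^ r :=
    (Real.continuous_rpow_const hr0.le).comp
      ((continuous_const.mul continuous_id).sub continuous_const).abs
  set c : ℝ := 2 * (1 / 2) ^ r with hc
  have hc0 : 0 < c := by positivity
  let A : Set ℝ := Icc 0 1 ∩ {s | ε * c ≤ |2 * s - 1| ^ r}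
  have hA : IsCompact A := isCompact_Icc.inter_right (isClosed_le continuous_const hcont')
  obtain ⟨K, hK0, hK⟩ : ∃ K : ℝ, 0 ≤ K ∧ ∀ s ∈ A, 1 ≤ K * D s := by
    rcases A.eq_empty_or_nonempty with hE | hE
    · exact ⟨0, le_rfl, fun s hs => by simp [hE] at hs⟩
    · obtain ⟨s₀, hs₀, hmin⟩ := hA.exists_isMinOn hE hcont.continuousOn
      have hpos : 0 < D s₀ := by
        refine hDpos s₀ hs₀.1 fun h => ?_
        have h2 : 2 * s₀ - 1 = 0 := by linarith
        have h3 : ε * c ≤ |2 * s₀ - 1| ^ r := hs₀.2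
        rw [h2, abs_zero, Real.zero_rpow hr0.ne'] at h3
        nlinarith
      refine ⟨(D s₀)⁻¹, by positivity, fun s hs => ?_⟩
      have : D s₀ ≤ D s := hmin hs
      rw [inv_mul_eq_div, le_div_iff₀ hpos]
      linarith
  have key : ∀ s ∈ Icc (0 : ℝ) 1, |2 * s - 1| ^ r ≤ ε * (s ^ r + (1 - s) ^ r) + K * D s := by
    intro s hs
    have h1 := hD0 s hs
    have h2 : c ≤ s ^ r + (1 - s) ^ r := by
      simp only [D] at h1
      rw [hc]; linarith
    have h3 : ε * c ≤ ε * (s ^ r + (1 - s) ^ r) := by gcongr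
    have h4 : 0 ≤ K * D s := mul_nonneg hK0 h1
    by_cases hsA : s ∈ A
    · have h5 := hK s hsA
      have h6 : |2 * s - 1| ^ r ≤ 1 := by
        refine Real.rpow_le_one (abs_nonneg _) ?_ hr0.le
        rw [abs_le]; constructor <;> linarith [hs.1, hs.2]
      have : 0 ≤ ε * c := by positivity
      linarith
    · have h5 : |2 * s - 1| ^ r < ε * c := by
        by_contra hcon
        exact hsA ⟨hs, not_lt.1 hcon⟩
      linarith
  refine ⟨K, hK0, fun a b ha hb => ?_⟩
  rcases (add_nonneg ha hb).eq_or_lt with h0 | h0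
  · have ha0 : a = 0 := by linarith
    have hb0 : b = 0 := by linarith
    simp [ha0, hb0, Real.zero_rpow hr0.ne']
  · set t := a + b with ht
    set s := a / t with hs
    have hat : a = t * s := by rw [hs]; field_simp
    have hbt : b = t * (1 - s) := by rw [mul_sub, ← hat]; linarith
    have hs0 : 0 ≤ s := by positivity
    have hs1 : s ≤ 1 := by rw [hs, div_le_one h0]; linarith
    have hk := key s ⟨hs0, hs1⟩
    have e1 : |a - b| ^ r = t ^ r * |2 * s - 1| ^ r := by
      rw [← Real.mul_rpow h0.le (abs_nonneg _)]
      congr 1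
      have h : a - b = t * (2 * s - 1) := by linarith
      rw [h, abs_mul, abs_of_pos h0]
    have e2 : a ^ r = t ^ r * s ^ r := by rw [← Real.mul_rpow h0.le hs0, ← hat]
    have e3 : b ^ r = t ^ r * (1 - s) ^ r := by
      rw [← Real.mul_rpow h0.le (sub_nonneg.2 hs1), ← hbt]
    have e4 : (t / 2) ^ r = t ^ r * (1 / 2) ^ r := by
      rw [← Real.mul_rpow h0.le (by norm_num)]; congr 1; ring
    rw [e1, e2, e3, e4]
    have := mul_le_mul_of_nonneg_left hk (show 0 ≤ t ^ r by positivity)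
    simp only [D] at this
    linarith

theorem norm_gap {ε : ℝ} (hε : 0 < ε) :
    ∃ K : ℝ, 0 ≤ K ∧ ∀ f g : Lp ℝ p μ, 0 ≤ f → 0 ≤ g →
      ‖f - g‖ ^ p.toReal ≤ ε * (‖f‖ ^ p.toReal + ‖g‖ ^ p.toReal) +
        K * ((‖f‖ ^ p.toReal + ‖g‖ ^ p.toReal) / 2 - ‖(1 / 2 : ℝ) • (f + g)‖ ^ p.toReal) := by
  obtain ⟨K, hK0, hK⟩ := rpow_gap (one_lt_toReal (p := p)) hε
  refine ⟨K, hK0, fun f g hf hg => ?_⟩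
  simp only [norm_rpow_eq]
  have i1 := integrable_rpow f
  have i2 := integrable_rpow g
  have i3 := integrable_rpow ((1 / 2 : ℝ) • (f + g))
  have i12 : Integrable (fun x => |f x| ^ p.toReal + |g x| ^ p.toReal) μ := i1.add i2
  have i4 : Integrable (fun x => (|f x| ^ p.toReal + |g x| ^ p.toReal) / 2 -
      |((1 / 2 : ℝ) • (f + g) : Lp ℝ p μ) x| ^ p.toReal) μ := (i12.div_const 2).sub i3
  rw [← integral_add i1 i2, ← integral_const_mul, ← integral_div,
    ← integral_sub (i12.div_const 2) i3, ← integral_const_mul,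
    ← integral_add (i12.const_mul ε) (i4.const_mul K)]
  refine integral_mono_ae (integrable_rpow _) ((i12.const_mul ε).add (i4.const_mul K)) ?_
  filter_upwards [(Lp.coeFn_nonneg f).2 hf, (Lp.coeFn_nonneg g).2 hg, Lp.coeFn_sub f g,
    Lp.coeFn_smul (1 / 2 : ℝ) (f + g), Lp.coeFn_add f g] with x h1 h2 h3 h4 h5
  simp only [Pi.zero_apply] at h1 h2
  simp only [h3, h4, h5, Pi.sub_apply, Pi.smul_apply, Pi.add_apply, smul_eq_mul]
  rw [abs_of_nonneg h1, abs_of_nonneg h2,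
    abs_of_nonneg (show 0 ≤ 1 / 2 * (f x + g x) by linarith)]
  have := hK _ _ h1 h2
  rwa [show (1 / 2 : ℝ) * (f x + g x) = (f x + g x) / 2 by ring]

/-- From a decreasing sequence of convex sets of nonnegative elements of `L^p`, each containing an
element of norm at most `M`, one can select a convergent sequence. -/
theorem exists_selection {Z : ℕ → Set (Lp ℝ p μ)} (hconv : ∀ n, Convex ℝ (Z n))
    (hanti : Antitone Z) (hpos : ∀ n, ∀ G ∈ Z n, 0 ≤ G) {M : ℝ}
    (hM : ∀ n, ∃ G ∈ Z n, ‖G‖ ^ p.toReal ≤ M) :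
    ∃ k : ℕ → Lp ℝ p μ, (∀ n, k n ∈ Z n) ∧ ∃ G, Tendsto k atTop (𝓝 G) := by
  set N : Lp ℝ p μ → ℝ := fun G => ‖G‖ ^ p.toReal with hN
  have hN0 : ∀ G, 0 ≤ N G := fun G => by simp only [hN]; positivity
  have hbdd : ∀ n, BddBelow (N '' Z n) := fun n => ⟨0, by rintro _ ⟨G, -, rfl⟩; exact hN0 G⟩
  set J : ℕ → ℝ := fun n => sInf (N '' Z n) with hJ
  have hne : ∀ n, (N '' Z n).Nonempty := fun n => by
    obtain ⟨G, hG, -⟩ := hM n; exact ⟨_, G, hG, rfl⟩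
  have hJle : ∀ n, ∀ G ∈ Z n, J n ≤ N G := fun n G hG => csInf_le (hbdd n) ⟨G, hG, rfl⟩
  have hJM : ∀ n, J n ≤ M := fun n => by
    obtain ⟨G, hG, h⟩ := hM n; exact (hJle n G hG).trans h
  have hJmono : Monotone J := fun n m h => csInf_le_csInf (hbdd n) (hne m) (image_mono (hanti h))
  obtain ⟨L, hL⟩ : ∃ L, Tendsto J atTop (𝓝 L) :=
    ⟨_, tendsto_atTop_ciSup hJmono ⟨M, by rintro _ ⟨n, rfl⟩; exact hJM n⟩⟩
  have hJL : ∀ n, J n ≤ L := fun n => hJmono.ge_of_tendsto hL n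
  have hex : ∀ n : ℕ, ∃ G ∈ Z n, N G < J n + 1 / ((n : ℝ) + 1) := by
    intro n
    obtain ⟨_, ⟨G, hG, rfl⟩, h⟩ := exists_lt_of_csInf_lt (hne n)
      (show sInf (N '' Z n) < J n + 1 / ((n : ℝ) + 1) by
        simp only [hJ]; linarith [Nat.one_div_pos_of_nat (α := ℝ) (n := n)])
    exact ⟨G, hG, h⟩
  choose k hkZ hk using hex
  refine ⟨k, hkZ, ?_⟩
  have hL0 : 0 ≤ L := (Real.sInf_nonneg (by rintro _ ⟨G, -, rfl⟩; exact hN0 G)).trans (hJL 0)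
  have hkL : ∀ n, N (k n) ≤ L + 1 / ((n : ℝ) + 1) := fun n => by linarith [hk n, hJL n]
  have hk1 : ∀ n, N (k n) ≤ L + 1 := fun n => by
    have h : 1 / ((n : ℝ) + 1) ≤ 1 := by
      rw [div_le_one (by positivity)]; linarith [Nat.cast_nonneg (α := ℝ) n]
    linarith [hkL n]
  have hcau : CauchySeq k := by
    refine cauchySeq_of_norm_rpow fun ε hε => ?_
    obtain ⟨K, hK0, hK⟩ := norm_gap (p := p) (μ := μ) (ε := ε / (4 * (L + 1))) (by positivity)
    have hlim : Tendsto (fun n : ℕ => K * (L + 1 / ((n : ℝ) + 1) - J n)) atTop (𝓝 0) := by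
      have := ((tendsto_const_nhds (x := L)).add
        (tendsto_one_div_add_atTop_nhds_zero_nat (𝕜 := ℝ))).sub hL |>.const_mul K
      simpa using this
    obtain ⟨n₀, hn₀⟩ := eventually_atTop.1 (hlim.eventually (gt_mem_nhds (half_pos hε)))
    refine ⟨n₀, fun n m hn hm => ?_⟩
    have h1 := hK (k n) (k m) (hpos n _ (hkZ n)) (hpos m _ (hkZ m))
    have hmid : (1 / 2 : ℝ) • (k n + k m) ∈ Z n := by
      rw [smul_add]
      exact hconv n (hkZ n) (hanti hm (hkZ m)) (by norm_num) (by norm_num) (by norm_num)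
    have h2 := hJle n _ hmid
    have h3 := hn₀ n hn
    have h4 : 1 / ((m : ℝ) + 1) ≤ 1 / ((n : ℝ) + 1) := by gcongr
    have h5 := hkL n
    have h6 := hkL m
    have h7 : ε / (4 * (L + 1)) * (N (k n) + N (k m)) ≤ ε / 2 := by
      have : N (k n) + N (k m) ≤ 2 * (L + 1) := by linarith [hk1 n, hk1 m]
      calc _ ≤ ε / (4 * (L + 1)) * (2 * (L + 1)) := by gcongr
        _ = ε / 2 := by field_simp; ring
    have h8 : K * ((N (k n) + N (k m)) / 2 - N ((1 / 2 : ℝ) • (k n + k m))) ≤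
        K * (L + 1 / ((n : ℝ) + 1) - J n) := by
      gcongr
      linarith
    simp only [hN] at h7 h8
    linarith
  exact cauchySeq_tendsto_of_complete hcau

end LpFacts

/-! ### Sobolev functions on a metric measure space -/

section Sobolev

variable {X : Type*} [MetricSpace X]

/-- Real-valued Lipschitz functions with bounded support. -/
structure IsLipBs (u : X → ℝ) : Prop where
  lipschitz : ∃ K : ℝ≥0, LipschitzWith K u
  bounded : Bornology.IsBounded (Function.support u)

/-- The slope `lip(u)(x) = limsup_{y → x, y ≠ x} |u(x) - u(y)| / d(x, y)`. At an isolated point the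
filter `𝓝[≠] x` is `⊥` and the value is `0`. -/
def slope (u : X → ℝ) (x : X) : ℝ≥0∞ :=
  limsup (fun y => edist (u x) (u y) / edist x y) (𝓝[≠] x)

theorem slope_add_le (u v : X → ℝ) (x : X) : slope (u + v) x ≤ slope u x + slope v x := by
  have key : ∀ a b : ℝ≥0∞, slope u x < a → slope v x < b → slope (u + v) x ≤ a + b := by
    intro a b ha hb
    refine limsup_le_of_le (by isBoundedDefault) ?_
    filter_upwards [eventually_lt_of_limsup_lt ha, eventually_lt_of_limsup_lt hb] with y h1 h2
    refine le_trans ?_ (add_le_add h1.le h2.le)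
    rw [← ENNReal.add_div]
    gcongr
    exact edist_add_add_le _ _ _ _
  by_cases hu : slope u x = ∞
  · simp [hu]
  by_cases hv : slope v x = ∞
  · simp [hv]
  refine ENNReal.le_of_forall_pos_le_add fun ε hε _ => ?_
  have hε' : ((ε / 2 : ℝ≥0) : ℝ≥0∞) ≠ 0 := by
    simpa using hε.ne'
  refine (key _ _ (ENNReal.lt_add_right hu hε') (ENNReal.lt_add_right hv hε')).trans ?_
  rw [add_add_add_comm, ← ENNReal.coe_add, add_halves]

theorem slope_smul_le (c : ℝ) (u : X → ℝ) (x : X) :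
    slope (c • u) x ≤ ENNReal.ofReal |c| * slope u x := by
  have h : slope (c • u) x =
      limsup (fun y => ENNReal.ofReal |c| * (edist (u x) (u y) / edist x y)) (𝓝[≠] x) := by
    refine limsup_congr (Eventually.of_forall fun y => ?_)
    simp only [Pi.smul_apply, edist_smul₀, ← mul_div_assoc]
    rw [← Real.norm_eq_abs, ofReal_norm]
    rfl
  rw [h]
  exact (ENNReal.limsup_const_mul_of_ne_top ENNReal.ofReal_ne_top).le

theorem measurable_slope [MeasurableSpace X] [BorelSpace X] {u : X → ℝ} (hu : Continuous u) :
    Measurable (slope u) := by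
  have h : slope u = fun x => ⨅ n : ℕ, ⨆ y : X,
      ⨆ _ : y ∈ Metric.ball x (1 / ((n : ℝ) + 1)) ∩ {x}ᶜ, edist (u x) (u y) / edist x y := by
    funext x
    rw [slope, (nhdsWithin_hasBasis Metric.nhds_basis_ball_inv_nat_succ _).limsup_eq_iInf_iSup]
    simp
  rw [h]
  refine Measurable.iInf fun n => LowerSemicontinuous.measurable ?_
  refine lowerSemicontinuous_iSup fun y => ?_
  intro x₀ c hc
  by_cases hx : y ∈ Metric.ball x₀ (1 / ((n : ℝ) + 1)) ∩ {x₀}ᶜ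
  · have hne : x₀ ≠ y := fun h => hx.2 h.symm
    simp only [hx, iSup_pos] at hc
    have hcont : Tendsto (fun x => edist (u x) (u y) / edist x y) (𝓝 x₀)
        (𝓝 (edist (u x₀) (u y) / edist x₀ y)) := by
      refine ENNReal.Tendsto.div ?_ (Or.inr ?_) ?_ (Or.inl (edist_ne_top _ _))
      · exact (hu.edist continuous_const).tendsto x₀
      · simpa using hne
      · exact (continuous_id.edist continuous_const).tendsto x₀
    have hopen : ∀ᶠ x in 𝓝 x₀, y ∈ Metric.ball x (1 / ((n : ℝ) + 1)) ∩ {x}ᶜ := by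
      have h1 : ∀ᶠ x in 𝓝 x₀, dist y x < 1 / ((n : ℝ) + 1) :=
        (continuous_const.dist continuous_id).tendsto x₀ |>.eventually (gt_mem_nhds hx.1)
      have h2 : ∀ᶠ x in 𝓝 x₀, x ≠ y := isOpen_ne.mem_nhds hne
      filter_upwards [h1, h2] with x h1 h2
      exact ⟨h1, fun h => h2 h.symm⟩
    filter_upwards [hopen, hcont.eventually (lt_mem_nhds hc)] with x h1 h2
    simpa only [h1, iSup_pos] using h2
  · simp only [hx, iSup_neg, not_false_eq_true] at hc
    exact absurd hc not_lt_bot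

theorem IsLipBs.add {u v : X → ℝ} (hu : IsLipBs u) (hv : IsLipBs v) : IsLipBs (u + v) := by
  obtain ⟨K, hK⟩ := hu.lipschitz
  obtain ⟨L, hL⟩ := hv.lipschitz
  exact ⟨⟨K + L, hK.add hL⟩, (hu.bounded.union hv.bounded).subset (Function.support_add u v)⟩

theorem IsLipBs.smul {u : X → ℝ} (c : ℝ) (hu : IsLipBs u) : IsLipBs (c • u) := by
  obtain ⟨K, hK⟩ := hu.lipschitz
  refine ⟨⟨‖c‖₊ * K, ?_⟩, hu.bounded.subset (Function.support_const_smul_subset c u)⟩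
  exact (lipschitzWith_smul c).comp hK

theorem isLipBs_zero : IsLipBs (0 : X → ℝ) :=
  ⟨⟨0, LipschitzWith.const 0⟩, by simp⟩

variable [MeasurableSpace X] [BorelSpace X] {p : ℝ≥0∞} [hp : FiniteExponent p] {m : Measure X}

/-- `(u_n) ⊆ LIP_bs(X)` and `u_n → f` in `L^p(m)`. -/
def IsLipApprox (u : ℕ → X → ℝ) (f : Lp ℝ p m) : Prop :=
  (∀ n, IsLipBs (u n)) ∧ Tendsto (fun n => eLpNorm (fun x => u n x - f x) p m) atTop (𝓝 0)

/-- The `p`-relaxed slopes of `f`: limits in `L^p(m)` of sequences of nonnegative functions `G_n`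
with `lip(u_n) ≤ G_n`, where `(u_n) ⊆ LIP_bs(X)` converges to `f` in `L^p(m)`. By Mazur's lemma
these are the functions that are a.e. above a weak `L^p(m)`-limit of such slopes `lip(u_n)`. -/
def relaxedSlopes (f : Lp ℝ p m) : Set (Lp ℝ p m) :=
  {G | ∃ (u : ℕ → X → ℝ) (H : ℕ → Lp ℝ p m), IsLipApprox u f ∧ (∀ n, 0 ≤ H n) ∧
    (∀ n, ∀ᵐ x ∂m, slope (u n) x ≤ ENNReal.ofReal (H n x)) ∧ Tendsto H atTop (𝓝 G)}

/-- Membership in `W^{1,p}(X)`. -/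
def MemSobolev (f : Lp ℝ p m) : Prop :=
  ∃ u : ℕ → X → ℝ, IsLipApprox u f ∧
    liminf (fun n => ∫⁻ x, slope (u n) x ^ p.toReal ∂m) atTop < ∞

theorem nonneg_of_mem_relaxedSlopes {f G : Lp ℝ p m} (h : G ∈ relaxedSlopes f) : 0 ≤ G := by
  obtain ⟨u, H, -, h1, -, h2⟩ := h
  exact ge_of_tendsto' h2 h1

theorem eLpNorm_add_sub_le {u v : X → ℝ} (hu : IsLipBs u) (hv : IsLipBs v) (f g : Lp ℝ p m) :
    eLpNorm (fun x => (u + v) x - (f + g : Lp ℝ p m) x) p m ≤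
      eLpNorm (fun x => u x - f x) p m + eLpNorm (fun x => v x - g x) p m := by
  obtain ⟨K, hK⟩ := hu.lipschitz
  obtain ⟨L, hL⟩ := hv.lipschitz
  have h : (fun x => (u + v) x - (f + g : Lp ℝ p m) x) =ᵐ[m]
      (fun x => u x - f x) + (fun x => v x - g x) := by
    filter_upwards [Lp.coeFn_add f g] with x hx
    simp only [Pi.add_apply, hx]
    ring
  rw [eLpNorm_congr_ae h]
  exact eLpNorm_add_le
    (hK.continuous.measurable.aestronglyMeasurable.sub (Lp.aestronglyMeasurable f))
    (hL.continuous.measurable.aestronglyMeasurable.sub (Lp.aestronglyMeasurable g)) hp.one_lt.le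

theorem eLpNorm_smul_sub (c : ℝ) (u : X → ℝ) (f : Lp ℝ p m) :
    eLpNorm (fun x => (c • u) x - (c • f : Lp ℝ p m) x) p m =
      ‖c‖ₑ * eLpNorm (fun x => u x - f x) p m := by
  have h : (fun x => (c • u) x - (c • f : Lp ℝ p m) x) =ᵐ[m]
      c • (fun x => u x - f x) := by
    filter_upwards [Lp.coeFn_smul c f] with x hx
    simp only [Pi.smul_apply, hx, smul_sub]
  rw [eLpNorm_congr_ae h, eLpNorm_const_smul]

theorem IsLipApprox.add {u v : ℕ → X → ℝ} {f g : Lp ℝ p m} (hu : IsLipApprox u f)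
    (hv : IsLipApprox v g) : IsLipApprox (fun n => u n + v n) (f + g) := by
  refine ⟨fun n => (hu.1 n).add (hv.1 n), ?_⟩
  have h := hu.2.add hv.2
  rw [add_zero] at h
  exact tendsto_of_tendsto_of_tendsto_of_le_of_le tendsto_const_nhds h (fun _ => zero_le)
    fun n => eLpNorm_add_sub_le (hu.1 n) (hv.1 n) f g

theorem IsLipApprox.smul {u : ℕ → X → ℝ} {f : Lp ℝ p m} (c : ℝ) (hu : IsLipApprox u f) :
    IsLipApprox (fun n => c • u n) (c • f) := by
  refine ⟨fun n => (hu.1 n).smul c, ?_⟩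
  simp only [eLpNorm_smul_sub]
  have := ENNReal.Tendsto.const_mul (a := ‖c‖ₑ) hu.2 (Or.inr enorm_ne_top)
  rwa [mul_zero] at this

theorem relaxedSlopes_add {f g F G : Lp ℝ p m} (hF : F ∈ relaxedSlopes f)
    (hG : G ∈ relaxedSlopes g) : F + G ∈ relaxedSlopes (f + g) := by
  obtain ⟨u, H, h1, h2, h3, h4⟩ := hF
  obtain ⟨v, K, k1, k2, k3, k4⟩ := hG
  refine ⟨fun n => u n + v n, fun n => H n + K n, h1.add k1, fun n => add_nonneg (h2 n) (k2 n),
    fun n => ?_, h4.add k4⟩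
  filter_upwards [h3 n, k3 n, Lp.coeFn_add (H n) (K n), (Lp.coeFn_nonneg _).2 (h2 n),
    (Lp.coeFn_nonneg _).2 (k2 n)] with x a1 a2 a3 a4 a5
  rw [a3, Pi.add_apply, ENNReal.ofReal_add a4 a5]
  exact (slope_add_le _ _ _).trans (add_le_add a1 a2)

theorem relaxedSlopes_smul (c : ℝ) {f G : Lp ℝ p m} (hG : G ∈ relaxedSlopes f) :
    |c| • G ∈ relaxedSlopes (c • f) := by
  obtain ⟨u, H, h1, h2, h3, h4⟩ := hG
  have hH : ∀ n, 0 ≤ |c| • H n := fun n => by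
    rw [← Lp.coeFn_nonneg]
    filter_upwards [Lp.coeFn_smul |c| (H n), (Lp.coeFn_nonneg _).2 (h2 n)] with x a1 a2
    rw [a1]
    exact mul_nonneg (abs_nonneg c) a2
  refine ⟨fun n => c • u n, fun n => |c| • H n, h1.smul c, hH, fun n => ?_, h4.const_smul _⟩
  filter_upwards [h3 n, Lp.coeFn_smul |c| (H n)] with x a1 a2
  rw [a2, Pi.smul_apply, smul_eq_mul, ENNReal.ofReal_mul (abs_nonneg c)]
  exact (slope_smul_le _ _ _).trans (by gcongr)

theorem zero_mem_relaxedSlopes : (0 : Lp ℝ p m) ∈ relaxedSlopes (0 : Lp ℝ p m) := by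
  refine ⟨fun _ => 0, fun _ => 0, ⟨fun _ => isLipBs_zero, ?_⟩, fun _ => le_rfl, fun n => ?_,
    tendsto_const_nhds⟩
  · have h : (fun x => (0 : X → ℝ) x - (0 : Lp ℝ p m) x) =ᵐ[m] 0 := by
      filter_upwards [Lp.coeFn_zero ℝ p m] with x hx
      rw [hx]
      simp
    simp only [eLpNorm_congr_ae h, eLpNorm_zero, tendsto_const_nhds_iff]
  · refine Eventually.of_forall fun x => ?_
    have := slope_smul_le (0 : ℝ) (0 : X → ℝ) x
    simp only [smul_zero, abs_zero, ENNReal.ofReal_zero, zero_mul] at this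
    exact this.trans zero_le

theorem enorm_rpow_eq (f : Lp ℝ p m) : ‖f‖ₑ ^ p.toReal = ∫⁻ x, ‖f x‖ₑ ^ p.toReal ∂m := by
  have hr : p.toReal ≠ 0 := (zero_lt_one.trans one_lt_toReal).ne'
  rw [Lp.enorm_def, eLpNorm_eq_lintegral_rpow_enorm_toReal ne_zero_of_exponent hp.lt_top.ne,
    ← ENNReal.rpow_mul, one_div_mul_cancel hr, ENNReal.rpow_one]

theorem memSobolev_of_nonempty {f : Lp ℝ p m} (h : (relaxedSlopes f).Nonempty) : MemSobolev f := by
  obtain ⟨G, u, H, h1, h2, h3, h4⟩ := h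
  have hr : 0 < p.toReal := zero_lt_one.trans one_lt_toReal
  refine ⟨u, h1, ?_⟩
  have hle : ∀ n, ∫⁻ x, slope (u n) x ^ p.toReal ∂m ≤ ‖H n‖ₑ ^ p.toReal := by
    intro n
    rw [enorm_rpow_eq]
    refine lintegral_mono_ae ?_
    filter_upwards [h3 n] with x hx
    gcongr
    exact hx.trans (Real.ofReal_le_enorm _)
  have hlim : Tendsto (fun n => ‖H n‖ₑ ^ p.toReal) atTop (𝓝 (‖G‖ₑ ^ p.toReal)) :=
    (ENNReal.continuous_rpow_const.tendsto _).comp ((continuous_enorm.tendsto G).comp h4)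
  calc liminf (fun n => ∫⁻ x, slope (u n) x ^ p.toReal ∂m) atTop
      ≤ liminf (fun n => ‖H n‖ₑ ^ p.toReal) atTop :=
        liminf_le_liminf (Eventually.of_forall hle)
    _ = ‖G‖ₑ ^ p.toReal := hlim.liminf_eq
    _ < ∞ := ENNReal.rpow_lt_top_of_nonneg hr.le enorm_ne_top

theorem exists_Lp_slope {u : X → ℝ} (hu : IsLipBs u) {M : ℝ≥0}
    (hM : ∫⁻ x, slope u x ^ p.toReal ∂m < M) :
    ∃ G : Lp ℝ p m, 0 ≤ G ∧ (∀ᵐ x ∂m, slope u x ≤ ENNReal.ofReal (G x)) ∧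
      ‖G‖ ^ p.toReal ≤ M := by
  have hr : 0 < p.toReal := zero_lt_one.trans one_lt_toReal
  obtain ⟨K, hK⟩ := hu.lipschitz
  have hmeas := measurable_slope hK.continuous
  have hle : ∫⁻ x, ‖(slope u x).toReal‖ₑ ^ p.toReal ∂m ≤ M := by
    refine le_trans (lintegral_mono fun x => ?_) hM.le
    gcongr
    rw [Real.enorm_of_nonneg ENNReal.toReal_nonneg]
    exact ENNReal.ofReal_toReal_le
  have hmem : MemLp (fun x => (slope u x).toReal) p m := by
    refine ⟨hmeas.ennreal_toReal.aestronglyMeasurable, ?_⟩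
    rw [eLpNorm_lt_top_iff_lintegral_rpow_enorm_lt_top ne_zero_of_exponent hp.lt_top.ne]
    exact hle.trans_lt ENNReal.coe_lt_top
  have hfin : ∀ᵐ x ∂m, slope u x < ∞ := by
    filter_upwards [ae_lt_top (hmeas.pow_const p.toReal) (hM.trans_le le_top).ne] with x hx
    exact (ENNReal.rpow_lt_top_iff_of_pos hr).1 hx
  refine ⟨hmem.toLp _, ?_, ?_, ?_⟩
  · rw [← Lp.coeFn_nonneg]
    filter_upwards [hmem.coeFn_toLp] with x hx
    rw [hx]
    exact ENNReal.toReal_nonneg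
  · filter_upwards [hmem.coeFn_toLp, hfin] with x hx h
    rw [hx, ENNReal.ofReal_toReal h.ne]
  · have h : ‖hmem.toLp _‖ₑ ^ p.toReal ≤ M := by
      rw [enorm_rpow_eq]
      refine le_trans (le_of_eq (lintegral_congr_ae ?_)) hle
      filter_upwards [hmem.coeFn_toLp] with x hx
      rw [hx]
    have h' := ENNReal.toReal_mono ENNReal.coe_ne_top h
    rwa [← ENNReal.toReal_rpow, toReal_enorm, ENNReal.coe_toReal] at h'

theorem MemSobolev.relaxedSlopes_nonempty {f : Lp ℝ p m} (hf : MemSobolev f) :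
    (relaxedSlopes f).Nonempty := by
  obtain ⟨u, hu, hlim⟩ := hf
  obtain ⟨M, hM⟩ := ENNReal.lt_iff_exists_nnreal_btwn.1 hlim
  have hfreq := frequently_lt_of_liminf_lt (by isBoundedDefault) hM.1
  let e : ℕ → ℝ≥0∞ := fun n => ENNReal.ofReal (1 / ((n : ℝ) + 1))
  have he0 : ∀ n, 0 < e n := fun n => ENNReal.ofReal_pos.2 (by positivity)
  have helim : Tendsto e atTop (𝓝 0) := by
    have := ENNReal.tendsto_ofReal (tendsto_one_div_add_atTop_nhds_zero_nat (𝕜 := ℝ))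
    rwa [ENNReal.ofReal_zero] at this
  let Z : ℕ → Set (Lp ℝ p m) := fun n => {G | 0 ≤ G ∧ ∃ v : X → ℝ, IsLipBs v ∧
    eLpNorm (fun x => v x - f x) p m ≤ e n ∧ ∀ᵐ x ∂m, slope v x ≤ ENNReal.ofReal (G x)}
  have hconv : ∀ n, Convex ℝ (Z n) := by
    rintro n F ⟨hF, v, v1, v2, v3⟩ G ⟨hG, w, w1, w2, w3⟩ a b ha hb hab
    have hnn : ∀ {c : ℝ} {G : Lp ℝ p m}, 0 ≤ c → 0 ≤ G → ∀ᵐ x ∂m, 0 ≤ (c • G : Lp ℝ p m) x := by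
      intro c G hc hG
      filter_upwards [Lp.coeFn_smul c G, (Lp.coeFn_nonneg _).2 hG] with x a1 a2
      rw [a1]
      exact mul_nonneg hc a2
    refine ⟨add_nonneg ((Lp.coeFn_nonneg _).1 (hnn ha hF)) ((Lp.coeFn_nonneg _).1 (hnn hb hG)),
      a • v + b • w, (v1.smul a).add (w1.smul b), ?_, ?_⟩
    · have h := eLpNorm_add_sub_le (v1.smul a) (w1.smul b) (a • f) (b • f)
      rw [← add_smul, hab, one_smul, eLpNorm_smul_sub, eLpNorm_smul_sub] at h
      refine h.trans ?_
      calc ‖a‖ₑ * eLpNorm (fun x => v x - f x) p m + ‖b‖ₑ * eLpNorm (fun x => w x - f x) p m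
          ≤ ‖a‖ₑ * e n + ‖b‖ₑ * e n := by gcongr
        _ = e n := by
          rw [← add_mul, Real.enorm_of_nonneg ha, Real.enorm_of_nonneg hb,
            ← ENNReal.ofReal_add ha hb, hab, ENNReal.ofReal_one, one_mul]
    · filter_upwards [v3, w3, Lp.coeFn_add (a • F) (b • G), Lp.coeFn_smul a F,
        Lp.coeFn_smul b G, hnn ha hF, hnn hb hG] with x a1 a2 a3 a4 a5 a6 a7
      rw [a3, Pi.add_apply, ENNReal.ofReal_add a6 a7, a4, a5, Pi.smul_apply, Pi.smul_apply,
        smul_eq_mul, smul_eq_mul, ENNReal.ofReal_mul ha, ENNReal.ofReal_mul hb]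
      refine (slope_add_le _ _ _).trans (add_le_add ?_ ?_)
      · refine (slope_smul_le _ _ _).trans ?_
        rw [abs_of_nonneg ha]
        gcongr
      · refine (slope_smul_le _ _ _).trans ?_
        rw [abs_of_nonneg hb]
        gcongr
  have hanti : Antitone Z := by
    rintro n k hnk G ⟨h0, v, v1, v2, v3⟩
    refine ⟨h0, v, v1, v2.trans (ENNReal.ofReal_le_ofReal ?_), v3⟩
    gcongr
  have hne : ∀ n, ∃ G ∈ Z n, ‖G‖ ^ p.toReal ≤ M := by
    intro n
    obtain ⟨k, hk1, hk2⟩ := (hfreq.and_eventually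
      (hu.2.eventually (gt_mem_nhds (he0 n)))).exists
    obtain ⟨G, g1, g2, g3⟩ := exists_Lp_slope (hu.1 k) hk1
    exact ⟨G, ⟨g1, u k, hu.1 k, hk2.le, g2⟩, g3⟩
  obtain ⟨H, hH, G, hG⟩ := exists_selection hconv hanti (fun n G h => h.1) hne
  choose h0 v v1 v2 v3 using hH
  exact ⟨G, v, H, ⟨v1, tendsto_of_tendsto_of_tendsto_of_le_of_le tendsto_const_nhds helim
    (fun _ => zero_le) v2⟩, h0, v3, hG⟩

variable (p m) in
/-- The Sobolev space `W^{1,p}(X)`. -/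
def Sobolev : Submodule ℝ (Lp ℝ p m) where
  carrier := {f | MemSobolev f}
  zero_mem' := memSobolev_of_nonempty ⟨0, zero_mem_relaxedSlopes⟩
  add_mem' {f g} hf hg := by
    obtain ⟨F, hF⟩ := MemSobolev.relaxedSlopes_nonempty hf
    obtain ⟨G, hG⟩ := MemSobolev.relaxedSlopes_nonempty hg
    exact memSobolev_of_nonempty ⟨_, relaxedSlopes_add hF hG⟩
  smul_mem' c f hf := by
    obtain ⟨F, hF⟩ := MemSobolev.relaxedSlopes_nonempty hf
    exact memSobolev_of_nonempty ⟨_, relaxedSlopes_smul c hF⟩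

/-- The Cheeger `p`-energy. -/
def cheegerEnergy (f : Lp ℝ p m) : ℝ≥0∞ :=
  ⨅ (u : ℕ → X → ℝ) (_ : IsLipApprox u f),
    liminf (fun n => p⁻¹ * ∫⁻ x, slope (u n) x ^ p.toReal ∂m) atTop

/-- The norm of `W^{1,p}(X)`. -/
def sobolevNorm (f : Sobolev p m) : ℝ≥0∞ :=
  (‖(f : Lp ℝ p m)‖ₑ ^ p.toReal + p * cheegerEnergy (f : Lp ℝ p m)) ^ (1 / p.toReal)

variable (p m) in
/-- `W^{1,p}(X)` is separable for its norm. -/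
def SeparableSobolev : Prop :=
  ∃ D : Set (Sobolev p m), D.Countable ∧
    ∀ (f : Sobolev p m) (ε : ℝ), 0 < ε → ∃ g ∈ D, sobolevNorm (f - g) < ENNReal.ofReal ε

theorem exists_minimal_slope (f : Sobolev p m) :
    ∃ G, IsGLB (relaxedSlopes (f : Lp ℝ p m)) G :=
  exists_isGLB (MemSobolev.relaxedSlopes_nonempty f.2) fun _ => nonneg_of_mem_relaxedSlopes

/-- The minimal `p`-relaxed slope `|Df|_p`: the a.e. smallest of the `p`-relaxed slopes of `f`,
as their essential infimum. -/
def minSlope (f : Sobolev p m) : Lp ℝ p m := (exists_minimal_slope f).choose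

theorem isGLB_minSlope (f : Sobolev p m) : IsGLB (relaxedSlopes (f : Lp ℝ p m)) (minSlope f) :=
  (exists_minimal_slope f).choose_spec

theorem minSlope_nonneg (f : Sobolev p m) : 0 ≤ minSlope f :=
  (isGLB_minSlope f).2 fun _ => nonneg_of_mem_relaxedSlopes

theorem minSlope_add_le (f g : Sobolev p m) : minSlope (f + g) ≤ minSlope f + minSlope g := by
  have h : ∀ F ∈ relaxedSlopes (f : Lp ℝ p m), minSlope (f + g) - F ≤ minSlope g := fun F hF =>
    (isGLB_minSlope g).2 fun G hG =>
      sub_le_iff_le_add'.2 ((isGLB_minSlope (f + g)).1 (relaxedSlopes_add hF hG))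
  have h' : minSlope (f + g) - minSlope g ≤ minSlope f :=
    (isGLB_minSlope f).2 fun F hF => sub_le_comm.1 (h F hF)
  exact sub_le_iff_le_add.1 h'

theorem smul_le_smul_Lp {c : ℝ} (hc : 0 ≤ c) {F G : Lp ℝ p m} (h : F ≤ G) : c • F ≤ c • G := by
  rw [← Lp.coeFn_le] at h ⊢
  filter_upwards [h, Lp.coeFn_smul c F, Lp.coeFn_smul c G] with x h1 h2 h3
  rw [h2, h3]
  exact mul_le_mul_of_nonneg_left h1 hc

theorem minSlope_smul_le {c : ℝ} (hc : c ≠ 0) (f : Sobolev p m) :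
    minSlope (c • f) ≤ |c| • minSlope f := by
  have hc' : 0 < |c| := abs_pos.2 hc
  have h : |c|⁻¹ • minSlope (c • f) ≤ minSlope f := (isGLB_minSlope f).2 fun G hG => by
    have := smul_le_smul_Lp (inv_nonneg.2 hc'.le)
      ((isGLB_minSlope (c • f)).1 (relaxedSlopes_smul c hG))
    rwa [smul_smul, inv_mul_cancel₀ hc'.ne', one_smul] at this
  have := smul_le_smul_Lp hc'.le h
  rwa [smul_smul, mul_inv_cancel₀ hc'.ne', one_smul] at this

theorem minSlope_smul (c : ℝ) (f : Sobolev p m) : minSlope (c • f) = |c| • minSlope f := by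
  rcases eq_or_ne c 0 with rfl | hc
  · rw [abs_zero, zero_smul, zero_smul]
    exact le_antisymm ((isGLB_minSlope _).1 zero_mem_relaxedSlopes) (minSlope_nonneg _)
  · refine le_antisymm (minSlope_smul_le hc f) ?_
    have h := smul_le_smul_Lp (abs_nonneg c) (minSlope_smul_le (inv_ne_zero hc) (c • f))
    rwa [smul_smul c⁻¹, inv_mul_cancel₀ hc, one_smul, smul_smul, ← abs_mul, mul_inv_cancel₀ hc,
      abs_one, one_smul] at h

variable (p m) in
/-- The map `f ↦ |Df|_p`, as a pointwise seminorm on `W^{1,p}(X)`. -/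
def minSlopeSeminorm : PtSeminorm p m (Sobolev p m) where
  toFun := minSlope
  add_le := minSlope_add_le
  smul_eq := minSlope_smul

variable (p m) in
/-- The cotangent module `L^p(T^*X)`: the `L^p(m)`-normed `L^∞(m)`-module generated by
`(W^{1,p}(X), |D·|_p)`. -/
abbrev CotangentModule : Type _ := GenModule (minSlopeSeminorm p m)

/-- The differential `d_p : W^{1,p}(X) → L^p(T^*X)`. -/
def differential : Sobolev p m →ₗ[ℝ] CotangentModule p m := GenModule.gen (minSlopeSeminorm p m)

/-- `|d_p f| = |Df|_p`. -/
theorem pnorm_differential (f : Sobolev p m) :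
    LpNormedModule.pnorm (p := p) (μ := m) (differential f) = minSlope f :=
  GenModule.pnorm_gen _ f

/-- The forms `∑ g_i • d_p f_i` with `g_i ∈ L^∞(m)` are dense in `L^p(T^*X)`. -/
theorem dense_span_differential :
    Dense (Submodule.span (Lp ℝ ∞ m)
      (Set.range (differential (p := p) (m := m))) : Set (CotangentModule p m)) :=
  GenModule.dense_span_gen _

end Sobolev

/-! ### Curves and test plans -/

section Curves

variable {X : Type*} [MetricSpace X]

/-- `C([0,1], X)`, with the supremum distance, carries its Borel σ-algebra. -/
instance : MeasurableSpace C(I, X) := borel _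

instance : BorelSpace C(I, X) := ⟨rfl⟩

open Classical in
/-- The metric speed `|γ'_t| = lim_{s → t} d(γ_s, γ_t) / |s - t|`, set to `0` where the limit does
not exist. -/
def metricSpeed (γ : C(I, X)) (t : I) : ℝ :=
  if h : ∃ l : ℝ, Tendsto (fun s : I => dist (γ s) (γ t) / |(s : ℝ) - t|) (𝓝[≠] t) (𝓝 l)
  then h.choose else 0

/-- Absolutely continuous curves. -/
def IsAC (γ : C(I, X)) : Prop :=
  ∃ g : I → ℝ, Integrable g ∧ ∀ s t : I, s < t → dist (γ t) (γ s) ≤ ∫ r in Set.Ioc s t, g r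

/-- `q`-absolutely continuous curves. -/
def IsACq (q : ℝ≥0∞) (γ : C(I, X)) : Prop :=
  IsAC γ ∧ MemLp (metricSpeed γ) q

open Classical in
/-- The `q`-energy functional `E_{q,t}(γ) = t (⨍_0^t |γ'_s|^q ds)^{1/q}`, equal to `∞` on curves
that are not `q`-absolutely continuous. -/
def curveEnergy (q : ℝ≥0∞) (t : I) (γ : C(I, X)) : ℝ≥0∞ :=
  if IsACq q γ then
    ENNReal.ofReal t * ((ENNReal.ofReal t)⁻¹ *
      ∫⁻ s in Set.Icc 0 t, ENNReal.ofReal (metricSpeed γ s) ^ q.toReal) ^ (1 / q.toReal)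
  else ∞

variable [MeasurableSpace X] [BorelSpace X]

/-- `q`-test plans. -/
structure IsTestPlan (q : ℝ≥0∞) (m : Measure X) (π : Measure C(I, X)) : Prop where
  isProbabilityMeasure : IsProbabilityMeasure π
  compression : ∃ C : ℝ≥0, 0 < C ∧ ∀ t : I, π.map (fun γ => γ t) ≤ C • m
  finite_energy : ∫⁻ γ, curveEnergy q 1 γ ^ q.toReal ∂π < ∞

theorem IsTestPlan.boundedCompression {q : ℝ≥0∞} {m : Measure X} {π : Measure C(I, X)}
    (h : IsTestPlan q m π) (t : I) : BoundedCompression (fun γ : C(I, X) => γ t) π m := by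
  obtain ⟨C, -, hC⟩ := h.compression
  exact ⟨(continuous_eval_const t).measurable, C, hC t⟩

/-- `e_0^* d_p g`, an element of the pullback module `e_0^* L^p(T^*X)`, for `g ∈ W^{1,p}(X)`. -/
def IsTestPlan.pullDifferential {p : ℝ≥0∞} [FiniteExponent p] {q : ℝ≥0∞} {m : Measure X}
    {π : Measure C(I, X)} (h : IsTestPlan q m π) (g : Sobolev p m) :
    PullbackModule p (h.boundedCompression 0) (CotangentModule p m) :=
  pullbackMap p (h.boundedCompression 0) (differential g)

/-- The test plan `π` `q`-represents the gradient of `f ∈ W^{1,p}(X)`. Convergence in `L^p(π)` is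
expressed through the `L^p(π)`-seminorm of the difference; on curves with `E_{q,t}(γ) = 0`, which
are constant on `[0,t]`, the first quotient is `0 / 0 = 0`. -/
structure RepresentsGradient {p : ℝ≥0∞} [FiniteExponent p] (q : ℝ≥0∞) {m : Measure X}
    (π : Measure C(I, X)) (f : Sobolev p m) : Prop where
  isTestPlan : IsTestPlan q m π
  tendsto_quotient : Tendsto (fun t : I => eLpNorm (fun γ : C(I, X) =>
    ((f : Lp ℝ p m) (γ t) - (f : Lp ℝ p m) (γ 0)) / (curveEnergy q t γ).toReal
      - minSlope f (γ 0)) p π) (𝓝[>] 0) (𝓝 0)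
  tendsto_energy : Tendsto (fun t : I => eLpNorm (fun γ : C(I, X) =>
    ((curveEnergy q t γ).toReal / t) ^ (q.toReal / p.toReal) - minSlope f (γ 0)) p π)
      (𝓝[>] 0) (𝓝 0)

end Curves

/-- Weak convergence in `L^1(μ)` (for finite `μ`): convergence against every function in `L^∞(μ)`,
the functions being integrable. -/
def WeakTendstoL1 (μ : Measure Ω) (u : ℕ → Ω → ℝ) (v : Ω → ℝ) : Prop :=
  (∀ n, Integrable (u n) μ) ∧ Integrable v μ ∧
    ∀ h : Ω → ℝ, MemLp h ∞ μ → Tendsto (fun n => ∫ x, h x * u n x ∂μ) atTop (𝓝 (∫ x, h x * v x ∂μ))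

end NormedModules

end

/-! The increments are factored as `(g ∘ e_t - g ∘ e_0) / t = Q_t(g) · (E_{q,t} / t)` with `Q_t(g) =
(g ∘ e_t - g ∘ e_0) / E_{q,t}`. The first factor is treated by weak compactness in `L^p(π)`, the
second converges strongly in `L^q(π)`, and the product therefore converges weakly in `L^1(π)`.

Compactness of `Q_t(g)` rests on `IsTestPlan.ae_edist_le`: if `G` is a relaxed slope of `g`, then
for `π`-a.e. curve `|Q_t(g)|` is at most the mean `(⨍_0^t |G(γ_s)|^p ds)^{1/p}`. For Lipschitz
functions this is the chain rule along absolutely continuous curves followed by Hölder's inequality;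
the general case follows by approximation, the compression bound controlling every error. By
`CompressedBy.tendsto_curveMean` these means converge strongly in `L^p(π)` to `G ∘ e_0`. Hence `g ↦
Q_t(g)` is bounded uniformly in `t` with respect to the Sobolev norm, and separability of
`W^{1,p}(X)` together with that of `L^q(π)` gives one subsequence that serves every `g`
(`exists_subseq_tendsto_pairing`). The weak limit `w(g)` is linear in `g` and satisfies `|w(g)| ≤ G
∘ e_0` for every relaxed slope `G`. Since the minimal slope is a limit of finite minima of relaxed
slopes, `|w(g)| ≤ |Dg|_p ∘ e_0`.

Both halves of the gradient hypothesis now enter. The power map `x ↦ x^{p/q}` is continuous from the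
positive cone of `L^p` to `L^q`, so the second half gives `E_{q,t} / t → N := (|Df|_p ∘ e_0)^{p/q}`
strongly in `L^q(π)`; thus the increments over `t` converge weakly to `w(g) N`. The first half
identifies `w(f) = |Df|_p ∘ e_0`.

The map `g ↦ w(g) N` is dominated by `(|Dg|_p ∘ e_0) N`. It extends by density, first to the
cotangent module and then to its pullback, as an element `η` of the dual with `|η(v)| ≤ |v| N`. At
`v = e_0^* d_p f` one gets `η(v) = |v|^{1+p/q} = |v|^p = N^q`, and testing with truncated multiples
of `v / |v|` shows that the pointwise norm of `η` is exactly `N` (`mem_dualSet`). -/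

noncomputable section

namespace NormedModules

/-! ### Metric derivative of an absolutely continuous curve on the real line. -/

section RealCurves

variable {X : Type*} [PseudoMetricSpace X] {c : ℝ → X} {g : ℝ → ℝ}

theorem dist_le_abs_integral (hc : ∀ s t, s ≤ t → dist (c s) (c t) ≤ ∫ r in s..t, g r) (s t : ℝ) :
    dist (c s) (c t) ≤ |∫ r in s..t, g r| := by
  rcases le_total s t with h | h
  · exact (hc s t h).trans (le_abs_self _)
  · rw [dist_comm, intervalIntegral.integral_symm, abs_neg]
    exact (hc t s h).trans (le_abs_self _)

/-- The increments of `c` are dominated by those of a primitive of `g`, which is absolutely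
continuous, so the defining sums are squeezed. -/
theorem absolutelyContinuousOnInterval_of_dist_le (hg : Integrable g)
    (hc : ∀ s t, s ≤ t → dist (c s) (c t) ≤ ∫ r in s..t, g r) (a b : ℝ) :
    AbsolutelyContinuousOnInterval c a b := by
  have h := (hg.intervalIntegrable (a := a) (b := b)).absolutelyContinuousOnInterval_intervalIntegral
    (c := a) (by simp)
  refine squeeze_zero (fun E => Finset.sum_nonneg fun _ _ => dist_nonneg)
    (fun E => Finset.sum_le_sum fun i _ => ?_) h
  refine (dist_le_abs_integral hc _ _).trans ?_
  rw [dist_comm, Real.dist_eq, intervalIntegral.integral_interval_sub_left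
    hg.intervalIntegrable hg.intervalIntegrable]

/-- An absolutely continuous real function is differentiable a.e. and is the integral of its
derivative. -/
theorem ae_hasDerivAt_of_dist_le {F : ℝ → ℝ} (hg : Integrable g)
    (hF : ∀ s t, s ≤ t → dist (F s) (F t) ≤ ∫ r in s..t, g r) :
    (∀ᵐ t, HasDerivAt F (deriv F t) t) ∧ ∀ s t, ∫ r in s..t, deriv F r = F t - F s := by
  refine ⟨?_, fun s t => (absolutelyContinuousOnInterval_of_dist_le hg hF s t).integral_deriv_eq_sub⟩
  have h : ∀ᵐ t : ℝ, ∀ n : ℕ, t ∈ uIcc (-(n : ℝ)) n → DifferentiableAt ℝ F t :=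
    ae_all_iff.2 fun n => (absolutelyContinuousOnInterval_of_dist_le hg hF _ _).ae_differentiableAt
  filter_upwards [h] with t ht
  obtain ⟨n, hn⟩ := exists_nat_ge |t|
  refine (ht n ?_).hasDerivAt
  rw [uIcc_of_le (by linarith [abs_nonneg t])]
  exact abs_le.1 hn

theorem tendsto_abs_sub_div {F : ℝ → ℝ} {t l : ℝ} (h : HasDerivAt F l t) :
    Tendsto (fun s => |F s - F t| / |s - t|) (𝓝[≠] t) (𝓝 |l|) := by
  refine (hasDerivAt_iff_tendsto_slope.1 h).abs.congr fun s => ?_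
  rw [slope_def_field, abs_div]

/-- At a.e. point both `F` and the primitives of `g` are differentiable, and their difference
quotients are ordered. -/
theorem abs_deriv_le_ae {F : ℝ → ℝ} (hg : Integrable g) (hg0 : 0 ≤ g)
    (hF : ∀ s t, s ≤ t → dist (F s) (F t) ≤ ∫ r in s..t, g r) :
    ∀ᵐ t, |deriv F t| ≤ g t := by
  filter_upwards [(ae_hasDerivAt_of_dist_le hg hF).1,
    LocallyIntegrable.ae_hasDerivAt_integral hg.locallyIntegrable] with t h1 h2
  -- Basing the primitive at `t` itself makes it vanish there, so its quotient is the integral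
  -- between `t` and `s` divided by `|s - t|`.
  have h3 := tendsto_abs_sub_div (h2 t)
  rw [abs_of_nonneg (hg0 t)] at h3
  refine le_of_tendsto_of_tendsto' (tendsto_abs_sub_div h1) h3 fun s => ?_
  refine div_le_div_of_nonneg_right ?_ (abs_nonneg _)
  rw [intervalIntegral.integral_same, sub_zero, abs_sub_comm, ← Real.dist_eq]
  exact dist_le_abs_integral hF t s

/-- Existence of the metric derivative of an absolutely continuous curve. -/
theorem exists_metricDeriv [TopologicalSpace.SeparableSpace X] (hg : Integrable g) (hg0 : 0 ≤ g)
    (hc : ∀ s t, s ≤ t → dist (c s) (c t) ≤ ∫ r in s..t, g r) :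
    ∃ w : ℝ → ℝ, Integrable w ∧ (∀ s t, s ≤ t → dist (c s) (c t) ≤ ∫ r in s..t, w r) ∧
      ∀ᵐ t, Tendsto (fun s => dist (c s) (c t) / |s - t|) (𝓝[≠] t) (𝓝 (w t)) := by
  have : Nonempty X := ⟨c 0⟩
  let x := TopologicalSpace.denseSeq X
  -- The distances to a dense sequence of points recover the metric; the metric derivative will be
  -- the supremum of their `|F_n'|`, which `g` keeps finite.
  let F : ℕ → ℝ → ℝ := fun n s => dist (c s) (x n)
  have hFc : ∀ n s t, |F n s - F n t| ≤ dist (c s) (c t) := fun n s t =>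
    abs_dist_sub_le _ _ _
  have hF : ∀ n s t, s ≤ t → dist (F n s) (F n t) ≤ ∫ r in s..t, g r := fun n s t h => by
    rw [Real.dist_eq]; exact (hFc n s t).trans (hc s t h)
  have hb : ∀ᵐ t, ∀ n, |deriv (F n) t| ≤ g t := ae_all_iff.2 fun n => abs_deriv_le_ae hg hg0 (hF n)
  have hd : ∀ᵐ t, ∀ n, HasDerivAt (F n) (deriv (F n) t) t :=
    ae_all_iff.2 fun n => (ae_hasDerivAt_of_dist_le hg (hF n)).1
  let w : ℝ → ℝ := fun t => ⨆ n, |deriv (F n) t|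
  have hwm : Measurable w := Measurable.iSup fun n => (measurable_deriv (F n)).abs
  have hw0 : 0 ≤ w := fun t => Real.iSup_nonneg fun n => abs_nonneg _
  have hwg : ∀ᵐ t, w t ≤ g t := by
    filter_upwards [hb] with t ht
    exact ciSup_le ht
  have hlew : ∀ᵐ t, ∀ n, |deriv (F n) t| ≤ w t := by
    filter_upwards [hb] with t ht n
    exact le_ciSup (f := fun n => |deriv (F n) t|) ⟨g t, by rintro _ ⟨n, rfl⟩; exact ht n⟩ n
  have hwi : Integrable w := hg.mono' hwm.aestronglyMeasurable (by
    filter_upwards [hwg] with t ht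
    rwa [Real.norm_of_nonneg (hw0 t)])
  have hle : ∀ s t, s ≤ t → dist (c s) (c t) ≤ ∫ r in s..t, w r := by
    intro s t hst
    have h1 : ∀ n, F n t - F n s ≤ ∫ r in s..t, w r := fun n => by
      rw [← (ae_hasDerivAt_of_dist_le hg (hF n)).2 s t]
      refine intervalIntegral.integral_mono_ae hst
        (absolutelyContinuousOnInterval_of_dist_le hg (hF n) s t).intervalIntegrable_deriv
        hwi.intervalIntegrable ?_
      filter_upwards [hlew] with r hr
      exact (le_abs_self _).trans (hr n)
    have h2 : ∀ y, dist (c t) y - dist (c s) y ≤ ∫ r in s..t, w r := fun y =>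
      (TopologicalSpace.denseRange_denseSeq X).induction_on y
        (isClosed_le (by fun_prop) continuous_const) h1
    -- The bound for the distance to `x n` has passed to every centre `y` by density; centring at `c
    -- s` gives the full distance.
    simpa [dist_comm] using h2 (c s)
  refine ⟨w, hwi, hle, ?_⟩
  filter_upwards [hd, LocallyIntegrable.ae_hasDerivAt_integral hwi.locallyIntegrable] with t h1 h2
  -- From below, one `F_n` with `|F_n'(t)| > a` suffices, being 1-Lipschitz in the curve. From
  -- above, the increments are bounded by `∫ w`, whose derivative at `t` is `w t`.
  refine tendsto_order.2 ⟨fun a ha => ?_, fun a ha => ?_⟩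
  · obtain ⟨n, hn⟩ := exists_lt_of_lt_ciSup ha
    filter_upwards [(tendsto_abs_sub_div (h1 n)).eventually (lt_mem_nhds hn)] with s hs
    refine hs.trans_le ?_
    gcongr
    exact hFc n s t
  · have h3 := tendsto_abs_sub_div (h2 t)
    rw [abs_of_nonneg (hw0 t)] at h3
    filter_upwards [h3.eventually (gt_mem_nhds ha)] with s hs
    refine lt_of_le_of_lt ?_ hs
    gcongr
    rw [intervalIntegral.integral_same, sub_zero, dist_comm]
    exact dist_le_abs_integral hle t s

end RealCurves

/-! ### Transfer to curves on the unit interval, and the chain rule with the slope. -/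

section CurvesOnUnitInterval

theorem measurePreserving_coe_unitInterval :
    MeasurePreserving ((↑) : I → ℝ) volume (volume.restrict (Icc 0 1)) :=
  measurePreserving_subtype_coe measurableSet_Icc

theorem ae_unitInterval {P : ℝ → Prop} (h : ∀ᵐ x, P x) : ∀ᵐ r : I, P r :=
  measurePreserving_coe_unitInterval.quasiMeasurePreserving.ae (ae_restrict_of_ae h)

theorem restrict_Icc_restrict_Ioc (a b : I) :
    (volume.restrict (Icc (0 : ℝ) 1)).restrict (Ioc (a : ℝ) b) = volume.restrict (Ioc (a : ℝ) b) := by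
  rw [Measure.restrict_restrict measurableSet_Ioc, inter_eq_left.2]
  exact fun x hx => ⟨a.2.1.trans hx.1.le, hx.2.trans b.2.2⟩

theorem setIntegral_Ioc_coe (h : ℝ → ℝ) (a b : I) :
    ∫ r in Ioc a b, h r = ∫ x in Ioc (a : ℝ) b, h x := by
  rw [← restrict_Icc_restrict_Ioc, ← measurePreserving_coe_unitInterval.setIntegral_preimage_emb
    (MeasurableEmbedding.subtype_coe measurableSet_Icc)]
  rfl

theorem setLIntegral_Ioc_coe (h : ℝ → ℝ≥0∞) (a b : I) :
    ∫⁻ r in Ioc a b, h r = ∫⁻ x in Ioc (a : ℝ) b, h x := by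
  rw [← restrict_Icc_restrict_Ioc, ← measurePreserving_coe_unitInterval.setLIntegral_comp_preimage_emb
    (MeasurableEmbedding.subtype_coe measurableSet_Icc)]
  rfl

variable {X : Type*} [MetricSpace X] {γ : C(I, X)}

/-- The extension of a curve on `[0,1]` to `ℝ`, constant on either side. -/
def extendCurve (γ : C(I, X)) (r : ℝ) : X := γ (projIcc 0 1 zero_le_one r)

theorem extendCurve_coe (γ : C(I, X)) (r : I) : extendCurve γ r = γ r := by
  rw [extendCurve, projIcc_val]

/-- The clamped curve does not move outside `[0,1]`, so the given bound, extended by zero, still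
controls it. The absolute value provides the nonnegativity needed to enlarge the clamped interval to
the original one. -/
theorem IsAC.exists_integrable (h : IsAC γ) : ∃ g : ℝ → ℝ, Integrable g ∧ 0 ≤ g ∧
    ∀ s t, s ≤ t → dist (extendCurve γ s) (extendCurve γ t) ≤ ∫ r in s..t, g r := by
  obtain ⟨g, hg, hγ⟩ := h
  let g' : ℝ → ℝ := (Icc (0 : ℝ) 1).indicator fun r => |g (projIcc 0 1 zero_le_one r)|
  have hg'i : Integrable g' := by
    rw [integrable_indicator_iff measurableSet_Icc]
    refine (measurePreserving_coe_unitInterval.integrable_comp_emb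
      (MeasurableEmbedding.subtype_coe measurableSet_Icc)).1 ?_
    refine hg.abs.congr (Eventually.of_forall fun r => ?_)
    simp
  have hg'0 : 0 ≤ g' := fun r => indicator_nonneg (fun _ _ => abs_nonneg _) r
  refine ⟨g', hg'i, hg'0, fun s t hst => ?_⟩
  set a := projIcc (0 : ℝ) 1 zero_le_one s with ha
  set b := projIcc (0 : ℝ) 1 zero_le_one t with hb
  have hab : a ≤ b := monotone_projIcc _ hst
  rw [intervalIntegral.integral_of_le hst]
  rcases hab.eq_or_lt with h0 | h0
  · rw [extendCurve, extendCurve, ← ha, ← hb, h0, dist_self]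
    exact setIntegral_nonneg measurableSet_Ioc fun r _ => hg'0 r
  · rw [extendCurve, extendCurve, ← ha, ← hb, dist_comm]
    calc dist (γ b) (γ a) ≤ ∫ r in Ioc a b, g r := hγ a b h0
      _ ≤ ∫ r in Ioc a b, g' r := by
        refine setIntegral_mono hg.integrableOn ?_ fun r => ?_
        · refine (hg.abs.congr (Eventually.of_forall fun r => ?_)).integrableOn
          simp [g']
        · simp only [g', r.2, indicator_of_mem, projIcc_val]
          exact le_abs_self _
      _ = ∫ x in Ioc (a : ℝ) b, g' x := setIntegral_Ioc_coe g' a b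
      _ ≤ ∫ x in Ioc s t, g' x := by
        refine setIntegral_mono_set hg'i.integrableOn (Eventually.of_forall hg'0)
          (LE.le.eventuallyLE ?_)
        have h1 : (a : ℝ) < b := h0
        rw [ha, hb, coe_projIcc, coe_projIcc] at h1
        rw [ha, hb, coe_projIcc, coe_projIcc]
        refine Ioc_subset_Ioc ?_ ?_ <;> grind

theorem metricSpeed_eq {t : I} {l : ℝ}
    (h : Tendsto (fun s : I => dist (γ s) (γ t) / |(s : ℝ) - t|) (𝓝[≠] t) (𝓝 l)) :
    metricSpeed γ t = l := by
  have hex : ∃ l : ℝ, Tendsto (fun s : I => dist (γ s) (γ t) / |(s : ℝ) - t|) (𝓝[≠] t) (𝓝 l) :=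
    ⟨l, h⟩
  rw [metricSpeed, dif_pos hex]
  exact tendsto_nhds_unique hex.choose_spec h

theorem tendsto_coe_nhdsNE (t : I) : Tendsto ((↑) : I → ℝ) (𝓝[≠] t) (𝓝[≠] (t : ℝ)) :=
  tendsto_nhdsWithin_iff.2 ⟨(continuous_subtype_val.tendsto t).mono_left nhdsWithin_le_nhds,
    eventually_nhdsWithin_of_forall fun _ hs h => hs (Subtype.ext h)⟩

variable [TopologicalSpace.SeparableSpace X]

/-- The metric derivative of `extendCurve γ` restricts to `I`. In particular `metricSpeed γ` is an
actual limit a.e. and itself an admissible bound in `IsAC`, as soon as any integrable bound exists.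
-/
theorem IsAC.metricDeriv (h : IsAC γ) :
    (∀ᵐ t : I, Tendsto (fun s : I => dist (γ s) (γ t) / |(s : ℝ) - t|) (𝓝[≠] t)
      (𝓝 (metricSpeed γ t))) ∧
    ∀ s t : I, s ≤ t → dist (γ t) (γ s) ≤ ∫ r in Ioc s t, metricSpeed γ r := by
  obtain ⟨g, hg, hg0, hγ⟩ := h.exists_integrable
  obtain ⟨w, -, hw, hlim⟩ := exists_metricDeriv hg hg0 hγ
  have h1 : ∀ᵐ t : I, Tendsto (fun s : I => dist (γ s) (γ t) / |(s : ℝ) - t|) (𝓝[≠] t)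
      (𝓝 (w t)) := by
    filter_upwards [ae_unitInterval hlim] with t ht
    refine (ht.comp (tendsto_coe_nhdsNE t)).congr fun s => ?_
    simp only [Function.comp, extendCurve_coe]
  have h2 : ∀ᵐ t : I, metricSpeed γ t = w t := h1.mono fun t ht => metricSpeed_eq ht
  constructor
  · filter_upwards [h1, h2] with t a1 a2
    rwa [a2]
  · intro s t hst
    rw [setIntegral_congr_ae (g := fun r : I => w r) measurableSet_Ioc (h2.mono fun r hr _ => hr),
      setIntegral_Ioc_coe, ← intervalIntegral.integral_of_le (show (s : ℝ) ≤ t from hst), dist_comm,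
      ← extendCurve_coe γ s, ← extendCurve_coe γ t]
    exact hw s t hst

/-- Chain rule as an inequality: for every `b` above the slope, `|u(y) - u(γ_s)| ≤ b d(y, γ_s)` near
`γ_s`. Dividing by `|r - s|` along the curve and letting `b` decrease to the slope, which is finite
as `u` is Lipschitz, gives the claim. -/
theorem abs_deriv_le_slope_mul {u : X → ℝ} {K : ℝ≥0} (hu : LipschitzWith K u) {F : I → ℝ}
    (hF : F = fun r => u (γ r)) {s : I} {d l : ℝ}
    (hd : Tendsto (fun r : I => |F r - F s| / |(r : ℝ) - s|) (𝓝[≠] s) (𝓝 |d|))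
    (hl : Tendsto (fun r : I => dist (γ r) (γ s) / |(r : ℝ) - s|) (𝓝[≠] s) (𝓝 l)) :
    ‖d‖ₑ ≤ slope u (γ s) * ENNReal.ofReal l := by
  have hl0 : 0 ≤ l := ge_of_tendsto' hl fun r => by positivity
  have hS : slope u (γ s) < ∞ := by
    refine lt_of_le_of_lt (limsup_le_of_le (by isBoundedDefault) (a := (K : ℝ≥0∞)) ?_)
      ENNReal.coe_lt_top
    exact Eventually.of_forall fun y => ENNReal.div_le_of_le_mul (hu _ _)
  have key : ∀ b : ℝ, (slope u (γ s)).toReal < b → |d| ≤ b * l := by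
    intro b hb
    have hb0 : 0 ≤ b := ENNReal.toReal_nonneg.trans hb.le
    have h1 : slope u (γ s) < ENNReal.ofReal b :=
      (ENNReal.lt_ofReal_iff_toReal_lt hS.ne).2 hb
    have h2 : ∀ᶠ y in 𝓝 (γ s), |u y - u (γ s)| ≤ b * dist y (γ s) := by
      have := eventually_nhdsWithin_iff.1 (eventually_lt_of_limsup_lt h1)
      filter_upwards [this] with y hy
      -- The slope ignores the centre, but a curve may return to it; there the bound is trivial.
      by_cases hys : y = γ s
      · simp [hys]
      · have h3 := (hy hys).le
        have h4 : edist (γ s) y ≠ 0 := by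
          rw [Ne, edist_eq_zero]; exact fun h => hys h.symm
        rw [ENNReal.div_le_iff h4 (edist_ne_top _ _), edist_dist, edist_dist,
          ← ENNReal.ofReal_mul hb0, ENNReal.ofReal_le_ofReal_iff (by positivity)] at h3
        rwa [← Real.dist_eq, dist_comm, dist_comm y]
    have h3 : ∀ᶠ r in 𝓝[≠] s, |u (γ r) - u (γ s)| ≤ b * dist (γ r) (γ s) :=
      nhdsWithin_le_nhds (γ.continuous.continuousAt.eventually h2)
    refine le_of_tendsto_of_tendsto hd (hl.const_mul b) ?_
    filter_upwards [h3] with r hr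
    rw [← mul_div_assoc, hF]
    gcongr
  have h : |d| ≤ (slope u (γ s)).toReal * l := by
    have hlim : Tendsto (fun b : ℝ => b * l) (𝓝[>] (slope u (γ s)).toReal)
        (𝓝 ((slope u (γ s)).toReal * l)) :=
      ((continuous_id.mul continuous_const).tendsto _).mono_left nhdsWithin_le_nhds
    exact ge_of_tendsto hlim (eventually_nhdsWithin_of_forall fun b hb => key b hb)
  rw [← ENNReal.ofReal_toReal hS.ne, ← ENNReal.ofReal_mul ENNReal.toReal_nonneg,
    ← ofReal_norm, Real.norm_eq_abs]
  exact ENNReal.ofReal_le_ofReal h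

/-- A Lipschitz function along an absolutely continuous curve is controlled by its slope. -/
theorem IsAC.edist_le_lintegral_slope (h : IsAC γ) {u : X → ℝ} {K : ℝ≥0} (hu : LipschitzWith K u)
    (t : I) : edist (u (γ t)) (u (γ 0)) ≤
      ∫⁻ s in Ioc 0 t, slope u (γ s) * ENNReal.ofReal (metricSpeed γ s) := by
  obtain ⟨g, hg, -, hγ⟩ := h.exists_integrable
  -- The composition with `u` is absolutely continuous with bound `K * g`, so its increment is the
  -- integral of its derivative.
  have hF : ∀ s t, s ≤ t → dist (u (extendCurve γ s)) (u (extendCurve γ t)) ≤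
      ∫ r in s..t, K * g r := fun s t hst => by
    rw [intervalIntegral.integral_const_mul]
    exact (hu.dist_le_mul _ _).trans (by gcongr; exact hγ s t hst)
  obtain ⟨hd, hint⟩ := ae_hasDerivAt_of_dist_le (hg.const_mul (K : ℝ)) hF
  set F := fun r => u (extendCurve γ r) with hFdef
  have h0 := hint (0 : I) t
  rw [edist_eq_enorm_sub, ← extendCurve_coe γ t, ← extendCurve_coe γ 0]
  change ‖F t - F (0 : I)‖ₑ ≤ _
  rw [← h0, intervalIntegral.integral_of_le (show ((0 : I) : ℝ) ≤ t from t.2.1)]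
  refine (enorm_integral_le_lintegral_enorm _).trans ?_
  rw [← setLIntegral_Ioc_coe (fun x => ‖deriv F x‖ₑ) 0 t]
  refine lintegral_mono_ae (ae_restrict_of_ae ?_)
  filter_upwards [ae_unitInterval hd, h.metricDeriv.1] with s h1 h2
  refine abs_deriv_le_slope_mul hu (F := fun r => u (γ r)) rfl ?_ h2
  refine ((tendsto_abs_sub_div h1).comp (tendsto_coe_nhdsNE s)).congr fun r => ?_
  simp only [Function.comp, hFdef, extendCurve_coe]

end CurvesOnUnitInterval

/-! ### Joint measurability of the metric speed and measurability of the energy. -/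

section SpeedMeasurability

variable {X : Type*} [MetricSpace X]

/-- The difference quotient of a curve. -/
def curveQuotient (γ : C(I, X)) (t s : I) : ℝ≥0∞ := edist (γ s) (γ t) / edist s t

theorem curveQuotient_eq (γ : C(I, X)) {t s : I} (h : s ≠ t) :
    curveQuotient γ t s = ENNReal.ofReal (dist (γ s) (γ t) / |(s : ℝ) - t|) := by
  have h' : 0 < dist s t := dist_pos.2 h
  rw [curveQuotient, edist_dist, edist_dist, ← ENNReal.ofReal_div_of_pos h']
  rfl

theorem continuousAt_curveQuotient {x : C(I, X) × I} {s : I} (h : x.2 ≠ s) :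
    ContinuousAt (fun x : C(I, X) × I => curveQuotient x.1 x.2 s) x := by
  refine ENNReal.Tendsto.div ?_ (Or.inr ?_) ?_ (Or.inl (edist_ne_top _ _))
  · have h1 : Continuous fun x : C(I, X) × I => x.1 s := by fun_prop
    have h2 : Continuous fun x : C(I, X) × I => x.1 x.2 := by fun_prop
    exact (h1.edist h2).tendsto x
  · simpa using h.symm
  · exact (continuous_const.edist continuous_snd).tendsto x

theorem eventually_mem_ball_inter {x : C(I, X) × I} {s : I} {δ : ℝ}
    (h : s ∈ Metric.ball x.2 δ ∩ {x.2}ᶜ) :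
    ∀ᶠ y : C(I, X) × I in 𝓝 x, s ∈ Metric.ball y.2 δ ∩ {y.2}ᶜ := by
  have h1 : ∀ᶠ y : C(I, X) × I in 𝓝 x, dist s y.2 < δ :=
    (continuous_const.dist continuous_snd).tendsto x |>.eventually (gt_mem_nhds h.1)
  have h2 : ∀ᶠ y : C(I, X) × I in 𝓝 x, y.2 ≠ s :=
    continuous_snd.continuousAt.eventually (isOpen_ne.mem_nhds fun h' => h.2 h'.symm)
  filter_upwards [h1, h2] with y a1 a2
  exact ⟨a1, fun h => a2 h.symm⟩

variable [SecondCountableTopology X]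

/-- The limsup is a countable infimum, over radii, of suprema over punctured balls. Lying in such a
ball is an open condition on the centre and the quotient is continuous there, so each supremum is
lower semicontinuous even though it is uncountable. -/
theorem measurable_limsup_curveQuotient : Measurable fun x : C(I, X) × I =>
    limsup (curveQuotient x.1 x.2) (𝓝[≠] x.2) := by
  have h : (fun x : C(I, X) × I => limsup (curveQuotient x.1 x.2) (𝓝[≠] x.2)) = fun x => ⨅ n : ℕ,
      ⨆ s : I, ⨆ _ : s ∈ Metric.ball x.2 (1 / ((n : ℝ) + 1)) ∩ {x.2}ᶜ,
        curveQuotient x.1 x.2 s := by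
    funext x
    rw [(nhdsWithin_hasBasis Metric.nhds_basis_ball_inv_nat_succ _).limsup_eq_iInf_iSup]
    simp
  rw [h]
  refine Measurable.iInf fun n => LowerSemicontinuous.measurable ?_
  refine lowerSemicontinuous_iSup fun s => ?_
  intro x₀ c hc
  by_cases hx : s ∈ Metric.ball x₀.2 (1 / ((n : ℝ) + 1)) ∩ {x₀.2}ᶜ
  · simp only [hx, iSup_pos] at hc
    filter_upwards [eventually_mem_ball_inter hx,
      (continuousAt_curveQuotient fun h => hx.2 h.symm).eventually (lt_mem_nhds hc)] with y h1 h2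
    simpa only [h1, iSup_pos] using h2
  · simp only [hx, iSup_neg, not_false_eq_true] at hc
    exact absurd hc not_lt_bot

theorem measurable_liminf_curveQuotient : Measurable fun x : C(I, X) × I =>
    liminf (curveQuotient x.1 x.2) (𝓝[≠] x.2) := by
  have h : (fun x : C(I, X) × I => liminf (curveQuotient x.1 x.2) (𝓝[≠] x.2)) = fun x => ⨆ n : ℕ,
      ⨅ s : I, ⨅ _ : s ∈ Metric.ball x.2 (1 / ((n : ℝ) + 1)) ∩ {x.2}ᶜ,
        curveQuotient x.1 x.2 s := by
    funext x
    rw [(nhdsWithin_hasBasis Metric.nhds_basis_ball_inv_nat_succ _).liminf_eq_iSup_iInf]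
    simp
  rw [h]
  refine Measurable.iSup fun n => UpperSemicontinuous.measurable ?_
  refine upperSemicontinuous_iInf fun s => ?_
  intro x₀ c hc
  by_cases hx : s ∈ Metric.ball x₀.2 (1 / ((n : ℝ) + 1)) ∩ {x₀.2}ᶜ
  · simp only [hx, iInf_pos] at hc
    filter_upwards [eventually_mem_ball_inter hx,
      (continuousAt_curveQuotient fun h => hx.2 h.symm).eventually (gt_mem_nhds hc)] with y h1 h2
    simpa only [h1, iInf_pos] using h2
  · simp only [hx, iInf_neg, not_false_eq_true] at hc
    exact absurd hc not_top_lt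

open Classical in
-- Existence of the limit becomes equality of two measurable functions together with finiteness; the
-- default `0` is the same on both sides.
theorem metricSpeed_eq_ite (γ : C(I, X)) (t : I) : metricSpeed γ t =
    if liminf (curveQuotient γ t) (𝓝[≠] t) = limsup (curveQuotient γ t) (𝓝[≠] t) ∧
      limsup (curveQuotient γ t) (𝓝[≠] t) ≠ ∞
    then (limsup (curveQuotient γ t) (𝓝[≠] t)).toReal else 0 := by
  split_ifs with h
  · have h1 := tendsto_of_liminf_eq_limsup h.1 rfl
    have h2 := (ENNReal.tendsto_toReal h.2).comp h1
    refine metricSpeed_eq (h2.congr' ?_)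
    filter_upwards [self_mem_nhdsWithin] with s hs
    rw [Function.comp, curveQuotient_eq γ hs, ENNReal.toReal_ofReal (by positivity)]
  · rw [metricSpeed, dif_neg]
    rintro ⟨l, hl⟩
    have h1 : Tendsto (curveQuotient γ t) (𝓝[≠] t) (𝓝 (ENNReal.ofReal l)) := by
      refine (ENNReal.tendsto_ofReal hl).congr' ?_
      filter_upwards [self_mem_nhdsWithin] with s hs
      rw [curveQuotient_eq γ hs]
    exact h ⟨by rw [h1.liminf_eq, h1.limsup_eq], by rw [h1.limsup_eq]; exact ENNReal.ofReal_ne_top⟩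

theorem measurable_metricSpeed : Measurable fun x : C(I, X) × I => metricSpeed x.1 x.2 := by
  classical
  simp only [metricSpeed_eq_ite]
  have h1 := measurable_liminf_curveQuotient (X := X)
  have h2 := measurable_limsup_curveQuotient (X := X)
  refine Measurable.ite ?_ h2.ennreal_toReal measurable_const
  exact (measurableSet_eq_fun h1 h2).inter (h2 (measurableSet_singleton ∞)).compl

theorem measurable_metricSpeed_right (γ : C(I, X)) : Measurable (metricSpeed γ) :=
  measurable_metricSpeed.comp measurable_prodMk_left

theorem metricSpeed_nonneg (γ : C(I, X)) (t : I) : 0 ≤ metricSpeed γ t := by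
  rw [metricSpeed_eq_ite]
  split_ifs <;> simp

variable {q : ℝ≥0∞} [hq : FiniteExponent q]

theorem memLp_metricSpeed_iff (γ : C(I, X)) : MemLp (metricSpeed γ) q ↔
    ∫⁻ s, ENNReal.ofReal (metricSpeed γ s) ^ q.toReal < ∞ := by
  rw [MemLp, and_iff_right (measurable_metricSpeed_right γ).aestronglyMeasurable,
    eLpNorm_lt_top_iff_lintegral_rpow_enorm_lt_top ne_zero_of_exponent hq.lt_top.ne]
  simp only [Real.enorm_of_nonneg (metricSpeed_nonneg γ _)]

theorem lintegral_metricSpeed_eq {γ : C(I, X)} (h : Integrable (metricSpeed γ)) (s t : I) :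
    ∫⁻ r in Ioc s t, ENNReal.ofReal (metricSpeed γ r) =
      ENNReal.ofReal (∫ r in Ioc s t, metricSpeed γ r) :=
  (ofReal_integral_eq_lintegral_ofReal h.integrableOn
    (Eventually.of_forall fun r => metricSpeed_nonneg γ r)).symm

/-- An integrable bound for the increments that holds for a dense set of times holds for all. -/
theorem dist_le_integral_of_dense {γ : C(I, X)} {w : I → ℝ} (hw : Integrable w) (hw0 : 0 ≤ w)
    {d : ℕ → I} (hd : DenseRange d)
    (h : ∀ i j, d i < d j → dist (γ (d j)) (γ (d i)) ≤ ∫ r in Ioc (d i) (d j), w r)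
    {s t : I} (hst : s ≤ t) : dist (γ t) (γ s) ≤ ∫ r in Ioc s t, w r := by
  let w' : ℝ → ℝ := (Icc (0 : ℝ) 1).indicator fun r => w (projIcc 0 1 zero_le_one r)
  have hw' : ∀ r : I, w' r = w r := fun r => by simp [w']
  have hi : Integrable w' := by
    rw [integrable_indicator_iff measurableSet_Icc]
    refine (measurePreserving_coe_unitInterval.integrable_comp_emb
      (MeasurableEmbedding.subtype_coe measurableSet_Icc)).1 ?_
    exact hw.congr (Eventually.of_forall fun r => by simp)
  let P : ℝ → ℝ := fun r => ∫ x in (0 : ℝ)..r, w' x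
  have hP : Continuous P := intervalIntegral.continuous_primitive
    (fun _ _ => hi.intervalIntegrable) 0
  have hPw : ∀ {a b : I}, a ≤ b → ∫ r in Ioc a b, w r = P b - P a := fun {a b} hab => by
    simp only [← hw']
    rw [setIntegral_Ioc_coe w', ← intervalIntegral.integral_of_le (show (a : ℝ) ≤ b from hab),
      intervalIntegral.integral_interval_sub_left hi.intervalIntegrable hi.intervalIntegrable]
  have hP0 : ∀ {a b : I}, a ≤ b → 0 ≤ P b - P a := fun {a b} hab => by
    rw [← hPw hab]; exact integral_nonneg hw0
  -- With the absolute value the inequality makes sense for unordered times, hence is a closed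
  -- condition on the whole square and can be checked on a dense set.
  have key : ∀ s t : I, dist (γ t) (γ s) ≤ |P t - P s| := by
    intro s t
    refine hd.induction_on₂ (p := fun s t : I => dist (γ t) (γ s) ≤ |P t - P s|) ?_ ?_ s t
    · refine isClosed_le ?_ ?_ <;> fun_prop
    · intro i j
      rcases lt_trichotomy (d i) (d j) with hij | hij | hij
      · exact (h i j hij).trans (by rw [hPw hij.le]; exact le_abs_self _)
      · simp [hij]
      · rw [dist_comm, abs_sub_comm]
        exact (h j i hij).trans (by rw [hPw hij.le]; exact le_abs_self _)
  rw [hPw hst, ← abs_of_nonneg (hP0 hst)]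
  exact key s t

/-- The metric speed is an admissible bound whenever one exists, which removes the quantifier over
`g`, and a countable dense set of times suffices. What remains is visibly measurable in `γ`. -/
theorem isACq_iff (γ : C(I, X)) : IsACq q γ ↔
    ∫⁻ s, ENNReal.ofReal (metricSpeed γ s) ^ q.toReal < ∞ ∧
      ∀ i j : ℕ, TopologicalSpace.denseSeq I i < TopologicalSpace.denseSeq I j →
        edist (γ (TopologicalSpace.denseSeq I j)) (γ (TopologicalSpace.denseSeq I i)) ≤
          ∫⁻ r in Ioc (TopologicalSpace.denseSeq I i) (TopologicalSpace.denseSeq I j),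
            ENNReal.ofReal (metricSpeed γ r) := by
  rw [IsACq, memLp_metricSpeed_iff, and_comm]
  refine and_congr_right fun hfin => ?_
  have hint : Integrable (metricSpeed γ) :=
    ((memLp_metricSpeed_iff (q := q) γ).2 hfin).integrable hq.one_lt.le
  constructor
  · intro h i j hij
    rw [lintegral_metricSpeed_eq hint, edist_dist]
    exact ENNReal.ofReal_le_ofReal (h.metricDeriv.2 _ _ hij.le)
  · intro h
    refine ⟨metricSpeed γ, hint, fun s t hst => ?_⟩
    refine dist_le_integral_of_dense hint (metricSpeed_nonneg γ)
      (TopologicalSpace.denseRange_denseSeq I) (fun i j hij => ?_) hst.le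
    have := h i j hij
    rwa [lintegral_metricSpeed_eq hint, edist_dist, ENNReal.ofReal_le_ofReal_iff
      (integral_nonneg (metricSpeed_nonneg γ))] at this

theorem measurableSet_isACq : MeasurableSet {γ : C(I, X) | IsACq q γ} := by
  have h1 := (measurable_metricSpeed (X := X)).ennreal_ofReal
  simp only [isACq_iff, ofPred_and, ofPred_forall]
  refine MeasurableSet.inter ?_ (MeasurableSet.iInter fun i => MeasurableSet.iInter fun j =>
    MeasurableSet.iInter fun _ => ?_)
  · exact measurableSet_lt (h1.pow_const q.toReal).lintegral_prod_right' measurable_const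
  · refine measurableSet_le ?_ h1.lintegral_prod_right'
    exact ((continuous_eval_const _).edist (continuous_eval_const _)).measurable

theorem measurable_curveEnergy (t : I) : Measurable (curveEnergy (X := X) q t) := by
  classical
  have h1 := (measurable_metricSpeed (X := X)).ennreal_ofReal
  refine Measurable.ite measurableSet_isACq ?_ measurable_const
  exact (((h1.pow_const q.toReal).lintegral_prod_right'.const_mul _).pow_const _).const_mul _

end SpeedMeasurability

/-! ### Hölder's inequality along curves, and consequences of bounded compression. -/

section TestPlanEstimates

theorem eLpNorm_rpow_toReal {Ω ε : Type*} [MeasurableSpace Ω] [TopologicalSpace ε]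
    [ContinuousENorm ε] {p : ℝ≥0∞} [hp : FiniteExponent p] (f : Ω → ε) (μ : Measure Ω) :
    eLpNorm f p μ ^ p.toReal = ∫⁻ x, ‖f x‖ₑ ^ p.toReal ∂μ := by
  have hr : p.toReal ≠ 0 := (zero_lt_one.trans one_lt_toReal).ne'
  rw [eLpNorm_eq_lintegral_rpow_enorm_toReal ne_zero_of_exponent hp.lt_top.ne,
    ← ENNReal.rpow_mul, one_div_mul_cancel hr, ENNReal.rpow_one]

/-- Normalized Lebesgue measure on `[0,t]`. -/
def uniformOn (t : I) : Measure I := (ENNReal.ofReal t)⁻¹ • volume.restrict (Icc 0 t)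

theorem isProbabilityMeasure_uniformOn {t : I} (ht : 0 < t) :
    IsProbabilityMeasure (uniformOn t) := by
  have h0 : ENNReal.ofReal t ≠ 0 := (ENNReal.ofReal_pos.2 (show (0 : ℝ) < t from ht)).ne'
  refine ⟨?_⟩
  rw [uniformOn, Measure.smul_apply, Measure.restrict_apply_univ, unitInterval.volume_Icc]
  simpa using ENNReal.inv_mul_cancel h0 ENNReal.ofReal_ne_top

theorem ae_uniformOn_le (t : I) : ∀ᵐ s ∂uniformOn t, s ≤ t := by
  refine Measure.ae_smul_measure ?_ _
  filter_upwards [ae_restrict_mem measurableSet_Icc] with s hs using hs.2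

instance (t : I) : SFinite (uniformOn t) := by unfold uniformOn; infer_instance

variable {X : Type*} [MetricSpace X] [SecondCountableTopology X] {p q : ℝ≥0∞}
  [hp : FiniteExponent p] [hq : FiniteExponent q]

/-- Written as an `L^q` norm for normalized Lebesgue measure, the energy is the factor that Hölder's
inequality produces. -/
theorem curveEnergy_eq {γ : C(I, X)} (h : IsACq q γ) (t : I) :
    curveEnergy q t γ = ENNReal.ofReal t * eLpNorm (metricSpeed γ) q (uniformOn t) := by
  rw [curveEnergy, if_pos h,
    eLpNorm_eq_lintegral_rpow_enorm_toReal ne_zero_of_exponent hq.lt_top.ne, uniformOn,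
    lintegral_smul_measure]
  simp only [Real.enorm_of_nonneg (metricSpeed_nonneg γ _), smul_eq_mul]

theorem curveEnergy_lt_top {γ : C(I, X)} (h : IsACq q γ) {t : I} (ht : 0 < t) :
    curveEnergy q t γ < ∞ := by
  rw [curveEnergy_eq h]
  refine ENNReal.mul_lt_top ENNReal.ofReal_lt_top ?_
  have h0 : ENNReal.ofReal t ≠ 0 := (ENNReal.ofReal_pos.2 (show (0 : ℝ) < t from ht)).ne'
  exact ((h.2.mono_measure Measure.restrict_le_self).smul_measure (ENNReal.inv_ne_top.2 h0)).2

/-- Hölder's inequality for the increment of a Lipschitz function along a curve. -/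
theorem IsACq.edist_le [hpq : ENNReal.HolderConjugate p q] {γ : C(I, X)} (h : IsACq q γ)
    {u : X → ℝ} {K : ℝ≥0} (hu : LipschitzWith K u) {H : I → ℝ} (hH : Measurable H)
    (hle : ∀ᵐ s, slope u (γ s) ≤ ENNReal.ofReal (H s)) {t : I} (ht : 0 < t) :
    edist (u (γ t)) (u (γ 0)) ≤ eLpNorm H p (uniformOn t) * curveEnergy q t γ := by
  have h0 : ENNReal.ofReal t ≠ 0 := (ENNReal.ofReal_pos.2 (show (0 : ℝ) < t from ht)).ne'
  have hc : p.toReal.HolderConjugate q.toReal := 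
    ENNReal.HolderConjugate.toReal one_lt_toReal
  rw [curveEnergy_eq h]
  calc edist (u (γ t)) (u (γ 0))
      ≤ ∫⁻ s in Ioc 0 t, slope u (γ s) * ENNReal.ofReal (metricSpeed γ s) :=
        h.1.edist_le_lintegral_slope hu t
    _ ≤ ∫⁻ s in Icc 0 t, ‖H s‖ₑ * ‖metricSpeed γ s‖ₑ := by
        refine (lintegral_mono_set Ioc_subset_Icc_self).trans
          (lintegral_mono_ae (ae_restrict_of_ae ?_))
        filter_upwards [hle] with s hs
        rw [Real.enorm_of_nonneg (metricSpeed_nonneg γ s)]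
        gcongr
        exact hs.trans (Real.ofReal_le_enorm _)
    _ = ENNReal.ofReal t * ∫⁻ s, ‖H s‖ₑ * ‖metricSpeed γ s‖ₑ ∂(uniformOn t) := by
        rw [uniformOn, lintegral_smul_measure, smul_eq_mul, ← mul_assoc,
          ENNReal.mul_inv_cancel h0 ENNReal.ofReal_ne_top, one_mul]
    _ ≤ ENNReal.ofReal t * (eLpNorm H p (uniformOn t) *
          eLpNorm (metricSpeed γ) q (uniformOn t)) := by
        gcongr
        rw [eLpNorm_eq_lintegral_rpow_enorm_toReal ne_zero_of_exponent hp.lt_top.ne,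
          eLpNorm_eq_lintegral_rpow_enorm_toReal ne_zero_of_exponent hq.lt_top.ne]
        exact ENNReal.lintegral_mul_le_Lp_mul_Lq _ hc hH.enorm.aemeasurable
          (measurable_metricSpeed_right γ).enorm.aemeasurable
    _ = _ := by ring

variable [MeasurableSpace X] [BorelSpace X] {m : Measure X} {π : Measure C(I, X)}

theorem measurable_eval : Measurable fun x : C(I, X) × I => x.1 x.2 :=
  (show Continuous fun x : C(I, X) × I => x.1 x.2 by fun_prop).measurable

/-- The compression bound of a test plan, for functions. -/
def CompressedBy (C : ℝ≥0) (m : Measure X) (π : Measure C(I, X)) : Prop :=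
  ∀ t : I, π.map (fun γ => γ t) ≤ C • m

theorem CompressedBy.lintegral_le {C : ℝ≥0} (h : CompressedBy C m π) {f : X → ℝ≥0∞}
    (hf : Measurable f) (t : I) : ∫⁻ γ, f (γ t) ∂π ≤ C * ∫⁻ x, f x ∂m := by
  rw [← lintegral_map hf (continuous_eval_const t).measurable]
  refine (lintegral_mono' (h t) le_rfl).trans ?_
  change ∫⁻ x, f x ∂((C : ℝ≥0∞) • m) ≤ _
  rw [lintegral_smul_measure, smul_eq_mul]

theorem CompressedBy.lintegral_lintegral_le {C : ℝ≥0} (h : CompressedBy C m π) [SFinite π]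
    {f : X → ℝ≥0∞} (hf : Measurable f) (ρ : Measure I) [SFinite ρ] :
    ∫⁻ γ, ∫⁻ s, f (γ s) ∂ρ ∂π ≤ C * (∫⁻ x, f x ∂m) * ρ univ := by
  rw [lintegral_lintegral_swap (f := fun γ s => f ((γ : C(I, X)) s))
    (hf.comp measurable_eval).aemeasurable, ← lintegral_const]
  exact lintegral_mono fun s => h.lintegral_le hf s

/-- By Tonelli the expected time spent in an `m`-null set vanishes, so `π`-a.e. curve avoids it at
a.e. time. -/
theorem CompressedBy.ae_ae {C : ℝ≥0} (h : CompressedBy C m π) [SFinite π] {P : X → Prop}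
    (hP : ∀ᵐ x ∂m, P x) : ∀ᵐ γ ∂π, ∀ᵐ s : I, P (γ s) := by
  obtain ⟨N, hN, hNm, hN0⟩ := exists_measurable_superset_of_null (ae_iff.1 hP)
  have hf : Measurable (N.indicator (1 : X → ℝ≥0∞)) := measurable_one.indicator hNm
  have h1 := h.lintegral_lintegral_le hf volume
  rw [lintegral_indicator_one hNm, hN0, mul_zero, zero_mul, nonpos_iff_eq_zero,
    lintegral_eq_zero_iff (f := fun γ : C(I, X) => ∫⁻ s, N.indicator 1 (γ s))
      (hf.comp measurable_eval).lintegral_prod_right'] at h1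
  filter_upwards [h1] with γ hγ
  rw [Pi.zero_apply, lintegral_eq_zero_iff (f := fun s : I => N.indicator 1 (γ s)) (hf.comp γ.continuous.measurable)] at hγ
  filter_upwards [hγ] with s hs
  by_contra hcon
  have : γ s ∈ N := hN hcon
  simp [this] at hs

theorem CompressedBy.eLpNorm_comp_le {C : ℝ≥0} (h : CompressedBy C m π) {f : X → ℝ}
    (hf : Measurable f) (t : I) :
    eLpNorm (fun γ : C(I, X) => f (γ t)) p π ≤ (C : ℝ≥0∞) ^ (1 / p.toReal) * eLpNorm f p m := by
  have hr : 0 < p.toReal := zero_lt_one.trans one_lt_toReal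
  rw [eLpNorm_eq_lintegral_rpow_enorm_toReal ne_zero_of_exponent hp.lt_top.ne,
    eLpNorm_eq_lintegral_rpow_enorm_toReal ne_zero_of_exponent hp.lt_top.ne,
    ← ENNReal.mul_rpow_of_nonneg _ _ (by positivity)]
  gcongr
  exact h.lintegral_le (hf.enorm.pow_const _) t

/-- The mean `(⨍_0^t |f(γ_s)|^p ds)^{1/p}`. -/
def curveMean (p : ℝ≥0∞) (f : X → ℝ) (t : I) (γ : C(I, X)) : ℝ≥0∞ :=
  eLpNorm (fun s => f (γ s)) p (uniformOn t)

theorem measurable_eLpNorm_right {Ω Ω' : Type*} [MeasurableSpace Ω] [MeasurableSpace Ω']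
    {K : Ω × Ω' → ℝ} (hK : Measurable K) (ρ : Measure Ω') [SFinite ρ] :
    Measurable fun x => eLpNorm (fun s => K (x, s)) p ρ := by
  simp only [eLpNorm_eq_lintegral_rpow_enorm_toReal ne_zero_of_exponent hp.lt_top.ne]
  exact (hK.enorm.pow_const _).lintegral_prod_right'.pow_const _

theorem measurable_curveMean {f : X → ℝ} (hf : Measurable f) (t : I) :
    Measurable (curveMean p f t) := by
  have h : Measurable fun x : C(I, X) × I => f (x.1 x.2) := hf.comp measurable_eval
  exact measurable_eLpNorm_right h (uniformOn t)

theorem curveMean_le_add {f g : X → ℝ} (hf : Measurable f) (hg : Measurable g) (t : I)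
    (γ : C(I, X)) : curveMean p f t γ ≤ curveMean p (f - g) t γ + curveMean p g t γ := by
  have h1 : Measurable fun s => (f - g) (γ s) := (hf.sub hg).comp γ.continuous.measurable
  have h2 : Measurable fun s => g (γ s) := hg.comp γ.continuous.measurable
  have h3 : (fun s => f (γ s)) = (fun s => (f - g) (γ s)) + fun s => g (γ s) := by
    funext s
    simp
  rw [curveMean, h3]
  exact eLpNorm_add_le h1.aestronglyMeasurable h2.aestronglyMeasurable hp.one_lt.le

/-- Tonelli and the compression bound; since the time average has total mass one, the constant does
not depend on `t`. -/
theorem CompressedBy.eLpNorm_curveMean_le {C : ℝ≥0} (h : CompressedBy C m π) [SFinite π]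
    {f : X → ℝ} (hf : Measurable f) {t : I} (ht : 0 < t) :
    eLpNorm (curveMean p f t) p π ≤ (C : ℝ≥0∞) ^ (1 / p.toReal) * eLpNorm f p m := by
  have hr : 0 < p.toReal := zero_lt_one.trans one_lt_toReal
  have := isProbabilityMeasure_uniformOn ht
  rw [eLpNorm_eq_lintegral_rpow_enorm_toReal ne_zero_of_exponent hp.lt_top.ne,
    eLpNorm_eq_lintegral_rpow_enorm_toReal ne_zero_of_exponent hp.lt_top.ne (μ := m),
    ← ENNReal.mul_rpow_of_nonneg _ _ (by positivity)]
  gcongr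
  simp only [enorm_eq_self, curveMean, eLpNorm_rpow_toReal]
  refine (h.lintegral_lintegral_le (hf.enorm.pow_const _) (uniformOn t)).trans (le_of_eq ?_)
  rw [measure_univ, mul_one]

end TestPlanEstimates

/-! ### Increments of Sobolev functions and means of their relaxed slopes. -/

section KeyInequality

variable {X : Type*} [MetricSpace X] [SecondCountableTopology X] {p q : ℝ≥0∞}
  [hp : FiniteExponent p] [hq : FiniteExponent q]
  [MeasurableSpace X] [BorelSpace X] {m : Measure X} {π : Measure C(I, X)}

theorem measurable_Lp (f : Lp ℝ p m) : Measurable f := (Lp.stronglyMeasurable f).measurable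

theorem IsTestPlan.ae_isACq (h : IsTestPlan q m π) : ∀ᵐ γ ∂π, IsACq q γ := by
  have hr : 0 < q.toReal := zero_lt_one.trans one_lt_toReal
  filter_upwards [ae_lt_top ((measurable_curveEnergy 1).pow_const _) h.finite_energy.ne] with γ hγ
  by_contra hcon
  rw [curveEnergy, if_neg hcon, ENNReal.top_rpow_of_pos hr] at hγ
  exact lt_irrefl _ hγ

theorem lintegral_enorm_le_eLpNorm {Ω ε : Type*} [MeasurableSpace Ω] {μ : Measure Ω}
    [IsProbabilityMeasure μ] [TopologicalSpace ε] [ContinuousENorm ε] {f : Ω → ε}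
    (hf : AEStronglyMeasurable f μ) : ∫⁻ x, ‖f x‖ₑ ∂μ ≤ eLpNorm f p μ := by
  rw [← eLpNorm_one_eq_lintegral_enorm]
  exact eLpNorm_le_eLpNorm_of_exponent_le hp.one_lt.le hf

/-- Fatou's lemma; a vanishing liminf is enough below and spares the extraction of an a.e.
convergent subsequence. -/
theorem ae_liminf_eq_zero {Ω : Type*} [MeasurableSpace Ω] {μ : Measure Ω} {F : ℕ → Ω → ℝ≥0∞}
    (hF : ∀ n, Measurable (F n)) (h : Tendsto (fun n => ∫⁻ x, F n x ∂μ) atTop (𝓝 0)) :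
    ∀ᵐ x ∂μ, liminf (fun n => F n x) atTop = 0 := by
  have h1 := lintegral_liminf_le (μ := μ) (u := atTop) hF
  rw [h.liminf_eq, nonpos_iff_eq_zero, lintegral_eq_zero_iff (.liminf hF)] at h1
  exact h1

/-- The increments of a Sobolev function along the curves of a test plan are controlled by its
relaxed slopes. -/
theorem IsTestPlan.ae_edist_le [hpq : ENNReal.HolderConjugate p q] (h : IsTestPlan q m π)
    {g G : Lp ℝ p m} (hG : G ∈ relaxedSlopes g) {t : I} (ht : 0 < t) :
    ∀ᵐ γ ∂π, edist (g (γ t)) (g (γ 0)) ≤ curveMean p G t γ * curveEnergy q t γ := by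
  obtain ⟨C, -, hC⟩ := h.compression
  have hC : CompressedBy C m π := hC
  have := h.isProbabilityMeasure
  obtain ⟨u, H, ⟨hu, hug⟩, -, hle, hHG⟩ := hG
  choose K hK using fun n => (hu n).lipschitz
  have hum : ∀ n, Measurable fun x => u n x - g x := fun n =>
    (hK n).continuous.measurable.sub (measurable_Lp g)
  have hHm : ∀ n, Measurable (⇑(H n) - ⇑G) := fun n => (measurable_Lp _).sub (measurable_Lp G)
  -- All the errors committed in replacing `g` by `u n` and `G` by `H n`; compression sends their
  -- integral to zero.
  let F : ℕ → C(I, X) → ℝ≥0∞ := fun n γ => ‖u n (γ t) - g (γ t)‖ₑ + ‖u n (γ 0) - g (γ 0)‖ₑ +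
    curveMean p (⇑(H n) - ⇑G) t γ
  have he : ∀ n s, Measurable fun γ : C(I, X) => u n (γ s) - g (γ s) := fun n s =>
    (hum n).comp (continuous_eval_const s).measurable
  have hFm : ∀ n, Measurable (F n) := fun n =>
    ((he n t).enorm.add (he n 0).enorm).add (measurable_curveMean (hHm n) t)
  have hF : Tendsto (fun n => ∫⁻ γ, F n γ ∂π) atTop (𝓝 0) := by
    set c : ℝ≥0∞ := (C : ℝ≥0∞) ^ (1 / p.toReal) with hc
    have hct : c ≠ ∞ := ENNReal.rpow_ne_top_of_nonneg
      (by have := one_lt_toReal (p := p); positivity) ENNReal.coe_ne_top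
    have h1 := ENNReal.Tendsto.const_mul (a := c) hug (Or.inr hct)
    have h2 := ENNReal.Tendsto.const_mul (a := c)
      ((Lp.tendsto_Lp_iff_tendsto_eLpNorm' H G).1 hHG) (Or.inr hct)
    have h3 := (h1.add h1).add h2
    simp only [mul_zero, add_zero] at h3
    refine tendsto_of_tendsto_of_tendsto_of_le_of_le tendsto_const_nhds h3 (fun _ => zero_le)
      fun n => ?_
    simp only [F]
    rw [lintegral_add_right _ (measurable_curveMean (hHm n) t),
      lintegral_add_left (he n t).enorm]
    have hb : ∀ s, ∫⁻ γ : C(I, X), ‖u n (γ s) - g (γ s)‖ₑ ∂π ≤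
        c * eLpNorm (fun x => u n x - g x) p m := fun s =>
      (lintegral_enorm_le_eLpNorm (p := p) (he n s).aestronglyMeasurable).trans
        (hC.eLpNorm_comp_le (hum n) s)
    refine add_le_add (add_le_add (hb t) (hb 0)) ?_
    exact (lintegral_enorm_le_eLpNorm (p := p)
      (measurable_curveMean (hHm n) t).aestronglyMeasurable).trans
        (hC.eLpNorm_curveMean_le (hHm n) ht)
  have hsl : ∀ᵐ γ ∂π, ∀ n, ∀ᵐ s : I, slope (u n) (γ s) ≤ ENNReal.ofReal (H n (γ s)) :=
    ae_all_iff.2 fun n => hC.ae_ae (hle n)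
  filter_upwards [ae_liminf_eq_zero hFm hF, hsl, h.ae_isACq] with γ h1 h2 h3
  have hE := (curveEnergy_lt_top h3 ht).ne
  set E := curveEnergy q t γ
  have h4 : ∀ n, edist (g (γ t)) (g (γ 0)) ≤ curveMean p G t γ * E + (1 + E) * F n γ := by
    intro n
    have h5 := h3.edist_le (p := p) (hK n)
      ((measurable_Lp (H n)).comp γ.continuous.measurable) (h2 n) ht
    calc edist (g (γ t)) (g (γ 0))
        ≤ edist (g (γ t)) (u n (γ t)) + edist (u n (γ t)) (u n (γ 0)) +
            edist (u n (γ 0)) (g (γ 0)) := edist_triangle4 _ _ _ _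
      _ ≤ ‖u n (γ t) - g (γ t)‖ₑ + (curveMean p (⇑(H n) - ⇑G) t γ + curveMean p G t γ) * E +
            ‖u n (γ 0) - g (γ 0)‖ₑ := by
          rw [edist_comm (g (γ t)), edist_eq_enorm_sub (u n (γ t)) (g (γ t)),
            edist_eq_enorm_sub (u n (γ 0)) (g (γ 0))]
          gcongr
          refine h5.trans ?_
          gcongr
          exact curveMean_le_add (measurable_Lp (H n)) (measurable_Lp G) t γ
      -- The extra terms complete the error to the product `(1 + E) * F n γ`.
      _ ≤ ‖u n (γ t) - g (γ t)‖ₑ + (curveMean p (⇑(H n) - ⇑G) t γ + curveMean p G t γ) * E +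
            ‖u n (γ 0) - g (γ 0)‖ₑ + (curveMean p (⇑(H n) - ⇑G) t γ +
            E * (‖u n (γ t) - g (γ t)‖ₑ + ‖u n (γ 0) - g (γ 0)‖ₑ)) := le_self_add
      _ = curveMean p G t γ * E + (1 + E) * F n γ := by simp only [F]; ring
  have h6 : ∀ n, edist (g (γ t)) (g (γ 0)) - curveMean p G t γ * E ≤ (1 + E) * F n γ := fun n =>
    tsub_le_iff_left.2 (h4 n)
  -- The left side does not depend on `n`, and `1 + E` is finite, so the liminf of the bound is
  -- zero.
  have h7 : edist (g (γ t)) (g (γ 0)) - curveMean p G t γ * E ≤ 0 := by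
    have h8 : edist (g (γ t)) (g (γ 0)) - curveMean p G t γ * E ≤
        liminf (fun n => (1 + E) * F n γ) atTop :=
      le_liminf_of_le (by isBoundedDefault) (Eventually.of_forall h6)
    rwa [ENNReal.liminf_const_mul_of_ne_top (ENNReal.add_ne_top.2 ⟨ENNReal.one_ne_top, hE⟩), h1,
      mul_zero] at h8
  exact tsub_eq_zero_iff_le.1 (nonpos_iff_eq_zero.1 h7)

/-- The quotient `(g(γ_t) - g(γ_0)) / E_{q,t}(γ)`. -/
def energyQuotient (q : ℝ≥0∞) (g : X → ℝ) (t : I) (γ : C(I, X)) : ℝ :=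
  (g (γ t) - g (γ 0)) / (curveEnergy q t γ).toReal

theorem measurable_energyQuotient {g : X → ℝ} (hg : Measurable g) (t : I) :
    Measurable (energyQuotient q g t) :=
  ((hg.comp (continuous_eval_const t).measurable).sub
    (hg.comp (continuous_eval_const 0).measurable)).div (measurable_curveEnergy t).ennreal_toReal

theorem enorm_energyQuotient_le {g : X → ℝ} {t : I} {γ : C(I, X)} {a : ℝ≥0∞}
    (h : edist (g (γ t)) (g (γ 0)) ≤ a * curveEnergy q t γ) (hE : curveEnergy q t γ ≠ ∞) :
    ‖energyQuotient q g t γ‖ₑ ≤ a := by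
  rcases eq_or_ne (curveEnergy q t γ) 0 with h0 | h0
  · simp [energyQuotient, h0]
  · have h1 : (curveEnergy q t γ).toReal ≠ 0 := (ENNReal.toReal_ne_zero).2 ⟨h0, hE⟩
    rw [energyQuotient, div_eq_mul_inv, enorm_mul, enorm_inv h1,
      Real.enorm_of_nonneg ENNReal.toReal_nonneg, ENNReal.ofReal_toReal hE, ← div_eq_mul_inv]
    refine ENNReal.div_le_of_le_mul ?_
    rwa [← edist_eq_enorm_sub]

/-- The factorization on which the whole argument is built. Where the energy vanishes the bound `h`
forces a zero increment, so division by zero is harmless and the convention `0 / 0 = 0` is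
respected. -/
theorem energyQuotient_mul {g : X → ℝ} {t : I} {γ : C(I, X)} {a : ℝ≥0∞}
    (h : edist (g (γ t)) (g (γ 0)) ≤ a * curveEnergy q t γ) (hE : curveEnergy q t γ ≠ ∞) :
    energyQuotient q g t γ * ((curveEnergy q t γ).toReal / t) = (g (γ t) - g (γ 0)) / t := by
  rcases eq_or_ne (curveEnergy q t γ) 0 with h0 | h0
  · rw [h0, mul_zero, nonpos_iff_eq_zero, edist_eq_zero] at h
    simp [h0, h]
  · have h1 : (curveEnergy q t γ).toReal ≠ 0 := (ENNReal.toReal_ne_zero).2 ⟨h0, hE⟩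
    rw [energyQuotient]
    field_simp

/-- For a bounded continuous function this is dominated convergence along continuous curves. Such
functions are dense in `L^p(m)`, and compression makes the approximation error uniform in `s`. -/
theorem CompressedBy.tendsto_eLpNorm_eval_sub [IsLocallyFiniteMeasure m] [IsFiniteMeasure π]
    {C : ℝ≥0} (h : CompressedBy C m π) (G : Lp ℝ p m) :
    Tendsto (fun s : I => eLpNorm (fun γ : C(I, X) => G (γ s) - G (γ 0)) p π) (𝓝 0) (𝓝 0) := by
  have hr : 0 < p.toReal := zero_lt_one.trans one_lt_toReal
  rw [ENNReal.tendsto_nhds_zero]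
  intro ε hε
  set c : ℝ≥0∞ := (C : ℝ≥0∞) ^ (1 / p.toReal) with hc
  have hct : c ≠ ∞ := ENNReal.rpow_ne_top_of_nonneg (by positivity) ENNReal.coe_ne_top
  have hε3 : ε / 3 ≠ 0 := (ENNReal.div_pos hε.ne' (by simp)).ne'
  -- Dividing by `c + 1` instead of `c` covers a vanishing compression factor.
  obtain ⟨φ, hφ, -⟩ := (Lp.memLp G).exists_boundedContinuous_eLpNorm_sub_le hp.lt_top.ne
    (ε := ε / 3 / (c + 1)) (ENNReal.div_pos hε3 (by simp [hct])).ne'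
  have hφm : Measurable (⇑G - ⇑φ) := (measurable_Lp G).sub φ.continuous.measurable
  have h1 : ∀ s : I, eLpNorm (fun γ : C(I, X) => (⇑G - ⇑φ) (γ s)) p π ≤ ε / 3 := fun s => by
    refine (h.eLpNorm_comp_le hφm s).trans ?_
    calc c * eLpNorm (⇑G - ⇑φ) p m ≤ (c + 1) * (ε / 3 / (c + 1)) := by
          gcongr
          exact le_self_add
      _ ≤ ε / 3 := ENNReal.mul_div_le
  have hlim : Tendsto (fun s : I => eLpNorm (fun γ : C(I, X) => φ (γ s) - φ (γ 0)) p π) (𝓝 0)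
      (𝓝 0) := by
    simp only [eLpNorm_eq_lintegral_rpow_enorm_toReal ne_zero_of_exponent hp.lt_top.ne]
    have h2 : Tendsto (fun s : I => ∫⁻ γ : C(I, X), ‖φ (γ s) - φ (γ 0)‖ₑ ^ p.toReal ∂π) (𝓝 0)
        (𝓝 (∫⁻ _, 0 ∂π)) := by
      refine tendsto_lintegral_filter_of_dominated_convergence
        (fun _ => ENNReal.ofReal (2 * ‖φ‖) ^ p.toReal) (Eventually.of_forall fun s => ?_)
        (Eventually.of_forall fun s => Eventually.of_forall fun γ => ?_) ?_
        (Eventually.of_forall fun γ => ?_)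
      · have : Continuous fun γ : C(I, X) => φ (γ s) - φ (γ 0) := by fun_prop
        exact this.measurable.enorm.pow_const _
      · gcongr
        rw [← ofReal_norm, ← dist_eq_norm]
        exact ENNReal.ofReal_le_ofReal (φ.dist_le_two_norm _ _)
      · rw [lintegral_const]
        exact ENNReal.mul_ne_top (ENNReal.rpow_ne_top_of_nonneg hr.le ENNReal.ofReal_ne_top)
          (measure_ne_top _ _)
      · have : Continuous fun s : I => ‖φ (γ s) - φ (γ 0)‖ₑ ^ p.toReal := by
          refine ENNReal.continuous_rpow_const.comp (continuous_enorm.comp ?_)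
          fun_prop
        have := this.tendsto 0
        simpa [ENNReal.zero_rpow_of_pos hr] using this
    rw [lintegral_zero] at h2
    have h3 := (ENNReal.continuous_rpow_const (y := 1 / p.toReal)).tendsto 0 |>.comp h2
    rwa [ENNReal.zero_rpow_of_pos (by positivity)] at h3
  filter_upwards [ENNReal.tendsto_nhds_zero.1 hlim (ε / 3) (pos_iff_ne_zero.2 hε3)] with s hs
  have m1 : ∀ s : I, AEStronglyMeasurable (fun γ : C(I, X) => (⇑G - ⇑φ) (γ s)) π := fun s =>
    (hφm.comp (continuous_eval_const s).measurable).aestronglyMeasurable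
  have m2 : AEStronglyMeasurable (fun γ : C(I, X) => φ (γ s) - φ (γ 0)) π :=
    (show Continuous fun γ : C(I, X) => φ (γ s) - φ (γ 0) by fun_prop).aestronglyMeasurable
  have h4 : (fun γ : C(I, X) => G (γ s) - G (γ 0)) = ((fun γ => (⇑G - ⇑φ) (γ s)) +
      fun γ => φ (γ s) - φ (γ 0)) - fun γ => (⇑G - ⇑φ) (γ 0) := by
    funext γ
    simp only [Pi.sub_apply, Pi.add_apply]
    ring
  rw [h4]
  refine (eLpNorm_sub_le ((m1 s).add m2) (m1 0) hp.one_lt.le).trans ?_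
  refine (add_le_add ((eLpNorm_add_le (m1 s) m2 hp.one_lt.le).trans (add_le_add (h1 s) hs))
    (h1 0)).trans (le_of_eq (ENNReal.add_thirds ε))

theorem enorm_toReal_sub_le {a b c : ℝ≥0∞} (ha : a ≠ ∞) (hb : b ≠ ∞) (h1 : a ≤ c + b)
    (h2 : b ≤ c + a) : ‖a.toReal - b.toReal‖ₑ ≤ c := by
  rcases eq_or_ne c ∞ with rfl | hc
  · exact le_top
  rw [← ofReal_norm, Real.norm_eq_abs]
  refine ENNReal.ofReal_le_of_le_toReal ?_
  have h3 := ENNReal.toReal_mono (ENNReal.add_ne_top.2 ⟨hc, hb⟩) h1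
  have h4 := ENNReal.toReal_mono (ENNReal.add_ne_top.2 ⟨hc, ha⟩) h2
  rw [ENNReal.toReal_add hc hb] at h3
  rw [ENNReal.toReal_add hc ha] at h4
  rw [abs_le]
  constructor <;> linarith

theorem CompressedBy.ae_curveMean_lt_top {C : ℝ≥0} (h : CompressedBy C m π) [SFinite π]
    (G : Lp ℝ p m) {t : I} (ht : 0 < t) : ∀ᵐ γ ∂π, curveMean p G t γ < ∞ := by
  have hr : 0 < p.toReal := zero_lt_one.trans one_lt_toReal
  have h1 : eLpNorm (curveMean p G t) p π < ∞ :=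
    (h.eLpNorm_curveMean_le (measurable_Lp G) ht).trans_lt (ENNReal.mul_lt_top
      (ENNReal.rpow_lt_top_of_nonneg (by positivity) ENNReal.coe_ne_top) (Lp.eLpNorm_lt_top G))
  have h2 : ∫⁻ γ, curveMean p G t γ ^ p.toReal ∂π ≠ ∞ := by
    have := eLpNorm_rpow_toReal (p := p) (curveMean p G t) π
    simp only [enorm_eq_self] at this
    rw [← this]
    exact ENNReal.rpow_ne_top_of_nonneg hr.le h1.ne
  filter_upwards [ae_lt_top ((measurable_curveMean (measurable_Lp G) t).pow_const _) h2] with γ hγ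
  exact (ENNReal.rpow_lt_top_iff_of_pos hr).1 hγ

/-- The mean and `|G(γ_0)|` are the `L^p` norms over `[0,t]` of `G ∘ γ` and of a constant, so the
reverse triangle inequality bounds their difference by the norm of `G(γ_s) - G(γ_0)`. After Tonelli
this is small uniformly in `s ≤ t`. -/
theorem CompressedBy.tendsto_curveMean [IsLocallyFiniteMeasure m] [IsFiniteMeasure π]
    {C : ℝ≥0} (h : CompressedBy C m π) (G : Lp ℝ p m) :
    Tendsto (fun t : I => eLpNorm (fun γ : C(I, X) =>
      (curveMean p G t γ).toReal - |G (γ 0)|) p π) (𝓝[>] 0) (𝓝 0) := by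
  have hr : 0 < p.toReal := zero_lt_one.trans one_lt_toReal
  have hGm := measurable_Lp G
  rw [ENNReal.tendsto_nhds_zero]
  intro ε hε
  obtain ⟨δ, hδ, hball⟩ := Metric.eventually_nhds_iff.1
    (ENNReal.tendsto_nhds_zero.1 (h.tendsto_eLpNorm_eval_sub G) ε hε)
  have hnear : ∀ᶠ t : I in 𝓝[>] 0, dist t 0 < δ := nhdsWithin_le_nhds (Metric.ball_mem_nhds 0 hδ)
  filter_upwards [hnear, self_mem_nhdsWithin] with t htδ ht
  have ht : 0 < t := ht
  have := isProbabilityMeasure_uniformOn ht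
  let K : C(I, X) × I → ℝ := fun x => G (x.1 x.2) - G (x.1 0)
  have hK : Measurable K := (hGm.comp measurable_eval).sub
    (hGm.comp ((continuous_eval_const 0).measurable.comp measurable_fst))
  let D : C(I, X) → ℝ≥0∞ := fun γ => eLpNorm (fun s => K (γ, s)) p (uniformOn t)
  have h1 : ∀ᵐ γ ∂π, ‖(curveMean p G t γ).toReal - |G (γ 0)|‖ₑ ≤ D γ := by
    filter_upwards [h.ae_curveMean_lt_top G ht] with γ hγ
    have m1 : AEStronglyMeasurable (fun s => K (γ, s)) (uniformOn t) :=
      (hK.comp measurable_prodMk_left).aestronglyMeasurable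
    have m2 : AEStronglyMeasurable (fun s => G (γ s)) (uniformOn t) :=
      (hGm.comp γ.continuous.measurable).aestronglyMeasurable
    have hconst : eLpNorm (fun _ : I => G (γ 0)) p (uniformOn t) = ‖G (γ 0)‖ₑ := by
      rw [eLpNorm_const _ ne_zero_of_exponent (NeZero.ne _)]
      simp
    have e1 : (fun s => G (γ s)) = (fun s => K (γ, s)) + fun _ => G (γ 0) := by
      funext s; simp [K]
    have e2 : (fun _ : I => G (γ 0)) = (fun s => G (γ s)) - fun s => K (γ, s) := by
      funext s; simp [K]
    have i1 : curveMean p G t γ ≤ D γ + ‖G (γ 0)‖ₑ := by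
      rw [curveMean, e1, ← hconst]
      exact eLpNorm_add_le m1 aestronglyMeasurable_const hp.one_lt.le
    have i2 : ‖G (γ 0)‖ₑ ≤ D γ + curveMean p G t γ := by
      rw [← hconst, e2, add_comm]
      exact eLpNorm_sub_le m2 m1 hp.one_lt.le
    have := enorm_toReal_sub_le hγ.ne enorm_ne_top i1 i2
    rwa [toReal_enorm, Real.norm_eq_abs] at this
  have h2 : eLpNorm D p π ≤ ε := by
    rw [← ENNReal.rpow_le_rpow_iff hr, eLpNorm_rpow_toReal]
    simp only [D, enorm_eq_self, eLpNorm_rpow_toReal]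
    rw [lintegral_lintegral_swap (f := fun γ s => ‖K (γ, s)‖ₑ ^ p.toReal)
      (hK.enorm.pow_const _).aemeasurable]
    calc ∫⁻ s, ∫⁻ γ, ‖K (γ, s)‖ₑ ^ p.toReal ∂π ∂(uniformOn t)
        ≤ ∫⁻ _, ε ^ p.toReal ∂(uniformOn t) := by
          refine lintegral_mono_ae ?_
          filter_upwards [ae_uniformOn_le t] with s hs
          rw [← eLpNorm_rpow_toReal]
          gcongr
          refine hball (lt_of_le_of_lt ?_ htδ)
          change |(s : ℝ) - 0| ≤ |(t : ℝ) - 0|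
          rw [sub_zero, sub_zero, abs_of_nonneg s.2.1, abs_of_nonneg t.2.1]
          exact hs
      _ = ε ^ p.toReal := by simp
  refine le_trans (eLpNorm_mono_enorm_ae ?_) h2
  simpa using h1

end KeyInequality

/-! ### Duality of `L^p` and `L^q`, and weak limits of sequences of linear maps. -/

section WeakCompactness

variable {Ω : Type*} [MeasurableSpace Ω] {μ : Measure Ω} {p q : ℝ≥0∞}
  [hp : FiniteExponent p] [hq : FiniteExponent q] [hpq : ENNReal.HolderConjugate p q]

variable (μ p q) in
/-- The pairing `(h, w) ↦ ∫ h w dμ` of `L^q(μ)` and `L^p(μ)`. -/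
def pairing : Lp ℝ q μ →L[ℝ] Lp ℝ p μ →L[ℝ] ℝ :=
  have : ENNReal.HolderConjugate q p := ENNReal.HolderConjugate.symm
  (ContinuousLinearMap.mul ℝ ℝ).lpPairing μ q p

theorem pairing_apply (h : Lp ℝ q μ) (w : Lp ℝ p μ) :
    pairing μ p q h w = ∫ x, h x * w x ∂μ := by
  have : ENNReal.HolderConjugate q p := ENNReal.HolderConjugate.symm
  exact (ContinuousLinearMap.mul ℝ ℝ).lpPairing_eq_integral h w

theorem integrable_mul_Lp (h : Lp ℝ q μ) (w : Lp ℝ p μ) : Integrable (fun x => h x * w x) μ := by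
  have : ENNReal.HolderConjugate q p := ENNReal.HolderConjugate.symm
  exact (Lp.memLp h).integrable_mul (Lp.memLp w)

theorem abs_pairing_le (h : Lp ℝ q μ) (w : Lp ℝ p μ) :
    |pairing μ p q h w| ≤ ‖pairing μ p q‖ * ‖h‖ * ‖w‖ :=
  (pairing μ p q).le_opNorm₂ h w

theorem abs_pairing_le_pairing_abs (h : Lp ℝ q μ) {w B : Lp ℝ p μ} (hw : |w| ≤ B) :
    |pairing μ p q h w| ≤ pairing μ p q |h| B := by
  rw [pairing_apply, pairing_apply]
  refine abs_integral_le_integral_abs.trans ?_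
  refine integral_mono_ae (integrable_mul_Lp h w).abs (integrable_mul_Lp |h| B) ?_
  filter_upwards [Lp.coeFn_abs h, Lp.coeFn_abs w, (Lp.coeFn_le _ _).2 hw] with x h1 h2 h3
  rw [h1, abs_mul]
  rw [h2] at h3
  gcongr

theorem pairing_indicator [IsFiniteMeasure μ] {A : Set Ω} (hA : MeasurableSet A) (c : ℝ)
    (w : Lp ℝ p μ) : pairing μ p q (indicatorConstLp q hA (measure_ne_top μ A) c) w =
      c * ∫ x in A, w x ∂μ := by
  rw [pairing_apply, ← integral_const_mul, ← integral_indicator hA]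
  refine integral_congr_ae ?_
  filter_upwards [indicatorConstLp_coeFn (p := q) (hs := hA) (hμs := measure_ne_top μ A) (c := c)]
    with x hx
  rw [hx]
  by_cases h : x ∈ A <;> simp [h]

theorem integrable_Lp [IsFiniteMeasure μ] (w : Lp ℝ p μ) : Integrable w μ :=
  (Lp.memLp w).integrable hp.one_lt.le

theorem ae_abs_le_of_setIntegral [IsFiniteMeasure μ] {w B : Ω → ℝ} (hw : Integrable w μ)
    (hB : Integrable B μ) (h : ∀ A, MeasurableSet A → |∫ x in A, w x ∂μ| ≤ ∫ x in A, B x ∂μ) :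
    ∀ᵐ x ∂μ, |w x| ≤ B x := by
  have h1 := ae_le_of_forall_setIntegral_le hw hB fun A hA _ => (le_abs_self _).trans (h A hA)
  have h2 := ae_le_of_forall_setIntegral_le hw.neg hB fun A hA _ => by
    simp only [Pi.neg_apply]
    rw [integral_neg]
    exact (neg_le_abs _).trans (h A hA)
  filter_upwards [h1, h2] with x a1 a2
  exact abs_le.2 ⟨by simp only [Pi.neg_apply] at a2; linarith, a1⟩

theorem abs_indicatorConstLp_one [IsFiniteMeasure μ] {A : Set Ω} (hA : MeasurableSet A) :
    |indicatorConstLp q hA (measure_ne_top μ A) (1 : ℝ)| =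
      indicatorConstLp q hA (measure_ne_top μ A) (1 : ℝ) := by
  apply Lp.ext
  filter_upwards [Lp.coeFn_abs (indicatorConstLp q hA (measure_ne_top μ A) (1 : ℝ)),
    indicatorConstLp_coeFn (p := q) (hs := hA) (hμs := measure_ne_top μ A) (c := (1 : ℝ))]
    with x h1 h2
  rw [h1, h2]
  by_cases h : x ∈ A <;> simp [h]

/-- Indicator functions as test functions reduce the claim to a comparison of integrals over all
measurable sets. -/
theorem abs_le_of_pairing_le [IsFiniteMeasure μ] {w B : Lp ℝ p μ}
    (h : ∀ k : Lp ℝ q μ, |pairing μ p q k w| ≤ pairing μ p q |k| B) : |w| ≤ B := by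
  rw [← Lp.coeFn_le]
  have h1 := ae_abs_le_of_setIntegral (integrable_Lp w) (integrable_Lp B) fun A hA => by
    have := h (indicatorConstLp q hA (measure_ne_top μ A) (1 : ℝ))
    rwa [abs_indicatorConstLp_one, pairing_indicator, pairing_indicator, one_mul, one_mul] at this
  filter_upwards [h1, Lp.coeFn_abs w] with x a1 a2
  rwa [a2]

theorem eq_of_pairing_eq [IsFiniteMeasure μ] {v w : Lp ℝ p μ}
    (h : ∀ k : Lp ℝ q μ, pairing μ p q k v = pairing μ p q k w) : v = w := by
  have h1 : |v - w| ≤ 0 := abs_le_of_pairing_le (q := q) fun k => by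
    rw [map_sub, h k, sub_self, map_zero, abs_zero]
  rw [← sub_eq_zero, ← norm_eq_zero, ← norm_abs_eq_norm, le_antisymm h1 (abs_nonneg _), norm_zero]

/-- A pointwise bound is equivalent to a family of linear bounds after testing, and these pass to
the limit when the dominating functions converge strongly. -/
theorem abs_le_of_tendsto_pairing [IsFiniteMeasure μ] {W B : ℕ → Lp ℝ p μ} {w b : Lp ℝ p μ}
    (hW : ∀ h : Lp ℝ q μ, Tendsto (fun j => pairing μ p q h (W j)) atTop (𝓝 (pairing μ p q h w)))
    (hB : Tendsto B atTop (𝓝 b)) (hle : ∀ j, |W j| ≤ B j) : |w| ≤ b :=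
  abs_le_of_pairing_le (q := q) fun k => le_of_tendsto_of_tendsto' (hW k).abs
    (((pairing μ p q |k|).continuous.tendsto b).comp hB)
    fun j => abs_pairing_le_pairing_abs k (hle j)

/-! ### Representation of functionals -/

open Classical in
/-- The signed measure `A ↦ Φ(χ_A)` of a functional on `L^q`. -/
def functionalMeasure [IsFiniteMeasure μ] (Φ : Lp ℝ q μ →L[ℝ] ℝ) : SignedMeasure Ω where
  measureOf' A := if hA : MeasurableSet A then
    Φ (indicatorConstLp q hA (measure_ne_top μ A) (1 : ℝ)) else 0
  empty' := by simp
  not_measurable' A hA := by simp [hA]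
  m_iUnion' f hf hd := by
    have hU : MeasurableSet (⋃ i, f i) := MeasurableSet.iUnion hf
    have hF : ∀ F : Finset ℕ, MeasurableSet (⋃ i ∈ F, f i) := fun F =>
      Finset.measurableSet_biUnion F fun i _ => hf i
    simp only [hf, hU, dif_pos]
    have hsum : ∀ F : Finset ℕ, ∑ i ∈ F, Φ (indicatorConstLp q (hf i) (measure_ne_top μ _) (1 : ℝ)) =
        Φ (indicatorConstLp q (hF F) (measure_ne_top μ _) (1 : ℝ)) := by
      intro F
      induction F using Finset.induction_on with
      | empty => simp
      | insert a F ha ih =>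
        rw [Finset.sum_insert ha, ih, ← map_add]
        congr 1
        have hdis : Disjoint (f a) (⋃ i ∈ F, f i) := by
          simp only [disjoint_iUnion_right]
          exact fun i hi => hd fun h => ha (h ▸ hi)
        rw [← indicatorConstLp_disjoint_union (hf a) (hF F) (measure_ne_top μ _)
          (measure_ne_top μ _) hdis]
        congr 1
        simp
    rw [HasSum]
    simp only [hsum]
    -- Countable additivity: the measure of the tail of the union tends to zero, so, `q` being
    -- finite, the indicators converge in `L^q`.
    refine (Φ.continuous.tendsto _).comp (tendsto_indicatorConstLp_set hq.lt_top.ne ?_)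
    have hlim : Tendsto (fun F : Finset ℕ => ∑' i : {i // i ∉ F}, μ (f i)) atTop (𝓝 0) :=
      ENNReal.tendsto_tsum_compl_atTop_zero (by
        rw [← measure_iUnion hd hf]; exact measure_ne_top μ _)
    refine tendsto_of_tendsto_of_tendsto_of_le_of_le tendsto_const_nhds hlim (fun _ => zero_le)
      fun F => ?_
    refine (measure_mono ?_).trans (measure_iUnion_le (μ := μ) fun i : {i // i ∉ F} => f i)
    rintro x (⟨h1, h2⟩ | ⟨h1, h2⟩)
    · exact absurd (iUnion₂_subset_iUnion _ _ h1) h2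
    · obtain ⟨i, hi⟩ := mem_iUnion.1 h1
      exact mem_iUnion.2 ⟨⟨i, fun hiF => h2 (mem_biUnion hiF hi)⟩, hi⟩

theorem functionalMeasure_apply [IsFiniteMeasure μ] (Φ : Lp ℝ q μ →L[ℝ] ℝ) {A : Set Ω}
    (hA : MeasurableSet A) : functionalMeasure Φ A =
      Φ (indicatorConstLp q hA (measure_ne_top μ A) (1 : ℝ)) := dif_pos hA

/-- A functional on `L^q` dominated by `h ↦ ∫ |h| B` is represented by a function of `L^p`. -/
theorem exists_pairing_eq [IsFiniteMeasure μ] (Φ : Lp ℝ q μ →L[ℝ] ℝ) {B : Lp ℝ p μ}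
    (hΦ : ∀ k, |Φ k| ≤ pairing μ p q |k| B) : ∃ w : Lp ℝ p μ, ∀ k, Φ k = pairing μ p q k w := by
  set ν := functionalMeasure Φ with hν
  have hac : ν ≪ᵥ μ.toENNRealVectorMeasure := by
    refine VectorMeasure.AbsolutelyContinuous.mk fun A hA h0 => ?_
    rw [Measure.toENNRealVectorMeasure_apply_measurable hA] at h0
    rw [hν, functionalMeasure_apply Φ hA]
    have : indicatorConstLp q hA (measure_ne_top μ A) (1 : ℝ) = 0 := by
      apply Lp.ext
      filter_upwards [indicatorConstLp_coeFn (p := q) (hs := hA) (hμs := measure_ne_top μ A)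
        (c := (1 : ℝ)), Lp.coeFn_zero ℝ q μ, measure_eq_zero_iff_ae_notMem.1 h0] with x h1 h2 h3
      rw [h1, h2]
      simp [h3]
    rw [this, map_zero]
  have hd := SignedMeasure.withDensityᵥ_rnDeriv_eq ν μ hac
  set w := ν.rnDeriv μ
  have hwi : Integrable w μ := SignedMeasure.integrable_rnDeriv ν μ
  have hA : ∀ A (hA : MeasurableSet A),
      Φ (indicatorConstLp q hA (measure_ne_top μ A) (1 : ℝ)) = ∫ x in A, w x ∂μ := by
    intro A hA
    rw [← functionalMeasure_apply Φ hA, ← hν, ← hd, withDensityᵥ_apply hwi hA]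
  -- The Radon-Nikodym density is a priori only integrable; the domination by `B` puts it in `L^p`.
  have hwB : ∀ᵐ x ∂μ, |w x| ≤ B x := ae_abs_le_of_setIntegral hwi (integrable_Lp B) fun A hA' => by
    have := hΦ (indicatorConstLp q hA' (measure_ne_top μ A) (1 : ℝ))
    rwa [abs_indicatorConstLp_one, hA A hA', pairing_indicator, one_mul] at this
  have hwp : MemLp w p μ := (Lp.memLp B).mono hwi.aestronglyMeasurable (by
    filter_upwards [hwB] with x hx
    rw [Real.norm_eq_abs, Real.norm_eq_abs]
    exact hx.trans (le_abs_self _))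
  refine ⟨hwp.toLp w, fun k => ?_⟩
  refine Lp.induction hq.lt_top.ne (motive := fun k => Φ k = pairing μ p q k (hwp.toLp w))
    (fun c A hA' _ => ?_) (fun f g hf hg _ h1 h2 => ?_) ?_ k
  · have e1 : (Lp.simpleFunc.indicatorConst q hA' (measure_ne_top μ A) c : Lp ℝ q μ) =
        indicatorConstLp q hA' (measure_ne_top μ A) c := Lp.simpleFunc.coe_indicatorConst _ _ _
    have e2 : indicatorConstLp q hA' (measure_ne_top μ A) c =
        c • indicatorConstLp q hA' (measure_ne_top μ A) (1 : ℝ) := by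
      apply Lp.ext
      filter_upwards [indicatorConstLp_coeFn (p := q) (hs := hA') (hμs := measure_ne_top μ A)
        (c := c), indicatorConstLp_coeFn (p := q) (hs := hA') (hμs := measure_ne_top μ A)
        (c := (1 : ℝ)), Lp.coeFn_smul c (indicatorConstLp q hA' (measure_ne_top μ A) (1 : ℝ))]
        with x h1 h2 h3
      rw [h1, h3, Pi.smul_apply, h2]
      by_cases h : x ∈ A <;> simp [h]
    rw [e1, pairing_indicator, e2, map_smul, hA A hA', smul_eq_mul]
    congr 1
    exact (setIntegral_congr_ae hA' (hwp.coeFn_toLp.mono fun x hx _ => hx)).symm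
  · rw [map_add, map_add, h1, h2]
    rfl
  · exact isClosed_eq Φ.continuous ((pairing μ p q).flip (hwp.toLp w)).continuous

theorem cauchySeq_of_approx {a : ℕ → ℝ}
    (h : ∀ ε > 0, ∃ b : ℕ → ℝ, CauchySeq b ∧ ∀ j, |a j - b j| ≤ ε) : CauchySeq a := by
  rw [Metric.cauchySeq_iff]
  intro ε hε
  obtain ⟨b, hb, hab⟩ := h (ε / 3) (by positivity)
  obtain ⟨N, hN⟩ := Metric.cauchySeq_iff.1 hb (ε / 3) (by positivity)
  refine ⟨N, fun i hi j hj => ?_⟩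
  have h1 := hN i hi j hj
  have h2 := abs_le.1 (hab i)
  have h3 := abs_le.1 (hab j)
  rw [Real.dist_eq, abs_lt] at h1 ⊢
  constructor <;> linarith [h1.1, h1.2, h2.1, h2.2, h3.1, h3.2]

/-- Simultaneous weak compactness for a sequence of linear maps into `L^p`. -/
theorem exists_subseq_tendsto_pairing [IsFiniteMeasure μ]
    [MeasurableSpace.CountablyGenerated Ω] {V : Type*} [AddCommGroup V] [Module ℝ V]
    (W : ℕ → V →ₗ[ℝ] Lp ℝ p μ) {D : Set V} (hD : D.Countable)
    (hdense : ∀ (g : V) (ε : ℝ), 0 < ε → ∃ g' ∈ D, ∀ i, ‖W i (g - g')‖ ≤ ε)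
    (hdom : ∀ g, ∃ (B : ℕ → Lp ℝ p μ) (b : Lp ℝ p μ), Tendsto B atTop (𝓝 b) ∧ ∀ i, |W i g| ≤ B i) :
    ∃ k : ℕ → ℕ, StrictMono k ∧ ∃ w : V →ₗ[ℝ] Lp ℝ p μ, ∀ (g : V) (h : Lp ℝ q μ),
      Tendsto (fun j => pairing μ p q h (W (k j) g)) atTop (𝓝 (pairing μ p q h (w g))) := by
  have hqtop : Fact (q ≠ ∞) := ⟨hq.lt_top.ne⟩
  set c := ‖pairing μ p q‖ with hc
  have hc0 : 0 ≤ c := by rw [hc]; exact norm_nonneg (pairing μ p q)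
  have hbdd : ∀ g, ∃ C : ℝ, 0 ≤ C ∧ ∀ i, ‖W i g‖ ≤ C := by
    intro g
    obtain ⟨B, b, hB, hle⟩ := hdom g
    obtain ⟨C, hC⟩ := isBounded_iff_forall_norm_le.1 (Metric.isBounded_range_of_tendsto B hB)
    have h1 : ∀ i, ‖W i g‖ ≤ C := fun i =>
      (norm_le_norm_of_abs_le_abs ((hle i).trans (le_abs_self _))).trans (hC _ ⟨i, rfl⟩)
    exact ⟨C, (norm_nonneg _).trans (h1 0), h1⟩
  choose C hC0 hC using hbdd
  -- `L^q` is separable because the σ-algebra is countably generated and `q` is finite.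
  let d := TopologicalSpace.denseSeq (Lp ℝ q μ)
  have hd : DenseRange d := TopologicalSpace.denseRange_denseSeq _
  have : Countable D := hD.to_subtype
  -- Countably many bounded real sequences form one sequence in a compact product of intervals; its
  -- sequential compactness does the work of a diagonal argument.
  let x : ℕ → D × ℕ → ℝ := fun i z => pairing μ p q (d z.2) (W i z.1)
  have hK : IsCompact (pi univ fun z : D × ℕ => Icc (-(c * ‖d z.2‖ * C z.1)) (c * ‖d z.2‖ * C z.1)) :=
    isCompact_univ_pi fun z => isCompact_Icc
  obtain ⟨y, -, k, hk, hlim⟩ := hK.tendsto_subseq (x := x) fun i z _ => by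
    refine abs_le.1 ((abs_pairing_le _ _).trans ?_)
    gcongr
    exact hC _ i
  have hlim' : ∀ z, Tendsto (fun j => x (k j) z) atTop (𝓝 (y z)) := tendsto_pi_nhds.1 hlim
  have hcau : ∀ g h, CauchySeq fun j => pairing μ p q h (W (k j) g) := by
    intro g h
    refine cauchySeq_of_approx fun ε hε => ?_
    -- Both arguments are approximated in turn, each at a cost of `ε / 2` uniformly in `j`; the
    -- added `1` keeps the denominators positive.
    obtain ⟨g', hg'D, hg'⟩ := hdense g (ε / 2 / (c * ‖h‖ + 1)) (by positivity)
    obtain ⟨n, hn⟩ := hd.exists_dist_lt h (ε := ε / 2 / (c * C g' + 1))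
      (by have := hC0 g'; positivity)
    refine ⟨fun j => x (k j) (⟨g', hg'D⟩, n), (hlim' _).cauchySeq, fun j => ?_⟩
    have e : pairing μ p q h (W (k j) g) - pairing μ p q (d n) (W (k j) g') =
        pairing μ p q h (W (k j) (g - g')) + pairing μ p q (h - d n) (W (k j) g') := by
      rw [map_sub, map_sub, map_sub, _root_.sub_apply]
      ring
    simp only [x]
    rw [e]
    refine (abs_add_le _ _).trans ?_
    have i1 : |pairing μ p q h (W (k j) (g - g'))| ≤ ε / 2 := by
      refine (abs_pairing_le _ _).trans ?_
      calc c * ‖h‖ * ‖W (k j) (g - g')‖ ≤ (c * ‖h‖ + 1) * (ε / 2 / (c * ‖h‖ + 1)) := by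
            gcongr
            · linarith
            · exact hg' _
        _ = ε / 2 := by field_simp
    have i2 : |pairing μ p q (h - d n) (W (k j) g')| ≤ ε / 2 := by
      have h0 := hC0 g'
      rw [dist_eq_norm] at hn
      refine (abs_pairing_le _ _).trans ?_
      calc c * ‖h - d n‖ * ‖W (k j) g'‖ ≤ c * (ε / 2 / (c * C g' + 1)) * C g' := by
            gcongr
            exact hC _ _
        _ = (c * C g') * (ε / 2 / (c * C g' + 1)) := by ring
        _ ≤ (c * C g' + 1) * (ε / 2 / (c * C g' + 1)) := by
            gcongr
            linarith
        _ = ε / 2 := by field_simp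
    linarith
  choose L hL using fun g h => cauchySeq_tendsto_of_complete (hcau g h)
  have hw : ∀ g, ∃ w : Lp ℝ p μ, ∀ h, L g h = pairing μ p q h w := by
    intro g
    obtain ⟨B, b, hB, hle⟩ := hdom g
    let Φ : Lp ℝ q μ →L[ℝ] ℝ := LinearMap.mkContinuous
      { toFun := L g
        map_add' := fun h h' => tendsto_nhds_unique (hL g (h + h')) (by
          simpa using (hL g h).add (hL g h'))
        map_smul' := fun r h => tendsto_nhds_unique (hL g (r • h)) (by
          simpa using (hL g h).const_mul r) } (c * C g) fun h => by
        refine le_of_tendsto (hL g h).norm (Eventually.of_forall fun j => ?_)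
        refine (abs_pairing_le _ _).trans ?_
        calc c * ‖h‖ * ‖W (k j) g‖ ≤ c * ‖h‖ * C g := by gcongr; exact hC _ _
          _ = c * C g * ‖h‖ := by ring
    -- The limit functional inherits the domination by the strong limit `b`, which is what its
    -- representation requires.
    exact exists_pairing_eq Φ (B := b) fun h => le_of_tendsto_of_tendsto' (hL g h).abs
      (((pairing μ p q |h|).continuous.tendsto b).comp (hB.comp hk.tendsto_atTop))
      fun j => abs_pairing_le_pairing_abs h (hle (k j))
  choose w hw using hw
  refine ⟨k, hk,
    { toFun := w
      map_add' := fun g g' => eq_of_pairing_eq (q := q) fun h => by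
        rw [← hw]
        refine tendsto_nhds_unique (hL _ h) ?_
        rw [map_add, ← hw, ← hw]
        simpa using (hL g h).add (hL g' h)
      map_smul' := fun r g => eq_of_pairing_eq (q := q) fun h => by
        rw [← hw]
        refine tendsto_nhds_unique (hL _ h) ?_
        rw [RingHom.id_apply, map_smul, ← hw]
        simpa using (hL g h).const_mul r }, fun g h => ?_⟩
  have := hL g h
  rwa [hw] at this

end WeakCompactness

/-! ### Strong continuity of the power map between Lebesgue spaces. -/

section PowerMap

/-- Both sides are homogeneous of degree `p`. If `a / b` is close to `1`, continuity of the power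
there gives the term with `ε`; otherwise `|a - b|` is comparable to the larger of `a` and `b`. -/
theorem abs_rpow_sub_rpow_le {p q r : ℝ} (hq : 0 < q) (hr : 0 < r) (hrq : r * q = p) {ε : ℝ}
    (hε : 0 < ε) : ∃ K : ℝ, 0 ≤ K ∧ ∀ a b : ℝ, 0 ≤ a → 0 ≤ b →
      |a ^ r - b ^ r| ^ q ≤ ε * b ^ p + K * |a - b| ^ p := by
  have hcont : Continuous fun x : ℝ => |x ^ r - 1| ^ q :=
    (Real.continuous_rpow_const hq.le).comp
      (((Real.continuous_rpow_const hr.le).sub continuous_const).abs)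
  have h1 : ∀ᶠ x in 𝓝 (1 : ℝ), |x ^ r - 1| ^ q < ε := by
    refine (hcont.tendsto 1).eventually (gt_mem_nhds ?_)
    simpa [Real.zero_rpow hq.ne'] using hε
  obtain ⟨δ, hδ, hball⟩ := Metric.eventually_nhds_iff.1 h1
  -- If `|a - b| ≥ δ b`, then `b ≤ |a - b| / δ` and `a ≤ (1 + 1 / δ) |a - b|`.
  refine ⟨(1 + 1 / δ) ^ p, by positivity, fun a b ha hb => ?_⟩
  by_cases hab : |a - b| < δ * b
  · have hb0 : 0 < b := by
      by_contra h
      have : b = 0 := le_antisymm (not_lt.1 h) hb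
      rw [this, mul_zero] at hab
      exact absurd hab (not_lt.2 (abs_nonneg _))
    have h2 : |(a / b) ^ r - 1| ^ q < ε := by
      refine hball ?_
      rw [Real.dist_eq, show a / b - 1 = (a - b) / b by field_simp, abs_div, abs_of_pos hb0,
        div_lt_iff₀ hb0]
      exact hab
    have h3 : |a ^ r - b ^ r| ^ q = b ^ p * |(a / b) ^ r - 1| ^ q := by
      rw [← hrq, Real.rpow_mul hb, ← Real.mul_rpow (by positivity) (abs_nonneg _)]
      congr 1
      rw [← abs_of_nonneg (show 0 ≤ b ^ r by positivity), ← abs_mul, abs_of_nonneg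
        (show 0 ≤ b ^ r by positivity), mul_sub, mul_one, ← Real.mul_rpow hb (by positivity),
        mul_div_cancel₀ _ hb0.ne']
    rw [h3]
    have h4 : b ^ p * |(a / b) ^ r - 1| ^ q ≤ b ^ p * ε := by gcongr
    have h5 : 0 ≤ (1 + 1 / δ) ^ p * |a - b| ^ p := by positivity
    linarith
  · rw [not_lt] at hab
    set M := (1 + 1 / δ) * |a - b| with hM
    have hbM' : b ≤ 1 / δ * |a - b| := by
      rw [one_div, ← div_eq_inv_mul, le_div_iff₀ hδ]
      linarith
    have h0 := abs_nonneg (a - b)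
    have hbM : b ≤ M := by rw [hM, add_mul, one_mul]; linarith
    have haM : a ≤ M := by
      rw [hM, add_mul, one_mul]
      linarith [le_abs_self (a - b)]
    have hM0 : 0 ≤ M := by positivity
    have h2 : |a ^ r - b ^ r| ≤ M ^ r := by
      have e1 : a ^ r ≤ M ^ r := by gcongr
      have e2 : b ^ r ≤ M ^ r := by gcongr
      have e3 : 0 ≤ a ^ r := by positivity
      have e4 : 0 ≤ b ^ r := by positivity
      rw [abs_le]
      constructor <;> linarith
    have h3 : |a ^ r - b ^ r| ^ q ≤ (1 + 1 / δ) ^ p * |a - b| ^ p := by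
      calc |a ^ r - b ^ r| ^ q ≤ (M ^ r) ^ q := by gcongr
        _ = M ^ p := by rw [← Real.rpow_mul hM0, hrq]
        _ = _ := by rw [hM, Real.mul_rpow (by positivity) h0]
    have : 0 ≤ ε * b ^ p := by positivity
    linarith

/-- Continuity of the power map `X ↦ X ^ (p / q)` from the positive cone of `L^p` to `L^q`. -/
theorem tendsto_eLpNorm_rpow_sub {Ω ι : Type*} [MeasurableSpace Ω] {μ : Measure Ω} {l : Filter ι}
    {p q : ℝ≥0∞} [hp : FiniteExponent p] [hq : FiniteExponent q] {Y : ι → Ω → ℝ} {Z : Ω → ℝ}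
    (hY : ∀ i x, 0 ≤ Y i x) (hZ : ∀ᵐ x ∂μ, 0 ≤ Z x) (hZp : MemLp Z p μ)
    (h : Tendsto (fun i => eLpNorm (fun x => Y i x - Z x) p μ) l (𝓝 0)) :
    Tendsto (fun i => eLpNorm (fun x => Y i x ^ (p.toReal / q.toReal) -
      Z x ^ (p.toReal / q.toReal)) q μ) l (𝓝 0) := by
  have hp0 : 0 < p.toReal := zero_lt_one.trans one_lt_toReal
  have hq0 : 0 < q.toReal := zero_lt_one.trans one_lt_toReal
  set r := p.toReal / q.toReal with hr
  have hr0 : 0 < r := by positivity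
  have hrq : r * q.toReal = p.toReal := div_mul_cancel₀ _ hq0.ne'
  have hlim : Tendsto (fun i => eLpNorm (fun x => Y i x - Z x) p μ ^ p.toReal) l (𝓝 0) := by
    have := (ENNReal.continuous_rpow_const (y := p.toReal)).tendsto 0 |>.comp h
    rwa [ENNReal.zero_rpow_of_pos hp0] at this
  set A := ∫⁻ x, ‖Z x‖ₑ ^ p.toReal ∂μ with hA
  have hAt : A ≠ ∞ := by
    rw [hA, ← eLpNorm_rpow_toReal]
    exact ENNReal.rpow_ne_top_of_nonneg hp0.le hZp.2.ne
  have key : Tendsto (fun i => ∫⁻ x, ‖Y i x ^ r - Z x ^ r‖ₑ ^ q.toReal ∂μ) l (𝓝 0) := by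
    rw [ENNReal.tendsto_nhds_zero]
    intro η hη
    -- `ε` makes the term in `Z` cost less than `η / 2`; `K` is then fixed, and the other term
    -- vanishes in the limit.
    obtain ⟨ε, hε, hεA⟩ := ENNReal.exists_nnreal_pos_mul_lt hAt (ENNReal.half_pos hη.ne').ne'
    obtain ⟨K, hK0, hK⟩ := abs_rpow_sub_rpow_le hq0 hr0 hrq (NNReal.coe_pos.2 hε)
    have h1 := ENNReal.Tendsto.const_mul (a := ENNReal.ofReal K) hlim (Or.inr ENNReal.ofReal_ne_top)
    rw [mul_zero] at h1
    filter_upwards [ENNReal.tendsto_nhds_zero.1 h1 (η / 2) (ENNReal.half_pos hη.ne')] with i hi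
    have h2 : ∫⁻ x, ‖Y i x ^ r - Z x ^ r‖ₑ ^ q.toReal ∂μ ≤
        ∫⁻ x, (ε * ‖Z x‖ₑ ^ p.toReal + ENNReal.ofReal K * ‖Y i x - Z x‖ₑ ^ p.toReal) ∂μ := by
      refine lintegral_mono_ae ?_
      filter_upwards [hZ] with x hx
      have h3 := ENNReal.ofReal_le_ofReal (hK (Y i x) (Z x) (hY i x) hx)
      rw [ENNReal.ofReal_add (by positivity) (by positivity), ENNReal.ofReal_mul (by positivity),
        ENNReal.ofReal_mul hK0, ← ENNReal.ofReal_rpow_of_nonneg (abs_nonneg _) hq0.le,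
        ← ENNReal.ofReal_rpow_of_nonneg (abs_nonneg _) hp0.le,
        ← ENNReal.ofReal_rpow_of_nonneg hx hp0.le, ENNReal.ofReal_coe_nnreal,
        ← Real.enorm_eq_ofReal_abs, ← Real.enorm_eq_ofReal_abs, ← Real.enorm_of_nonneg hx] at h3
      exact h3
    refine h2.trans ?_
    rw [lintegral_add_left' ((hZp.1.aemeasurable.enorm.pow_const _).const_mul _),
      lintegral_const_mul' _ _ ENNReal.coe_ne_top, lintegral_const_mul' _ _ ENNReal.ofReal_ne_top]
    rw [eLpNorm_rpow_toReal] at hi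
    exact (add_le_add hεA.le hi).trans (le_of_eq (ENNReal.add_halves η))
  have := (ENNReal.continuous_rpow_const (y := 1 / q.toReal)).tendsto 0 |>.comp key
  rw [ENNReal.zero_rpow_of_pos (by positivity)] at this
  refine this.congr fun i => ?_
  rw [eLpNorm_eq_lintegral_rpow_enorm_toReal ne_zero_of_exponent hq.lt_top.ne]
  rfl

end PowerMap

/-! ### Essential infima as strong limits of finite minima. -/

section GreatestLowerBound

variable {Ω : Type*} [MeasurableSpace Ω] {μ : Measure Ω} {p : ℝ≥0∞} [hp : FiniteExponent p]

/-- The essential infimum of a set is the limit of a sequence of finite infima of its elements. -/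
theorem exists_tendsto_of_isGLB {S : Set (Lp ℝ p μ)} (hne : S.Nonempty) {G : Lp ℝ p μ}
    (hG : IsGLB S G) :
    ∃ b : ℕ → Lp ℝ p μ, (∀ n, b n ∈ infClosure S) ∧ Tendsto b atTop (𝓝 G) := by
  have hr : 0 < p.toReal := zero_lt_one.trans one_lt_toReal
  have hG' : IsGLB (infClosure S) G := by simpa using hG
  set T := infClosure S with hT
  have hTc : InfClosed T := infClosed_infClosure
  have hTne : T.Nonempty := hne.mono subset_infClosure
  set N : Lp ℝ p μ → ℝ := fun F => ‖F - G‖ ^ p.toReal with hN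
  have hbdd : BddBelow (N '' T) := ⟨0, by rintro _ ⟨F, -, rfl⟩; simp only [hN]; positivity⟩
  set J := sInf (N '' T) with hJ
  have hJle : ∀ F ∈ T, J ≤ N F := fun F hF => csInf_le hbdd ⟨F, hF, rfl⟩
  -- Superadditivity of `x ↦ x^p` makes norms of decrements telescope, so running minima of a
  -- minimizing sequence are Cauchy.
  have hgap : ∀ {c d : Lp ℝ p μ}, G ≤ c → c ≤ d → ‖d - c‖ ^ p.toReal ≤ N d - N c := by
    intro c d hc hcd
    have := norm_sub_rpow_le (sub_nonneg.2 hc) (sub_le_sub_right hcd G)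
    rwa [sub_sub_sub_cancel_right] at this
  have hNmono : ∀ {c d : Lp ℝ p μ}, G ≤ c → c ≤ d → N c ≤ N d := by
    intro c d hc hcd
    have h1 := hgap hc hcd
    have h0 : 0 ≤ ‖d - c‖ ^ p.toReal := by positivity
    linarith
  have hex : ∀ n : ℕ, ∃ F ∈ T, N F < J + 1 / ((n : ℝ) + 1) := by
    intro n
    obtain ⟨_, ⟨F, hF, rfl⟩, h⟩ := exists_lt_of_csInf_lt (hTne.image N)
      (show sInf (N '' T) < J + 1 / ((n : ℝ) + 1) by
        rw [← hJ]; linarith [Nat.one_div_pos_of_nat (α := ℝ) (n := n)])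
    exact ⟨F, hF, h⟩
  choose a haT ha using hex
  let b : ℕ → Lp ℝ p μ := fun n => Nat.rec (a 0) (fun k c => c ⊓ a (k + 1)) n
  have hbs : ∀ n, b (n + 1) = b n ⊓ a (n + 1) := fun n => rfl
  have hbT : ∀ n, b n ∈ T := by
    intro n
    induction n with
    | zero => exact haT 0
    | succ k ih => rw [hbs]; exact hTc ih (haT _)
  have hba : ∀ n, b n ≤ a n := by
    intro n
    cases n with
    | zero => exact le_rfl
    | succ k => rw [hbs]; exact inf_le_right
  have hanti : Antitone b := antitone_nat_of_succ_le fun n => by rw [hbs]; exact inf_le_left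
  have hNb : ∀ n, N (b n) < J + 1 / ((n : ℝ) + 1) := fun n =>
    (hNmono (hG'.1 (hbT n)) (hba n)).trans_lt (ha n)
  have hcau : CauchySeq b := by
    refine cauchySeq_of_norm_rpow fun ε hε => ?_
    obtain ⟨M, hM⟩ := exists_nat_one_div_lt hε
    refine ⟨M, fun n k hn hk => ?_⟩
    have h1 := hgap (hG'.1 (hbT k)) (hanti hk)
    have h2 := hJle _ (hbT k)
    have h3 := hNb n
    have h4 : 1 / ((n : ℝ) + 1) ≤ 1 / ((M : ℝ) + 1) := by gcongr
    linarith
  obtain ⟨c, hc⟩ := cauchySeq_tendsto_of_complete hcau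
  -- Taking the minimum with another `s ∈ T` can lower `N` only by a vanishing amount, hence does
  -- not change the limit `c`; uniqueness of the infimum then gives `c = G`.
  have hcG : IsGLB T c := by
    refine ⟨fun s hs => ?_, fun d hd => ge_of_tendsto' hc fun n => hd (hbT n)⟩
    have hlim : Tendsto (fun n => b n - b n ⊓ s) atTop (𝓝 (c - c ⊓ s)) :=
      hc.sub (hc.inf_nhds tendsto_const_nhds)
    have hlim0 : Tendsto (fun n => b n - b n ⊓ s) atTop (𝓝 0) := by
      refine tendsto_of_norm_rpow (tendsto_one_div_add_atTop_nhds_zero_nat (𝕜 := ℝ)) fun n => ?_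
      have hm : b n ⊓ s ∈ T := hTc (hbT n) hs
      have h1 := hgap (hG'.1 hm) (inf_le_left : b n ⊓ s ≤ b n)
      have h2 := hJle _ hm
      have h3 := hNb n
      linarith
    have := tendsto_nhds_unique hlim hlim0
    rw [sub_eq_zero] at this
    exact inf_eq_left.1 this.symm
  exact ⟨b, hbT, hcG.unique hG' ▸ hc⟩

end GreatestLowerBound

/-! ### Small Sobolev norm gives a relaxed slope of small norm. -/

section SlopeBound

variable {X : Type*} [MetricSpace X] [MeasurableSpace X] [BorelSpace X] {p : ℝ≥0∞}
  [hp : FiniteExponent p] {m : Measure X}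

/-- Sublinearity of the slope and of the distance to `f` allows convex combinations of the functions
together with their bounds, which the selection of a strongly convergent sequence needs. -/
theorem convex_slopeBounds (f : Lp ℝ p m) (e : ℝ≥0∞) :
    Convex ℝ {G : Lp ℝ p m | 0 ≤ G ∧ ∃ v : X → ℝ, IsLipBs v ∧
      eLpNorm (fun x => v x - f x) p m ≤ e ∧ ∀ᵐ x ∂m, slope v x ≤ ENNReal.ofReal (G x)} := by
  rintro F ⟨hF, v, v1, v2, v3⟩ G ⟨hG, w, w1, w2, w3⟩ a b ha hb hab
  have hnn : ∀ {c : ℝ} {G : Lp ℝ p m}, 0 ≤ c → 0 ≤ G → ∀ᵐ x ∂m, 0 ≤ (c • G : Lp ℝ p m) x := by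
    intro c G hc hG
    filter_upwards [Lp.coeFn_smul c G, (Lp.coeFn_nonneg _).2 hG] with x a1 a2
    rw [a1]
    exact mul_nonneg hc a2
  refine ⟨add_nonneg ((Lp.coeFn_nonneg _).1 (hnn ha hF)) ((Lp.coeFn_nonneg _).1 (hnn hb hG)),
    a • v + b • w, (v1.smul a).add (w1.smul b), ?_, ?_⟩
  · have h := eLpNorm_add_sub_le (v1.smul a) (w1.smul b) (a • f) (b • f)
    rw [← add_smul, hab, one_smul, eLpNorm_smul_sub, eLpNorm_smul_sub] at h
    refine h.trans ?_
    calc ‖a‖ₑ * eLpNorm (fun x => v x - f x) p m + ‖b‖ₑ * eLpNorm (fun x => w x - f x) p m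
        ≤ ‖a‖ₑ * e + ‖b‖ₑ * e := by gcongr
      _ = e := by
        rw [← add_mul, Real.enorm_of_nonneg ha, Real.enorm_of_nonneg hb,
          ← ENNReal.ofReal_add ha hb, hab, ENNReal.ofReal_one, one_mul]
  · filter_upwards [v3, w3, Lp.coeFn_add (a • F) (b • G), Lp.coeFn_smul a F,
      Lp.coeFn_smul b G, hnn ha hF, hnn hb hG] with x a1 a2 a3 a4 a5 a6 a7
    rw [a3, Pi.add_apply, ENNReal.ofReal_add a6 a7, a4, a5, Pi.smul_apply, Pi.smul_apply,
      smul_eq_mul, smul_eq_mul, ENNReal.ofReal_mul ha, ENNReal.ofReal_mul hb]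
    refine (slope_add_le _ _ _).trans (add_le_add ?_ ?_)
    · refine (slope_smul_le _ _ _).trans ?_
      rw [abs_of_nonneg ha]
      gcongr
    · refine (slope_smul_le _ _ _).trans ?_
      rw [abs_of_nonneg hb]
      gcongr

/-- A function with small relaxed energy has a small relaxed slope. -/
theorem exists_relaxedSlope_norm_le {f : Lp ℝ p m} {u : ℕ → X → ℝ} (hu : IsLipApprox u f)
    {ε : ℝ} (hε : 0 ≤ ε) (hlim : liminf (fun n => ∫⁻ x, slope (u n) x ^ p.toReal ∂m) atTop <
      ENNReal.ofReal (ε ^ p.toReal)) : ∃ G ∈ relaxedSlopes f, ‖G‖ ≤ ε := by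
  have hr : 0 < p.toReal := zero_lt_one.trans one_lt_toReal
  have hM := frequently_lt_of_liminf_lt (by isBoundedDefault) hlim
  let e : ℕ → ℝ≥0∞ := fun n => ENNReal.ofReal (1 / ((n : ℝ) + 1))
  have he0 : ∀ n, 0 < e n := fun n => ENNReal.ofReal_pos.2 (by positivity)
  have helim : Tendsto e atTop (𝓝 0) := by
    have := ENNReal.tendsto_ofReal (tendsto_one_div_add_atTop_nhds_zero_nat (𝕜 := ℝ))
    rwa [ENNReal.ofReal_zero] at this
  -- Intersecting with a closed ball keeps the sets convex and forces the norm bound on the limit.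
  let Z : ℕ → Set (Lp ℝ p m) := fun n => {G | 0 ≤ G ∧ ∃ v : X → ℝ, IsLipBs v ∧
    eLpNorm (fun x => v x - f x) p m ≤ e n ∧ ∀ᵐ x ∂m, slope v x ≤ ENNReal.ofReal (G x)} ∩
      Metric.closedBall 0 ε
  have hconv : ∀ n, Convex ℝ (Z n) := fun n =>
    (convex_slopeBounds f (e n)).inter (convex_closedBall 0 ε)
  have hanti : Antitone Z := by
    rintro n k hnk G ⟨⟨h0, v, v1, v2, v3⟩, h1⟩
    refine ⟨⟨h0, v, v1, v2.trans (ENNReal.ofReal_le_ofReal ?_), v3⟩, h1⟩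
    gcongr
  have hne : ∀ n, ∃ G ∈ Z n, ‖G‖ ^ p.toReal ≤ ε ^ p.toReal := by
    intro n
    obtain ⟨k, hk1, hk2⟩ := (hM.and_eventually
      (hu.2.eventually (gt_mem_nhds (he0 n)))).exists
    obtain ⟨G, g1, g2, g3⟩ := exists_Lp_slope (M := (ε ^ p.toReal).toNNReal) (hu.1 k) hk1
    rw [Real.coe_toNNReal _ (by positivity)] at g3
    have g4 : ‖G‖ ≤ ε := (Real.rpow_le_rpow_iff (norm_nonneg _) hε hr).1 g3
    exact ⟨G, ⟨⟨g1, u k, hu.1 k, hk2.le, g2⟩, mem_closedBall_zero_iff.2 g4⟩, g3⟩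
  obtain ⟨H, hH, G, hG⟩ := exists_selection hconv hanti (fun n G h => h.1.1) hne
  choose h0 v v1 v2 v3 using fun n => (hH n).1
  refine ⟨G, ⟨v, H, ⟨v1, tendsto_of_tendsto_of_tendsto_of_le_of_le tendsto_const_nhds helim
    (fun _ => zero_le) v2⟩, h0, v3, hG⟩, ?_⟩
  exact mem_closedBall_zero_iff.1 (Metric.isClosed_closedBall.mem_of_tendsto hG
    (Eventually.of_forall fun n => (hH n).2))

/-- The `L^p` part of the norm is discarded, and the factor `p` cancels the `p⁻¹` in the Cheeger
energy. This turns Sobolev approximation into uniform control of the quotients. -/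
theorem exists_relaxedSlope_of_sobolevNorm_lt {g : Sobolev p m} {ε : ℝ} (hε : 0 < ε)
    (h : sobolevNorm g < ENNReal.ofReal ε) :
    ∃ G ∈ relaxedSlopes (g : Lp ℝ p m), ‖G‖ ≤ ε := by
  have hr : 0 < p.toReal := zero_lt_one.trans one_lt_toReal
  have hp0 : p ≠ 0 := ne_zero_of_exponent
  have hpt : p ≠ ∞ := hp.lt_top.ne
  have h1 : p * cheegerEnergy (g : Lp ℝ p m) < ENNReal.ofReal (ε ^ p.toReal) := by
    have h2 := ENNReal.rpow_lt_rpow h hr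
    rw [sobolevNorm, ← ENNReal.rpow_mul, one_div_mul_cancel hr.ne', ENNReal.rpow_one,
      ENNReal.ofReal_rpow_of_nonneg hε.le hr.le] at h2
    exact lt_of_le_of_lt le_add_self h2
  have h2 : cheegerEnergy (g : Lp ℝ p m) < p⁻¹ * ENNReal.ofReal (ε ^ p.toReal) := by
    rw [← ENNReal.mul_lt_mul_iff_right hp0 hpt, ← mul_assoc, ENNReal.mul_inv_cancel hp0 hpt,
      one_mul]
    exact h1
  obtain ⟨u, hu'⟩ := iInf_lt_iff.1 h2
  obtain ⟨hu, h3⟩ := iInf_lt_iff.1 hu'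
  rw [ENNReal.liminf_const_mul_of_ne_top (ENNReal.inv_ne_top.2 hp0)] at h3
  exact exists_relaxedSlope_norm_le hu hε.le (lt_of_mul_lt_mul_left' h3)

end SlopeBound

/-! ### Extension of dominated linear maps to generated modules. -/

section Lifting

variable {Ω Ω' : Type*} [MeasurableSpace Ω] [MeasurableSpace Ω'] {μ : Measure Ω} {ν : Measure Ω'}
  {φ : Ω → Ω'} {p q : ℝ≥0∞} [hp : FiniteExponent p] [hq : FiniteExponent q]
  [hpq : ENNReal.HolderConjugate p q]

variable (μ p q) in
/-- Pointwise a.e. multiplication `L^p(μ) × L^q(μ) → L^1(μ)`. -/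
def mulL1 : Lp ℝ p μ →L[ℝ] Lp ℝ q μ →L[ℝ] Lp ℝ 1 μ :=
  (ContinuousLinearMap.mul ℝ ℝ).holderL μ p q 1

theorem coeFn_mulL1 (f : Lp ℝ p μ) (g : Lp ℝ q μ) :
    mulL1 μ p q f g =ᵐ[μ] fun x => f x * g x := by
  simpa [mulL1] using (ContinuousLinearMap.mul ℝ ℝ).coeFn_holder (r := 1) f g

theorem exists_norm_compLp_le (h : BoundedCompression φ μ ν) :
    ∃ C : ℝ, ∀ f : Lp ℝ p ν, ‖compLp h f‖ ≤ C * ‖f‖ := by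
  obtain ⟨C, hC⟩ := h.bound
  refine ⟨((C : ℝ≥0∞) ^ (1 / p).toReal).toReal, fun f => ?_⟩
  have hfin : (C : ℝ≥0∞) ^ (1 / p).toReal ≠ ∞ :=
    ENNReal.rpow_ne_top_of_nonneg ENNReal.toReal_nonneg ENNReal.coe_ne_top
  rw [compLp, Lp.norm_toLp, Lp.norm_def, ← ENNReal.toReal_mul]
  refine ENNReal.toReal_mono (ENNReal.mul_ne_top hfin (Lp.eLpNorm_ne_top f)) ?_
  calc eLpNorm (fun x => f (φ x)) p μ = eLpNorm f p (μ.map φ) :=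
        (eLpNorm_map_measure (Lp.stronglyMeasurable f).aestronglyMeasurable
          h.measurable.aemeasurable).symm
    _ ≤ eLpNorm f p ((C : ℝ≥0∞) • ν) := eLpNorm_mono_measure _ hC
    _ = (C : ℝ≥0∞) ^ (1 / p).toReal * eLpNorm f p ν := by
        rw [eLpNorm_smul_measure_of_ne_top hp.lt_top.ne, smul_eq_mul]

/-- The composition `f ↦ f ∘ φ`, as a continuous linear map. -/
def compLpL (h : BoundedCompression φ μ ν) : Lp ℝ p ν →L[ℝ] Lp ℝ p μ :=
  LinearMap.mkContinuousOfExistsBound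
    { toFun := compLp h
      map_add' := fun f g => by
        apply Lp.ext
        filter_upwards [coeFn_compLp h (f + g), coeFn_compLp h f, coeFn_compLp h g,
          Lp.coeFn_add (compLp h f) (compLp h g), h.quasi.ae (Lp.coeFn_add f g)]
          with x h1 h2 h3 h4 h5
        rw [h1, h4, Pi.add_apply, h2, h3, h5, Pi.add_apply]
      map_smul' := fun c f => by
        apply Lp.ext
        filter_upwards [coeFn_compLp h (c • f), coeFn_compLp h f,
          Lp.coeFn_smul c (compLp h f), h.quasi.ae (Lp.coeFn_smul c f)] with x h1 h2 h3 h4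
        rw [h1, RingHom.id_apply, h3, Pi.smul_apply, h2, h4, Pi.smul_apply] }
    (exists_norm_compLp_le h)

theorem continuous_compLp (h : BoundedCompression φ μ ν) :
    Continuous (compLp h : Lp ℝ p ν → Lp ℝ p μ) := (compLpL h).continuous

theorem boundedCompression_id : BoundedCompression (id : Ω → Ω) μ μ :=
  ⟨measurable_id, 1, by simp⟩

theorem compLp_id (f : Lp ℝ p μ) : compLp boundedCompression_id f = f :=
  Lp.ext (coeFn_compLp boundedCompression_id f)

theorem norm_mulL1_le (f : Lp ℝ p μ) (g : Lp ℝ q μ) : ‖mulL1 μ p q f g‖ ≤ ‖f‖ * ‖g‖ := by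
  have := (ContinuousLinearMap.mul ℝ ℝ).norm_holder_apply_apply_le (r := 1) f g
  simpa [mulL1] using this

variable {V : Type*} [AddCommGroup V] [Module ℝ V] {ψ : PtSeminorm p ν V}

theorem memLp_lift (hφ : Measurable φ) (ℓ : V →ₗ[ℝ] Lp ℝ 1 μ) (s : SimpleForm ψ) :
    MemLp (fun x => ℓ (s.fn (φ x)) x) 1 μ := by
  classical
  let s' : SimpleFunc Ω' V := s
  have : (fun x => ℓ (s.fn (φ x)) x) =
      fun x => ∑ v ∈ s'.range, (φ ⁻¹' (s' ⁻¹' {v})).indicator (ℓ v) x := by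
    funext x
    rw [Finset.sum_eq_single (s' (φ x))]
    · simp [Set.indicator, SimpleForm.fn, s']
    · intro v _ hv
      simp [Set.indicator, Ne.symm hv]
    · intro h
      exact absurd (s'.mem_range_self (φ x)) h
  rw [this]
  exact memLp_finsetSum _ fun v _ => (Lp.memLp _).indicator (hφ (s'.measurableSet_fiber v))

/-- A simple form takes finitely many values, so the exceptional null sets can be united; the value
may then vary with the point. -/
theorem ae_forall_fn (s : SimpleForm ψ) {P : V → Ω → Prop} (h : ∀ v, ∀ᵐ x ∂μ, P v x) :
    ∀ᵐ x ∂μ, P (s.fn (φ x)) x := by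
  have : ∀ᵐ x ∂μ, ∀ v ∈ Set.range s.fn, P v x :=
    (ae_ball_iff s.fn_finite.countable).2 fun v _ => h v
  filter_upwards [this] with x hx
  exact hx _ ⟨φ x, rfl⟩

theorem ae_forall_fn₂ (s t : SimpleForm ψ) {P : V → V → Ω → Prop}
    (h : ∀ v w, ∀ᵐ x ∂μ, P v w x) : ∀ᵐ x ∂μ, P (s.fn (φ x)) (t.fn (φ x)) x := by
  have : ∀ᵐ x ∂μ, ∀ v ∈ Set.range s.fn, ∀ w ∈ Set.range t.fn, P v w x :=
    (ae_ball_iff s.fn_finite.countable).2 fun v _ =>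
      (ae_ball_iff t.fn_finite.countable).2 fun w _ => h v w
  filter_upwards [this] with x hx
  exact hx _ ⟨φ x, rfl⟩ _ ⟨φ x, rfl⟩

/-- The map `∑ χ_{A_i} v_i ↦ ∑ χ_{A_i} ∘ φ · ℓ(v_i)` on simple forms. -/
def liftSimple (hφ : Measurable φ) (ℓ : V →ₗ[ℝ] Lp ℝ 1 μ) : SimpleForm ψ →ₗ[ℝ] Lp ℝ 1 μ where
  toFun s := (memLp_lift hφ ℓ s).toLp _
  map_add' s t := by
    apply Lp.ext
    filter_upwards [(memLp_lift hφ ℓ (s + t)).coeFn_toLp, (memLp_lift hφ ℓ s).coeFn_toLp,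
      (memLp_lift hφ ℓ t).coeFn_toLp, Lp.coeFn_add ((memLp_lift hφ ℓ s).toLp _)
        ((memLp_lift hφ ℓ t).toLp _),
      ae_forall_fn₂ (φ := φ) (μ := μ) s t (P := fun v w x => ℓ (v + w) x = ℓ v x + ℓ w x)
        fun v w => by rw [map_add]; exact Lp.coeFn_add _ _] with x h1 h2 h3 h4 h5
    rw [h1, h4, Pi.add_apply, h2, h3, SimpleForm.fn_add, h5]
  map_smul' c s := by
    apply Lp.ext
    filter_upwards [(memLp_lift hφ ℓ (c • s)).coeFn_toLp, (memLp_lift hφ ℓ s).coeFn_toLp,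
      Lp.coeFn_smul c ((memLp_lift hφ ℓ s).toLp _),
      ae_forall_fn (φ := φ) (μ := μ) s (P := fun v x => ℓ (c • v) x = c * ℓ v x)
        fun v => by rw [map_smul]; exact Lp.coeFn_smul _ _] with x h1 h2 h3 h4
    rw [h1, RingHom.id_apply, h3, Pi.smul_apply, h2, SimpleForm.fn_smul, h4, smul_eq_mul]

theorem coeFn_liftSimple (hφ : Measurable φ) (ℓ : V →ₗ[ℝ] Lp ℝ 1 μ) (s : SimpleForm ψ) :
    liftSimple hφ ℓ s =ᵐ[μ] fun x => ℓ (s.fn (φ x)) x := (memLp_lift hφ ℓ s).coeFn_toLp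

theorem abs_liftSimple_le (h : BoundedCompression φ μ ν) {ℓ : V →ₗ[ℝ] Lp ℝ 1 μ} {N : Lp ℝ q μ}
    (hℓ : ∀ v, |ℓ v| ≤ mulL1 μ p q (compLp h (ψ.toFun v)) N) (s : SimpleForm ψ) :
    |liftSimple h.measurable ℓ s| ≤ mulL1 μ p q (compLp h s.pn) N := by
  rw [← Lp.coeFn_le]
  have h1 : ∀ v, ∀ᵐ x ∂μ, |ℓ v x| ≤ ψ.toFun v (φ x) * N x := fun v => by
    filter_upwards [(Lp.coeFn_le _ _).2 (hℓ v), Lp.coeFn_abs (ℓ v),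
      coeFn_mulL1 (compLp h (ψ.toFun v)) N, coeFn_compLp h (ψ.toFun v)] with x a1 a2 a3 a4
    rwa [a2, a3, a4] at a1
  filter_upwards [ae_forall_fn (φ := φ) s h1, Lp.coeFn_abs (liftSimple h.measurable ℓ s),
    coeFn_liftSimple h.measurable ℓ s, coeFn_mulL1 (compLp h s.pn) N, coeFn_compLp h s.pn,
    h.quasi.ae (SimpleForm.coeFn_pn s)] with x a1 a2 a3 a4 a5 a6
  rw [a2, a3, a4, a5, a6]
  exact a1

/-- A linear map `ℓ : V → L^1(μ)` with `|ℓ v| ≤ ψ(v) ∘ φ · N` extends to the generated module. -/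
theorem exists_lift (h : BoundedCompression φ μ ν) {ℓ : V →ₗ[ℝ] Lp ℝ 1 μ} {N : Lp ℝ q μ}
    (hℓ : ∀ v, |ℓ v| ≤ mulL1 μ p q (compLp h (ψ.toFun v)) N) :
    ∃ T : GenModule ψ →L[ℝ] Lp ℝ 1 μ,
      (∀ s, T (GenModule.incl ψ s) = liftSimple h.measurable ℓ s) ∧
      ∀ w, |T w| ≤ mulL1 μ p q (compLp h (LpNormedModule.pnorm (p := p) (μ := ν) w)) N := by
  obtain ⟨C, hC⟩ := exists_norm_compLp_le (p := p) h
  have hbound : ∀ s : SimpleForm ψ, ‖liftSimple h.measurable ℓ s‖ ≤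
      C * ‖N‖ * ‖(GenModule.incl ψ).toLinearMap s‖ := by
    intro s
    change _ ≤ C * ‖N‖ * ‖GenModule.incl ψ s‖
    rw [GenModule.norm_incl, SimpleForm.norm_def]
    calc ‖liftSimple h.measurable ℓ s‖ ≤ ‖mulL1 μ p q (compLp h s.pn) N‖ :=
          norm_le_norm_of_abs_le_abs ((abs_liftSimple_le h hℓ s).trans (le_abs_self _))
      _ ≤ ‖compLp h s.pn‖ * ‖N‖ := norm_mulL1_le _ _
      _ ≤ C * ‖s.pn‖ * ‖N‖ := by gcongr; exact hC _
      _ = C * ‖N‖ * ‖s.pn‖ := by ring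
  let T : GenModule ψ →L[ℝ] Lp ℝ 1 μ :=
    (liftSimple h.measurable ℓ).extendOfNorm (GenModule.incl ψ).toLinearMap
  have hT : ∀ s, T (GenModule.incl ψ s) = liftSimple h.measurable ℓ s := fun s =>
    LinearMap.extendOfNorm_eq (GenModule.denseRange_incl ψ) ⟨_, hbound⟩ s
  refine ⟨T, hT, fun w => ?_⟩
  change |T w| ≤ mulL1 μ p q (compLp h (GenModule.ptNorm ψ w)) N
  refine (GenModule.denseRange_incl ψ).induction_on w ?_ fun s => ?_
  · have c1 : Continuous fun w => |T w| := T.continuous.sup T.continuous.neg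
    have c2 : Continuous fun w => mulL1 μ p q (compLp h (GenModule.ptNorm ψ w)) N :=
      ((mulL1 μ p q).flip N).continuous.comp
        ((continuous_compLp h).comp (GenModule.continuous_ptNorm ψ))
    exact isClosed_le c1 c2
  · rw [hT, GenModule.ptNorm_incl]
    exact abs_liftSimple_le h hℓ s

theorem lift_gen (hφ : Measurable φ) {ℓ : V →ₗ[ℝ] Lp ℝ 1 μ} {T : GenModule ψ →L[ℝ] Lp ℝ 1 μ}
    (hT : ∀ s, T (GenModule.incl ψ s) = liftSimple hφ ℓ s) (v : V) : T (GenModule.gen ψ v) = ℓ v :=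
  (hT _).trans (Lp.ext (coeFn_liftSimple hφ ℓ _))

/-- Over the same base space the extension is also `L^∞`-linear: for simple multipliers on simple
forms this is real homogeneity of `ℓ` on each piece, and density does the rest. -/
theorem exists_moduleDual {ψ : PtSeminorm p μ V} {ℓ : V →ₗ[ℝ] Lp ℝ 1 μ} {N : Lp ℝ q μ}
    (hℓ : ∀ v, |ℓ v| ≤ mulL1 μ p q (ψ.toFun v) N) :
    ∃ T : ModuleDual μ (GenModule ψ), (∀ v, T.toCLM (GenModule.gen ψ v) = ℓ v) ∧
      ∀ w, |T.toCLM w| ≤ mulL1 μ p q (LpNormedModule.pnorm (p := p) (μ := μ) w) N := by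
  obtain ⟨T, hT, hle⟩ := exists_lift (φ := id) (q := q) (ℓ := ℓ) (N := N) (ψ := ψ)
    boundedCompression_id (fun v => by rw [compLp_id]; exact hℓ v)
  refine ⟨⟨T, fun g v => ?_⟩, lift_gen _ hT, fun w => ?_⟩
  · rw [GenModule.smul_def]
    refine GenModule.clm_ext_incl ψ (f := fun v => T (GenModule.act ψ g v))
      (g := fun v => mulLp μ 1 g (T v)) (by fun_prop) (by fun_prop) (fun s => ?_) v
    refine GenModule.ext_simple (f := fun g => T (GenModule.act ψ g (GenModule.incl ψ s)))
      (g := fun g => mulLp μ 1 g (T (GenModule.incl ψ s))) (by fun_prop) (by fun_prop)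
      (fun a => ?_) g
    rw [GenModule.act_simple, hT, hT]
    apply Lp.ext
    have ha : ∀ᵐ x ∂μ, ∀ c ∈ Set.range a, ∀ v ∈ Set.range s.fn, ℓ (c • v) x = c * ℓ v x := by
      refine (ae_ball_iff a.finite_range.countable).2 fun c _ =>
        (ae_ball_iff s.fn_finite.countable).2 fun v _ => ?_
      rw [map_smul]
      exact Lp.coeFn_smul _ _
    filter_upwards [coeFn_liftSimple measurable_id ℓ (SimpleForm.mulSimple a s),
      coeFn_liftSimple measurable_id ℓ s, coeFn_simpleToLinf (μ := μ) a,
      coeFn_mulLp (simpleToLinf μ a) (liftSimple measurable_id ℓ s), ha] with x h1 h2 h3 h4 h5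
    rw [h1, h4, h3, h2, id, SimpleForm.fn_mulSimple]
    exact h5 _ ⟨x, rfl⟩ _ ⟨x, rfl⟩
  · have := hle w
    rwa [compLp_id] at this

end Lifting

/-! ### Identification of the pointwise dual norm. -/

section DualElements

variable {Ω : Type*} [MeasurableSpace Ω] {μ : Measure Ω} {p q : ℝ≥0∞} [hp : FiniteExponent p]
  [hq : FiniteExponent q] [hpq : ENNReal.HolderConjugate p q]
  {M : Type*} [NormedAddCommGroup M] [NormedSpace ℝ M] [Module (Lp ℝ ∞ μ) M]
  [LpNormedModule p μ M]

/-- Cutting off small values keeps the inverse bounded, by `n + 1`. With `w = |v|`, the multiple `a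
• v` is a bounded substitute for `v / |v|`. -/
theorem exists_linf_inv (w : Lp ℝ p μ) (n : ℕ) : ∃ a : Lp ℝ ∞ μ, ∀ᵐ x ∂μ,
    a x = if 1 / ((n : ℝ) + 1) < w x then (w x)⁻¹ else 0 := by
  have hw : Measurable w := (Lp.stronglyMeasurable w).measurable
  have hm : Measurable fun x => if 1 / ((n : ℝ) + 1) < w x then (w x)⁻¹ else 0 :=
    Measurable.ite (measurableSet_lt measurable_const hw) hw.inv measurable_const
  have hL : MemLp (fun x => if 1 / ((n : ℝ) + 1) < w x then (w x)⁻¹ else 0) ∞ μ := by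
    refine memLp_top_of_bound hm.aestronglyMeasurable ((n : ℝ) + 1) (Eventually.of_forall fun x => ?_)
    have hn : (0 : ℝ) < (n : ℝ) + 1 := by positivity
    split_ifs with h
    · have h0 : 0 < w x := lt_trans (by positivity) h
      rw [Real.norm_of_nonneg (by positivity), inv_le_comm₀ h0 hn, ← one_div]
      exact h.le
    · simpa using hn.le
  exact ⟨hL.toLp _, hL.coeFn_toLp⟩

/-- A criterion for membership in `Dual(v)`. -/
theorem mem_dualSet {ω : ModuleDual μ M} {v : M} {N : Lp ℝ q μ} (hN0 : 0 ≤ N)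
    (hω : ∀ w, |ω.toCLM w| ≤ mulL1 μ p q (LpNormedModule.pnorm (p := p) (μ := μ) w) N)
    (hv : ∀ᵐ x ∂μ, ω.toCLM v x = LpNormedModule.pnorm (p := p) (μ := μ) v x ^ p.toReal)
    (hN : ∀ᵐ x ∂μ, N x = LpNormedModule.pnorm (p := p) (μ := μ) v x ^ (p.toReal / q.toReal)) :
    ω ∈ DualSet μ p q v := by
  have hp0 : 0 < p.toReal := zero_lt_one.trans one_lt_toReal
  have hq0 : 0 < q.toReal := zero_lt_one.trans one_lt_toReal
  have hc : p.toReal.HolderConjugate q.toReal := ENNReal.HolderConjugate.toReal one_lt_toReal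
  set w := LpNormedModule.pnorm (p := p) (μ := μ) v with hw
  have hw0 : ∀ᵐ x ∂μ, 0 ≤ w x := (Lp.coeFn_nonneg _).2 (LpNormedModule.pnorm_nonneg v)
  refine ⟨N, ⟨?_, fun N' hN' => ?_⟩, ?_⟩
  · rintro _ ⟨u, hu, rfl⟩
    rw [← AEEqFun.coeFn_le]
    filter_upwards [hu, (Lp.coeFn_le _ _).2 (hω u), Lp.coeFn_abs (ω.toCLM u),
      AEEqFun.coeFn_abs (ω.toCLM u : Ω →ₘ[μ] ℝ), coeFn_mulL1 (LpNormedModule.pnorm (p := p) u) N,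
      (Lp.coeFn_nonneg _).2 hN0] with x h1 h2 h3 h4 h5 h6
    rw [h4]
    rw [h3, h5] at h2
    exact h2.trans (mul_le_of_le_one_left h6 h1)
  -- Minimality of `N`: where `w > 1 / (n + 1)`, testing with `a n • v` yields `w^{p-1}`, and `p - 1
  -- = p / q` by conjugacy.
  · choose a ha using exists_linf_inv w
    have key : ∀ n, ∀ᵐ x ∂μ, |a n x * w x ^ p.toReal| ≤ N' x := by
      intro n
      have h1 : |(ω.toCLM (a n • v) : Ω →ₘ[μ] ℝ)| ≤ N' := by
        refine hN' ⟨a n • v, ?_, rfl⟩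
        rw [LpNormedModule.pnorm_smul]
        filter_upwards [coeFn_mulLp |a n| w, Lp.coeFn_abs (a n), ha n, hw0] with x h1 h2 h3 h4
        rw [h1, h2, h3]
        split_ifs with h
        · have h0 : 0 < w x := lt_trans (by positivity) h
          rw [abs_of_nonneg (by positivity), inv_mul_cancel₀ h0.ne']
        · simp
      rw [ω.map_linf_smul, ← AEEqFun.coeFn_le] at h1
      filter_upwards [h1, AEEqFun.coeFn_abs (mulLp μ 1 (a n) (ω.toCLM v) : Ω →ₘ[μ] ℝ),
        coeFn_mulLp (a n) (ω.toCLM v), hv] with x h1 h2 h3 h4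
      rw [h2] at h1
      have h3' : (mulLp μ 1 (a n) (ω.toCLM v) : Ω →ₘ[μ] ℝ) x = a n x * ω.toCLM v x := h3
      rwa [h3', h4] at h1
    rw [← AEEqFun.coeFn_le]
    filter_upwards [ae_all_iff.2 key, ae_all_iff.2 ha, hN, hw0] with x h1 h2 h3 h4
    rw [h3]
    rcases h4.eq_or_lt with h0 | h0
    -- Where `w = 0` also `N = 0`, and every upper bound is nonnegative.
    · rw [← h0, Real.zero_rpow (by positivity)]
      exact (abs_nonneg _).trans (h1 0)
    · obtain ⟨n, hn⟩ := exists_nat_one_div_lt h0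
      have h5 := (le_abs_self _).trans (h1 n)
      rw [h2 n, if_pos hn] at h5
      refine le_trans (le_of_eq ?_) h5
      rw [hc.div_conj_eq_sub_one, Real.rpow_sub h0, Real.rpow_one, div_eq_inv_mul]
  · filter_upwards [hv, hN, hw0] with x h1 h2 h3
    refine ⟨h1, ?_⟩
    rw [h2, ← Real.rpow_mul h3, div_mul_cancel₀ _ hq0.ne']

end DualElements

/-! ### The energy quotients as bounded linear maps into `L^p(π)`. -/

section QuotientMap

variable {X : Type*} [MetricSpace X] [SecondCountableTopology X] {p q : ℝ≥0∞}
  [hp : FiniteExponent p] [hq : FiniteExponent q] [hpq : ENNReal.HolderConjugate p q]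
  [MeasurableSpace X] [BorelSpace X] {m : Measure X} {π : Measure C(I, X)}

theorem IsTestPlan.ae_enorm_energyQuotient_le (h : IsTestPlan q m π) {g G : Lp ℝ p m}
    (hG : G ∈ relaxedSlopes g) {t : I} (ht : 0 < t) :
    ∀ᵐ γ ∂π, ‖energyQuotient q g t γ‖ₑ ≤ curveMean p G t γ := by
  filter_upwards [h.ae_isACq, h.ae_edist_le hG ht] with γ h1 h2
  exact enorm_energyQuotient_le h2 (curveEnergy_lt_top h1 ht).ne

theorem IsTestPlan.eLpNorm_energyQuotient_le (h : IsTestPlan q m π) {C : ℝ≥0}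
    (hC : CompressedBy C m π) {g G : Lp ℝ p m} (hG : G ∈ relaxedSlopes g) {t : I} (ht : 0 < t) :
    eLpNorm (energyQuotient q g t) p π ≤ (C : ℝ≥0∞) ^ (1 / p.toReal) * eLpNorm G p m := by
  have := h.isProbabilityMeasure
  refine le_trans (eLpNorm_mono_enorm_ae ?_) (hC.eLpNorm_curveMean_le (measurable_Lp G) ht)
  simpa using h.ae_enorm_energyQuotient_le hG ht

theorem const_rpow_lt_top (C : ℝ≥0) : (C : ℝ≥0∞) ^ (1 / p.toReal) < ∞ :=
  ENNReal.rpow_lt_top_of_nonneg (by positivity) ENNReal.coe_ne_top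

theorem IsTestPlan.memLp_energyQuotient (h : IsTestPlan q m π) (g : Sobolev p m) {t : I}
    (ht : 0 < t) : MemLp (energyQuotient q (g : Lp ℝ p m) t) p π := by
  obtain ⟨C, -, hC⟩ := h.compression
  obtain ⟨G, hG⟩ := MemSobolev.relaxedSlopes_nonempty g.2
  exact ⟨(measurable_energyQuotient (measurable_Lp _) t).aestronglyMeasurable,
    (h.eLpNorm_energyQuotient_le hC hG ht).trans_lt
      (ENNReal.mul_lt_top (const_rpow_lt_top C) (Lp.eLpNorm_lt_top G))⟩

/-- The map `g ↦ (g ∘ e_t - g ∘ e_0) / E_{q,t}` from `W^{1,p}(X)` to `L^p(π)`. -/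
def IsTestPlan.quotientMap (h : IsTestPlan q m π) {t : I} (ht : 0 < t) :
    Sobolev p m →ₗ[ℝ] Lp ℝ p π where
  toFun g := (h.memLp_energyQuotient g ht).toLp _
  map_add' f g := by
    rw [← MemLp.toLp_add]
    refine MemLp.toLp_congr _ _ ?_
    filter_upwards [(h.boundedCompression t).quasi.ae (Lp.coeFn_add (f : Lp ℝ p m) g),
      (h.boundedCompression 0).quasi.ae (Lp.coeFn_add (f : Lp ℝ p m) g)] with γ h1 h2
    simp only [energyQuotient, Submodule.coe_add, h1, h2, Pi.add_apply]
    ring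
  map_smul' c g := by
    rw [RingHom.id_apply, ← MemLp.toLp_const_smul]
    refine MemLp.toLp_congr _ _ ?_
    filter_upwards [(h.boundedCompression t).quasi.ae (Lp.coeFn_smul c (g : Lp ℝ p m)),
      (h.boundedCompression 0).quasi.ae (Lp.coeFn_smul c (g : Lp ℝ p m))] with γ h1 h2
    simp only [energyQuotient, Submodule.coe_smul, h1, h2, Pi.smul_apply, smul_eq_mul]
    ring

theorem IsTestPlan.coeFn_quotientMap (h : IsTestPlan q m π) {t : I} (ht : 0 < t)
    (g : Sobolev p m) : h.quotientMap ht g =ᵐ[π] energyQuotient q (g : Lp ℝ p m) t :=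
  (h.memLp_energyQuotient g ht).coeFn_toLp

/-- The constant is independent of `t`; this equicontinuity lets a countable dense set of Sobolev
functions decide convergence. -/
theorem IsTestPlan.norm_quotientMap_le (h : IsTestPlan q m π) {C : ℝ≥0}
    (hC : CompressedBy C m π) {g : Sobolev p m} {G : Lp ℝ p m}
    (hG : G ∈ relaxedSlopes (g : Lp ℝ p m)) {t : I} (ht : 0 < t) :
    ‖h.quotientMap ht g‖ ≤ ((C : ℝ≥0∞) ^ (1 / p.toReal)).toReal * ‖G‖ := by
  change ‖(h.memLp_energyQuotient g ht).toLp _‖ ≤ _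
  rw [Lp.norm_toLp, Lp.norm_def, ← ENNReal.toReal_mul]
  exact ENNReal.toReal_mono
    (ENNReal.mul_lt_top (const_rpow_lt_top C) (Lp.eLpNorm_lt_top G)).ne
    (h.eLpNorm_energyQuotient_le hC hG ht)

theorem IsTestPlan.memLp_curveMean (h : IsTestPlan q m π) (G : Lp ℝ p m) {t : I} (ht : 0 < t) :
    MemLp (fun γ => (curveMean p G t γ).toReal) p π := by
  have := h.isProbabilityMeasure
  obtain ⟨C, -, hC⟩ := h.compression
  refine ⟨(measurable_curveMean (measurable_Lp G) t).ennreal_toReal.aestronglyMeasurable, ?_⟩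
  refine lt_of_le_of_lt (eLpNorm_mono_enorm_ae ?_)
    ((CompressedBy.eLpNorm_curveMean_le hC (measurable_Lp G) ht).trans_lt
      (ENNReal.mul_lt_top (const_rpow_lt_top C) (Lp.eLpNorm_lt_top G)))
  refine Eventually.of_forall fun γ => ?_
  rw [Real.enorm_of_nonneg ENNReal.toReal_nonneg]
  exact ENNReal.ofReal_toReal_le

/-- The difference quotients are dominated by a sequence converging in `L^p(π)` to `G ∘ e_0`. -/
theorem IsTestPlan.exists_dominating [IsLocallyFiniteMeasure m] (h : IsTestPlan q m π) {t : ℕ → I}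
    (ht0 : ∀ i, 0 < t i) (ht : Tendsto t atTop (𝓝 0)) {g : Sobolev p m} {G : Lp ℝ p m}
    (hG : G ∈ relaxedSlopes (g : Lp ℝ p m)) :
    ∃ B : ℕ → Lp ℝ p π, Tendsto B atTop (𝓝 (compLp (h.boundedCompression 0) G)) ∧
      ∀ i, |h.quotientMap (ht0 i) g| ≤ B i := by
  have := h.isProbabilityMeasure
  obtain ⟨C, -, hC⟩ := h.compression
  have hC : CompressedBy C m π := hC
  have ht' : Tendsto t atTop (𝓝[>] 0) :=
    tendsto_nhdsWithin_iff.2 ⟨ht, Eventually.of_forall ht0⟩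
  refine ⟨fun i => (h.memLp_curveMean G (ht0 i)).toLp _, ?_, fun i => ?_⟩
  · rw [Lp.tendsto_Lp_iff_tendsto_eLpNorm']
    refine ((hC.tendsto_curveMean G).comp ht').congr fun i => eLpNorm_congr_ae ?_
    filter_upwards [(h.memLp_curveMean G (ht0 i)).coeFn_toLp,
      coeFn_compLp (h.boundedCompression 0) G, (h.boundedCompression 0).quasi.ae
        ((Lp.coeFn_nonneg _).2 (nonneg_of_mem_relaxedSlopes hG))] with γ h1 h2 h3
    simp only [Pi.sub_apply, h1, h2]
    rw [abs_of_nonneg h3]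
  · rw [← Lp.coeFn_le]
    filter_upwards [(h.memLp_curveMean G (ht0 i)).coeFn_toLp,
      Lp.coeFn_abs (h.quotientMap (ht0 i) g), h.coeFn_quotientMap (ht0 i) g,
      h.ae_enorm_energyQuotient_le hG (ht0 i), hC.ae_curveMean_lt_top G (ht0 i)]
      with γ h1 h2 h3 h4 h5
    rw [h1, h2, h3, ← Real.norm_eq_abs, ← toReal_enorm]
    exact ENNReal.toReal_mono h5.ne h4

end QuotientMap

/-! ### Strong limits from the gradient hypothesis, and bounds by the minimal slope. -/

section SpeedAndMinimalSlope

variable {X : Type*} [MetricSpace X] [SecondCountableTopology X] {p q : ℝ≥0∞}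
  [hp : FiniteExponent p] [hq : FiniteExponent q] [hpq : ENNReal.HolderConjugate p q]
  [MeasurableSpace X] [BorelSpace X] {m : Measure X} {π : Measure C(I, X)}

theorem curveEnergy_le_mul_one (t : I) (γ : C(I, X)) (h : IsACq q γ) : curveEnergy q t γ ≤
    ENNReal.ofReal t * (ENNReal.ofReal t)⁻¹ ^ (1 / q.toReal) * curveEnergy q 1 γ := by
  have hr : 0 < q.toReal := zero_lt_one.trans one_lt_toReal
  rw [curveEnergy, curveEnergy, if_pos h, if_pos h,
    ENNReal.mul_rpow_of_nonneg _ _ (by positivity), mul_assoc]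
  simp only [Icc.coe_one, ENNReal.ofReal_one, inv_one, one_mul]
  gcongr
  exact unitInterval.le_one'

/-- Only the energy at time `1` is integrable by assumption; enlarging the interval of integration
bounds the earlier ones by a multiple of it. -/
theorem IsTestPlan.memLp_speed (h : IsTestPlan q m π) {t : I} (ht : 0 < t) :
    MemLp (fun γ => (curveEnergy q t γ).toReal / t) q π := by
  have hr : 0 < q.toReal := zero_lt_one.trans one_lt_toReal
  have h1 : MemLp (fun γ => (curveEnergy q 1 γ).toReal) q π := by
    refine ⟨(measurable_curveEnergy 1).ennreal_toReal.aestronglyMeasurable, ?_⟩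
    rw [eLpNorm_lt_top_iff_lintegral_rpow_enorm_lt_top ne_zero_of_exponent hq.lt_top.ne]
    refine lt_of_le_of_lt (lintegral_mono fun γ => ?_) h.finite_energy
    rw [Real.enorm_of_nonneg ENNReal.toReal_nonneg]
    gcongr
    exact ENNReal.ofReal_toReal_le
  set c : ℝ≥0∞ := ENNReal.ofReal t * (ENNReal.ofReal t)⁻¹ ^ (1 / q.toReal) with hc
  have ht' : (ENNReal.ofReal t)⁻¹ ≠ ∞ :=
    ENNReal.inv_ne_top.2 (ENNReal.ofReal_pos.2 (by exact_mod_cast ht)).ne'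
  have hct : c ≠ ∞ := ENNReal.mul_ne_top ENNReal.ofReal_ne_top
    (ENNReal.rpow_ne_top_of_nonneg (by positivity) ht')
  refine (h1.const_mul (c.toReal / t)).of_le
    ((measurable_curveEnergy t).ennreal_toReal.div_const _).aestronglyMeasurable ?_
  filter_upwards [h.ae_isACq] with γ hγ
  have h0 : (0 : ℝ) ≤ t := t.2.1
  rw [Real.norm_of_nonneg (by positivity), Real.norm_of_nonneg (by positivity), div_mul_eq_mul_div,
    ← ENNReal.toReal_mul]
  gcongr
  · exact ENNReal.mul_ne_top hct (curveEnergy_lt_top hγ zero_lt_one).ne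
  · exact curveEnergy_le_mul_one t γ hγ

theorem exponent_mul : q.toReal / p.toReal * (p.toReal / q.toReal) = 1 := by
  have h1 : 0 < p.toReal := zero_lt_one.trans one_lt_toReal
  have h2 : 0 < q.toReal := zero_lt_one.trans one_lt_toReal
  field_simp

theorem memLp_rpow_div {Ω : Type*} [MeasurableSpace Ω] {μ : Measure Ω} (Z : Lp ℝ p μ) :
    MemLp (fun x => Z x ^ (p.toReal / q.toReal)) q μ := by
  have h1 : 0 < p.toReal := zero_lt_one.trans one_lt_toReal
  have h2 : 0 < q.toReal := zero_lt_one.trans one_lt_toReal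
  have h := (Lp.memLp Z).norm_rpow_div (ENNReal.ofReal (p.toReal / q.toReal))
  have e : p / ENNReal.ofReal (p.toReal / q.toReal) = q := by
    rw [ENNReal.ofReal_div_of_pos h2, ENNReal.ofReal_toReal hp.lt_top.ne,
      ENNReal.ofReal_toReal hq.lt_top.ne]
    exact ENNReal.div_div_cancel ne_zero_of_exponent hp.lt_top.ne
  rw [e, ENNReal.toReal_ofReal (by positivity)] at h
  refine h.of_le ((Lp.stronglyMeasurable Z).measurable.pow_const _).aestronglyMeasurable
    (Eventually.of_forall fun x => ?_)
  rw [Real.norm_eq_abs, Real.norm_eq_abs, abs_of_nonneg (a := ‖Z x‖ ^ _) (by positivity)]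
  exact Real.abs_rpow_le_abs_rpow _ _

/-- The functions `E_{q,t} / t` converge in `L^q(π)` to `|Df|_p ^ (p / q) ∘ e_0`. -/
theorem RepresentsGradient.tendsto_speed {f : Sobolev p m} (h : RepresentsGradient q π f)
    {t : ℕ → I} (ht0 : ∀ i, 0 < t i) (ht : Tendsto t atTop (𝓝 0)) :
    Tendsto (fun i => (h.isTestPlan.memLp_speed (ht0 i)).toLp _) atTop
      (𝓝 ((memLp_rpow_div (q := q)
        (compLp (h.isTestPlan.boundedCompression 0) (minSlope f))).toLp _)) := by
  have ht' : Tendsto t atTop (𝓝[>] 0) :=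
    tendsto_nhdsWithin_iff.2 ⟨ht, Eventually.of_forall ht0⟩
  have hnn : ∀ (i : ℕ) (γ : C(I, X)), 0 ≤ (curveEnergy q (t i) γ).toReal / t i := fun i γ =>
    div_nonneg ENNReal.toReal_nonneg (t i).2.1
  have hcomp := coeFn_compLp (h.isTestPlan.boundedCompression 0) (minSlope f)
  -- The hypothesis concerns `(E_{q,t} / t)^{q/p}` in `L^p`; the exponent `p / q` undoes the power
  -- and moves the convergence to `L^q`.
  have hlim := tendsto_eLpNorm_rpow_sub (p := p) (q := q) (μ := π) (l := atTop)
    (Y := fun i γ => ((curveEnergy q (t i) γ).toReal / t i) ^ (q.toReal / p.toReal))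
    (Z := compLp (h.isTestPlan.boundedCompression 0) (minSlope f))
    (fun i γ => Real.rpow_nonneg (hnn i γ) _)
    (by
      filter_upwards [hcomp, (h.isTestPlan.boundedCompression 0).quasi.ae
        ((Lp.coeFn_nonneg _).2 (minSlope_nonneg f))] with γ h1 h2
      rw [h1]
      exact h2) (Lp.memLp _)
    ((h.tendsto_energy.comp ht').congr fun i => eLpNorm_congr_ae (by
      filter_upwards [hcomp] with γ h1
      rw [h1]))
  rw [Lp.tendsto_Lp_iff_tendsto_eLpNorm']
  refine hlim.congr fun i => eLpNorm_congr_ae ?_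
  filter_upwards [(h.isTestPlan.memLp_speed (ht0 i)).coeFn_toLp, (memLp_rpow_div (q := q)
    (compLp (h.isTestPlan.boundedCompression 0) (minSlope f))).coeFn_toLp] with γ h1 h2
  rw [Pi.sub_apply, h1, h2, ← Real.rpow_mul (hnn i γ), exponent_mul, Real.rpow_one]

theorem RepresentsGradient.tendsto_quotientMap {f : Sobolev p m} (h : RepresentsGradient q π f)
    {t : ℕ → I} (ht0 : ∀ i, 0 < t i) (ht : Tendsto t atTop (𝓝 0)) :
    Tendsto (fun i => h.isTestPlan.quotientMap (ht0 i) f) atTop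
      (𝓝 (compLp (h.isTestPlan.boundedCompression 0) (minSlope f))) := by
  have ht' : Tendsto t atTop (𝓝[>] 0) :=
    tendsto_nhdsWithin_iff.2 ⟨ht, Eventually.of_forall ht0⟩
  rw [Lp.tendsto_Lp_iff_tendsto_eLpNorm']
  refine (h.tendsto_quotient.comp ht').congr fun i => eLpNorm_congr_ae ?_
  filter_upwards [coeFn_compLp (h.isTestPlan.boundedCompression 0) (minSlope f),
    h.isTestPlan.coeFn_quotientMap (ht0 i) f] with γ h1 h2
  rw [Pi.sub_apply, h1, h2, energyQuotient]

/-- Composition with `φ` commutes with finite minima, so the functions whose composition dominates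
`w` are closed under them. -/
theorem le_compLp_of_mem_infClosure {Ω : Type*} [MeasurableSpace Ω] {μ : Measure Ω} {Ω' : Type*}
    [MeasurableSpace Ω'] {ν : Measure Ω'} {φ : Ω → Ω'} (h : BoundedCompression φ μ ν)
    {S : Set (Lp ℝ p ν)} {w : Lp ℝ p μ} (hS : ∀ G ∈ S, w ≤ compLp h G) {G : Lp ℝ p ν}
    (hG : G ∈ infClosure S) : w ≤ compLp h G := by
  have hsub : infClosure S ⊆ {G | w ≤ compLp h G} := infClosure_min hS fun F hF G hG => by
    simp only [mem_ofPred_eq] at hF hG ⊢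
    rw [← Lp.coeFn_le] at hF hG ⊢
    filter_upwards [hF, hG, coeFn_compLp h F, coeFn_compLp h G, coeFn_compLp h (F ⊓ G),
      h.quasi.ae (Lp.coeFn_inf F G)] with x h1 h2 h3 h4 h5 h6
    rw [h5, h6]
    rw [h3] at h1
    rw [h4] at h2
    exact le_inf h1 h2
  exact hsub hG

/-- Bounds by relaxed slopes along a map pass to the minimal relaxed slope. -/
theorem le_compLp_minSlope {Ω : Type*} [MeasurableSpace Ω] {μ : Measure Ω} {φ : Ω → X}
    (h : BoundedCompression φ μ m) {g : Sobolev p m} {w : Lp ℝ p μ}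
    (hw : ∀ G ∈ relaxedSlopes (g : Lp ℝ p m), w ≤ compLp h G) : w ≤ compLp h (minSlope g) := by
  obtain ⟨b, hb, hlim⟩ := exists_tendsto_of_isGLB (MemSobolev.relaxedSlopes_nonempty g.2)
    (isGLB_minSlope g)
  exact ge_of_tendsto' (((continuous_compLp h).tendsto _).comp hlim)
    fun n => le_compLp_of_mem_infClosure h hw (hb n)

end SpeedAndMinimalSlope

/-! ### Passage to the limit and construction of the dual element. -/

section WeakLimits

variable {X : Type*} [MetricSpace X] [SecondCountableTopology X] {p q : ℝ≥0∞}
  [hp : FiniteExponent p] [hq : FiniteExponent q] [hpq : ENNReal.HolderConjugate p q]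
  [MeasurableSpace X] [BorelSpace X] {m : Measure X} {π : Measure C(I, X)}

/-- If `W^{1,p}(X)` is separable, a subsequence of the quotients `(g ∘ e_t - g ∘ e_0) / E_{q,t}`
converges weakly in `L^p(π)`, simultaneously for all `g ∈ W^{1,p}(X)`. -/
theorem IsTestPlan.exists_weak_limit [IsLocallyFiniteMeasure m] (hsep : SeparableSobolev p m)
    (h : IsTestPlan q m π) {t : ℕ → I} (ht0 : ∀ i, 0 < t i) (ht : Tendsto t atTop (𝓝 0)) :
    ∃ k : ℕ → ℕ, StrictMono k ∧ ∃ w : Sobolev p m →ₗ[ℝ] Lp ℝ p π,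
      (∀ (g : Sobolev p m) (u : Lp ℝ q π),
        Tendsto (fun j => pairing π p q u (h.quotientMap (ht0 (k j)) g)) atTop
          (𝓝 (pairing π p q u (w g)))) ∧
      ∀ g, |w g| ≤ compLp (h.boundedCompression 0) (minSlope g) := by
  have := h.isProbabilityMeasure
  obtain ⟨C, -, hC⟩ := h.compression
  obtain ⟨D, hD, hdense⟩ := hsep
  set c : ℝ := ((C : ℝ≥0∞) ^ (1 / p.toReal)).toReal with hc
  have hc0 : 0 ≤ c := ENNReal.toReal_nonneg
  obtain ⟨k, hk, w, hw⟩ := exists_subseq_tendsto_pairing (q := q)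
    (fun i => h.quotientMap (p := p) (ht0 i)) hD
    (fun g ε hε => by
      have hδ : 0 < ε / (c + 1) := by positivity
      obtain ⟨g', hg', hlt⟩ := hdense g _ hδ
      obtain ⟨G, hG, hGn⟩ := exists_relaxedSlope_of_sobolevNorm_lt hδ hlt
      refine ⟨g', hg', fun i => (h.norm_quotientMap_le hC hG (ht0 i)).trans ?_⟩
      calc c * ‖G‖ ≤ (c + 1) * (ε / (c + 1)) := by gcongr; linarith
        _ = ε := by field_simp)
    (fun g => by
      obtain ⟨G, hG⟩ := MemSobolev.relaxedSlopes_nonempty g.2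
      obtain ⟨B, hB, hle⟩ := h.exists_dominating ht0 ht hG
      exact ⟨B, _, hB, hle⟩)
  -- The subsequence is already fixed, so the bound by `G ∘ e_0` is available for all relaxed slopes
  -- `G` simultaneously.
  refine ⟨k, hk, w, hw, fun g => le_compLp_minSlope _ fun G hG => ?_⟩
  obtain ⟨B, hB, hle⟩ := h.exists_dominating ht0 ht hG
  exact abs_le_of_tendsto_pairing (hw g) (hB.comp hk.tendsto_atTop) fun j => hle (k j)

/-- Replacing `A j` by its limit costs at most a constant times `‖A j - a‖`, because the `W j` are
bounded. -/
theorem tendsto_pairing_of_strong_weak {Ω : Type*} [MeasurableSpace Ω] {μ : Measure Ω}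
    {A : ℕ → Lp ℝ q μ} {a : Lp ℝ q μ} {W : ℕ → Lp ℝ p μ} {w : Lp ℝ p μ}
    (hA : Tendsto A atTop (𝓝 a)) {c : ℝ} (hc : ∀ j, ‖W j‖ ≤ c)
    (hW : Tendsto (fun j => pairing μ p q a (W j)) atTop (𝓝 (pairing μ p q a w))) :
    Tendsto (fun j => pairing μ p q (A j) (W j)) atTop (𝓝 (pairing μ p q a w)) := by
  have h1 : Tendsto (fun j => pairing μ p q (A j - a) (W j)) atTop (𝓝 0) := by
    have h2 : Tendsto (fun j => ‖pairing μ p q‖ * ‖A j - a‖ * c) atTop (𝓝 0) := by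
      simpa using ((tendsto_iff_norm_sub_tendsto_zero.1 hA).const_mul ‖pairing μ p q‖).mul_const c
    refine squeeze_zero_norm (fun j => ?_) h2
    rw [Real.norm_eq_abs]
    exact (abs_pairing_le _ _).trans (by gcongr; exact hc j)
  have h3 := h1.add hW
  rw [zero_add] at h3
  refine h3.congr fun j => ?_
  rw [map_sub, sub_apply, sub_add_cancel]

/-- `g ↦ w(g) N` as a linear map to `L^1`. -/
def mulRight {Ω V : Type*} [MeasurableSpace Ω] {μ : Measure Ω} [AddCommGroup V] [Module ℝ V]
    (w : V →ₗ[ℝ] Lp ℝ p μ) (N : Lp ℝ q μ) : V →ₗ[ℝ] Lp ℝ 1 μ :=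
  ((mulL1 μ p q).flip N).toLinearMap ∘ₗ w

theorem mulRight_apply {Ω V : Type*} [MeasurableSpace Ω] {μ : Measure Ω} [AddCommGroup V]
    [Module ℝ V] (w : V →ₗ[ℝ] Lp ℝ p μ) (N : Lp ℝ q μ) (v : V) :
    mulRight w N v = mulL1 μ p q (w v) N := rfl

/-- A linear map on `W^{1,p}(X)` dominated by `|D·|_p ∘ e_0` times a function `N` of `L^q(π)`
extends to an element of the dual of `e_0^* L^p(T^*X)`. -/
theorem IsTestPlan.exists_moduleDual_pullDifferential (h : IsTestPlan q m π)
    {ℓ : Sobolev p m →ₗ[ℝ] Lp ℝ 1 π} {N : Lp ℝ q π}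
    (hℓ : ∀ g, |ℓ g| ≤ mulL1 π p q (compLp (h.boundedCompression 0) (minSlope g)) N) :
    ∃ η : ModuleDual π (PullbackModule p (h.boundedCompression 0) (CotangentModule p m)),
      (∀ g, η.toCLM (h.pullDifferential g) = ℓ g) ∧
      ∀ v, |η.toCLM v| ≤ mulL1 π p q (LpNormedModule.pnorm (p := p) (μ := π) v) N := by
  -- Two extensions: across `e_0` to the cotangent module, then, the resulting bound being exactly
  -- domination by the pullback seminorm, to the pullback module.
  obtain ⟨T, hT, hTle⟩ := exists_lift (ψ := minSlopeSeminorm p m) (h.boundedCompression 0) hℓ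
  obtain ⟨η, hη, hηle⟩ := exists_moduleDual
    (ψ := pullbackSeminorm (p := p) (h.boundedCompression 0) (CotangentModule p m))
    (ℓ := T.toLinearMap) hTle
  exact ⟨η, fun g => (hη (differential g)).trans (lift_gen _ hT g), hηle⟩

theorem RepresentsGradient.exists_dual [IsLocallyFiniteMeasure m] (hsep : SeparableSobolev p m)
    {f : Sobolev p m} (h : RepresentsGradient q π f) {t : ℕ → I} (ht0 : ∀ i, 0 < t i)
    (ht : Tendsto t atTop (𝓝 0)) :
    ∃ k : ℕ → ℕ, StrictMono k ∧ ∃ η ∈ DualSet π p q (h.isTestPlan.pullDifferential f),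
      ∀ g : Sobolev p m, WeakTendstoL1 π
        (fun j γ => ((g : Lp ℝ p m) (γ (t (k j))) - (g : Lp ℝ p m) (γ 0)) / (t (k j) : ℝ))
        (η.toCLM (h.isTestPlan.pullDifferential g)) := by
  have := h.isTestPlan.isProbabilityMeasure
  set h0 := h.isTestPlan.boundedCompression 0 with hh0
  obtain ⟨k, hk, w, hw, hwle⟩ := h.isTestPlan.exists_weak_limit hsep ht0 ht
  set Z : Lp ℝ p π := compLp h0 (minSlope f) with hZ
  have hZ0 : ∀ᵐ γ ∂π, 0 ≤ Z γ := by
    filter_upwards [coeFn_compLp h0 (minSlope f),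
      h0.quasi.ae ((Lp.coeFn_nonneg _).2 (minSlope_nonneg f))] with γ h1 h2
    rw [h1]
    exact h2
  -- For `f` itself the quotients converge strongly by hypothesis, which identifies the weak limit.
  have hwf : w f = Z := eq_of_pairing_eq (q := q) fun u => tendsto_nhds_unique (hw f u)
    (((pairing π p q u).continuous.tendsto _).comp
      ((h.tendsto_quotientMap ht0 ht).comp hk.tendsto_atTop))
  set N : Lp ℝ q π := (memLp_rpow_div (q := q) Z).toLp _ with hN
  have hNZ : ∀ᵐ γ ∂π, N γ = Z γ ^ (p.toReal / q.toReal) := (memLp_rpow_div (q := q) Z).coeFn_toLp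
  have hN0 : 0 ≤ N := by
    rw [← Lp.coeFn_nonneg]
    filter_upwards [hNZ, hZ0] with γ h1 h2
    rw [h1]
    exact Real.rpow_nonneg h2 _
  obtain ⟨η, hη, hηle⟩ := h.isTestPlan.exists_moduleDual_pullDifferential (ℓ := mulRight w N)
    (N := N) fun g => by
      rw [mulRight_apply, ← Lp.coeFn_le]
      filter_upwards [Lp.coeFn_abs (mulL1 π p q (w g) N), coeFn_mulL1 (w g) N,
        coeFn_mulL1 (compLp h0 (minSlope g)) N, Lp.coeFn_abs (w g),
        (Lp.coeFn_le _ _).2 (hwle g), (Lp.coeFn_nonneg _).2 hN0] with γ h1 h2 h3 h4 h5 h6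
      rw [h1, h2, h3, abs_mul, abs_of_nonneg (show 0 ≤ N γ from h6)]
      rw [h4] at h5
      exact mul_le_mul_of_nonneg_right h5 h6
  have hpn : LpNormedModule.pnorm (p := p) (μ := π) (h.isTestPlan.pullDifferential f) = Z := by
    rw [IsTestPlan.pullDifferential, pnorm_pullbackMap, pnorm_differential]
  refine ⟨k, hk, η, mem_dualSet hN0 hηle ?_ ?_, fun g => ⟨fun j => ?_, L1.integrable_coeFn _, ?_⟩⟩
  -- Here `η(e_0^* d_p f) = Z · Z^{p/q}`, and conjugacy gives `1 + p / q = p`.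
  · rw [hη, mulRight_apply, hwf, hpn]
    filter_upwards [coeFn_mulL1 Z N, hNZ, hZ0] with γ h1 h2 h3
    have hconj : 1 + p.toReal / q.toReal = p.toReal := by
      have h4 := (ENNReal.HolderConjugate.toReal_iff (p := p) (q := q) one_lt_toReal).2 hpq
      have h5 := h4.inv_add_inv_eq_one
      have h6 := h4.pos.ne'
      have h7 := h4.symm.pos.ne'
      field_simp at h5 ⊢
      linarith
    have h4 : 0 < p.toReal := zero_lt_one.trans one_lt_toReal
    have h5 : 0 < q.toReal := zero_lt_one.trans one_lt_toReal
    rw [h1, h2]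
    nth_rw 1 [← Real.rpow_one (Z γ)]
    rw [← Real.rpow_add_of_nonneg h3 zero_le_one (by positivity), hconj]
  · rw [hpn]
    exact hNZ
  · exact ((((h.isTestPlan.boundedCompression _).memLp (g : Lp ℝ p m)).sub
      (h0.memLp (g : Lp ℝ p m))).integrable hp.one_lt.le).div_const _
  · intro u hu
    obtain ⟨C, -, hC⟩ := h.isTestPlan.compression
    obtain ⟨G, hG⟩ := MemSobolev.relaxedSlopes_nonempty g.2
    -- The bounded test function is absorbed into the strong factor: `u · E_{q,t} / t` converges to
    -- `u N` in `L^q(π)` and is paired with the weakly convergent quotients.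
    have hlim := tendsto_pairing_of_strong_weak
      ((((mulLp π q (hu.toLp u)).continuous.tendsto N).comp
        (h.tendsto_speed ht0 ht)).comp hk.tendsto_atTop)
      (fun j => h.isTestPlan.norm_quotientMap_le hC hG (ht0 (k j))) (hw g _)
    rw [pairing_apply] at hlim
    have e : ∫ γ, mulLp π q (hu.toLp u) N γ * w g γ ∂π =
        ∫ γ, u γ * η.toCLM (h.isTestPlan.pullDifferential g) γ ∂π := by
      refine integral_congr_ae ?_
      rw [hη, mulRight_apply]
      filter_upwards [coeFn_mulLp (hu.toLp u) N, hu.coeFn_toLp, coeFn_mulL1 (w g) N]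
        with γ h1 h2 h3
      rw [h1, h2, h3]
      ring
    rw [e] at hlim
    refine hlim.congr fun j => ?_
    simp only [Function.comp_apply]
    rw [pairing_apply]
    refine integral_congr_ae ?_
    filter_upwards [coeFn_mulLp (hu.toLp u) ((h.isTestPlan.memLp_speed (ht0 (k j))).toLp _),
      hu.coeFn_toLp, (h.isTestPlan.memLp_speed (ht0 (k j))).coeFn_toLp,
      h.isTestPlan.coeFn_quotientMap (ht0 (k j)) g, h.isTestPlan.ae_edist_le hG (ht0 (k j)),
      h.isTestPlan.ae_isACq] with γ h1 h2 h3 h4 h5 h6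
    rw [h1, h2, h3, h4, ← energyQuotient_mul h5 (curveEnergy_lt_top h6 (ht0 (k j))).ne]
    ring

end WeakLimits

end NormedModules

end

theorem proposition2p2 {X : Type*} [MetricSpace X] [CompleteSpace X]
    [TopologicalSpace.SeparableSpace X] [MeasurableSpace X] [BorelSpace X]
    (m : Measure X) (hm : ∀ B : Set X, Bornology.IsBounded B → m B < ∞)
    (p q : ℝ≥0∞) [NormedModules.FiniteExponent p] [NormedModules.FiniteExponent q]
    (hpq : p⁻¹ + q⁻¹ = 1)
    (hsep : NormedModules.SeparableSobolev p m)
    (f : NormedModules.Sobolev p m)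
    (π : Measure C(I, X)) (hπ : NormedModules.RepresentsGradient q π f)
    (t : ℕ → I) (ht0 : ∀ i, 0 < t i) (ht : Tendsto t atTop (𝓝 0)) :
    ∃ k : ℕ → ℕ, StrictMono k ∧
      ∃ η ∈ NormedModules.DualSet π p q (hπ.isTestPlan.pullDifferential f),
        ∀ g : NormedModules.Sobolev p m,
          NormedModules.WeakTendstoL1 π
            (fun j γ => ((g : Lp ℝ p m) (γ (t (k j))) - (g : Lp ℝ p m) (γ 0)) / (t (k j) : ℝ))
            (η.toCLM (hπ.isTestPlan.pullDifferential g)) := by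
  have : SecondCountableTopology X := UniformSpace.secondCountable_of_separable X
  have : ENNReal.HolderConjugate p q := ⟨by simpa using hpq⟩
  have : IsLocallyFiniteMeasure m :=
    ⟨fun x => ⟨Metric.ball x 1, Metric.ball_mem_nhds x one_pos, hm _ Metric.isBounded_ball⟩⟩
  exact hπ.exists_dual hsep ht0 ht
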